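/- Let $\mathbb T^2=\mathbb R^2/(2\pi\mathbb Z)^2$, let $\mathcal D'(\mathbb T^2)$ be the space of distributions on $\mathbb T^2$, and let $K$ be the mean-zero Green function of $-\Delta$ on $\mathbb T^2$, so that $-\Delta K=\delta_0-\frac1{4\pi^2}$. Put $G_1=\partial_1K$, $G_2=\partial_2K$ and $G=G_1-iG_2$. Let $\mathscr W=(\mathscr W_1,\mathscr W_2,\mathscr W_3)$ be a three-dimensional white noise on $\mathbb T^2$, defined on a probability space: almost surely, in $\mathcal D'(\mathbb T^2)$, $$\mathscr W_j=\eta_j+\operatorname{Re}\sum_{k\in\mathbb Z^2\setminus\{0\}}\eta_{kj}\,e^{i(k,x)},\qquad j=1,2,3,$$ where all the variables $\eta_j$, $\eta_{kj}$ are independent, the $\eta_j$ are standard real Gaussian variables, and the $\eta_{kj}$ are identically distributed complex Gaussian variables with independent centred real and imaginary parts of one common variance $v\ge 0$ ($v=\frac12$ and $v=1$ are the usual normalizations of a standard complex Gaussian variable). Some of the components $\mathscr W_j$ may instead be of zero mean, that is, with $\eta_j$ replaced by $0$. Let $\rho$ be a mollifier on $\mathbb R^2$ (smooth, nonnegative,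 supported in the closed unit ball, of integral one), $\rho_\varepsilon(x)=\varepsilon^{-2}\rho(x/\varepsilon)$, and for $\varepsilon>0$ and $k=1,2,3$ put $$\mathscr W^\varepsilon_k=\rho_\varepsilon*\mathscr W_k,\qquad \xi^\varepsilon_k=2iG*\mathscr W^\varepsilon_k,\qquad \xi^\varepsilon_{1k}=2G_1*\mathscr W^\varepsilon_k,\qquad \xi^\varepsilon_{2k}=2G_2*\mathscr W^\varepsilon_k,$$ so that $\xi^\varepsilon_k=\xi^\varepsilon_{2k}+i\xi^\varepsilon_{1k}$; put also $\xi_{1k}=2G_1*\mathscr W_k$, $\xi_{2k}=2G_2*\mathscr W_k$, and $\theta^\varepsilon=\xi^\varepsilon\times\overline{\xi^\varepsilon}$. Indices are taken modulo $3$. Then, almost surely, the following holds. (1) For all $\varepsilon>0$ and $j=1,2,3$, in $C^\infty(\mathbb T^2)$, $$\theta^\varepsilon_j=4i\Big(\partial_1\big[(K*\mathscr W^\varepsilon_{j+1}-A)\,\xi^\varepsilon_{2,j+2}\big]-\partial_2\big[(K*\mathscr W^\varepsilon_{j+1}-A)\,\xi^\varepsilon_{1,j+2}\big]\Big),$$ both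 for $A=0$ and for $A=(K*\mathscr W^\varepsilon_{j+1})(x)$ with an arbitrary $x\in\mathbb T^2$. (2) The limit $\theta=\lim_{\varepsilon\to0}\theta^\varepsilon$ exists in $\mathcal D'(\mathbb T^2)$. (3) Each $K*\mathscr W_j$ is a continuous function on $\mathbb T^2$, and for $j=1,2,3$ $$\theta_j=4i\Big(\partial_1\big[(K*\mathscr W_{j+1}-A)\,\xi_{2,j+2}\big]-\partial_2\big[(K*\mathscr W_{j+1}-A)\,\xi_{1,j+2}\big]\Big),$$ both for $A=0$ and for $A=(K*\mathscr W_{j+1})(x)$ with an arbitrary $x\in\mathbb T^2$. Here the products in square brackets are Young products: for every $\kappa\in(0,\frac12)$ the first factor lies in the little Hölder–Zygmund space of exponent $1-\kappa$ (the closure of $C^\infty(\mathbb T^2)$ in the Hölder–Zygmund space), the second one in that of exponent $-\kappa$, and the product is the value of the unique continuous bilinear map from the product of these two spaces to the second one that extends the pointwise product of smooth functions. -/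

import Mathlib

open MeasureTheory ProbabilityTheory Filter Topology
open scoped NNReal ENNReal

namespace Torus

noncomputable section

open scoped ContDiff

/-! ### Test functions on the torus -/

/-- The plane; the torus is its quotient by the lattice `(2πℤ)²`, and functions on the torus are
`2π`-periodic functions on the plane. -/
abbrev E : Type := EuclideanSpace ℝ (Fin 2)

/-- The lattice vector `2πn`. -/
def lat (n : Fin 2 → ℤ) : E := WithLp.toLp 2 fun i => 2 * Real.pi * (n i : ℝ)

/-- The partial derivative `∂ᵢ f`. -/
def pd (i : Fin 2) (f : E → ℂ) : E → ℂ :=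
  fun x => fderiv ℝ f x (EuclideanSpace.single i (1 : ℝ))

/-- The iterated partial derivative along a word `l` (of order `l.length`). -/
def pds (l : List (Fin 2)) (f : E → ℂ) : E → ℂ := l.foldr pd f

/-- The algebra of smooth periodic complex functions. -/
def smoothFns : Subalgebra ℂ (E → ℂ) where
  carrier := {f | ContDiff ℝ ∞ f ∧ ∀ n x, f (x + lat n) = f x}
  mul_mem' := by
    rintro f g ⟨hf, hf'⟩ ⟨hg, hg'⟩
    exact ⟨hf.mul hg, fun n x => by simp [hf', hg']⟩
  add_mem' := by
    rintro f g ⟨hf, hf'⟩ ⟨hg, hg'⟩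
    exact ⟨hf.add hg, fun n x => by simp [hf', hg']⟩
  algebraMap_mem' := fun c => ⟨contDiff_const, fun _ _ => rfl⟩

/-- The space of test functions on the torus: smooth periodic complex functions. -/
abbrev TestFn : Type := smoothFns

namespace TestFn

theorem smooth (φ : TestFn) : ContDiff ℝ ∞ (φ : E → ℂ) := φ.2.1

theorem periodic (φ : TestFn) (n : Fin 2 → ℤ) (x : E) : φ.1 (x + lat n) = φ.1 x := φ.2.2 n x

theorem differentiable (φ : TestFn) : Differentiable ℝ (φ : E → ℂ) :=
  φ.smooth.differentiable (by simp)

/-- `∂ᵢ` on test functions. -/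
def deriv (i : Fin 2) : TestFn →ₗ[ℂ] TestFn where
  toFun φ := ⟨pd i φ.1, by
    constructor
    · exact (φ.smooth.fderiv_right (m := ∞) (by simp)).clm_apply contDiff_const
    · intro n x
      have h : (fun y => φ.1 (y + lat n)) = φ.1 := funext fun y => φ.periodic n y
      have := fderiv_comp_add_right (𝕜 := ℝ) (f := φ.1) (x := x) (lat n)
      rw [h] at this
      simp only [pd, this]⟩
  map_add' φ ψ := by
    ext x
    change fderiv ℝ (φ.1 + ψ.1) x _ = fderiv ℝ φ.1 x _ + fderiv ℝ ψ.1 x _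
    rw [fderiv_add (φ.differentiable x) (ψ.differentiable x)]
    rfl
  map_smul' c φ := by
    ext x
    change fderiv ℝ (c • φ.1) x _ = c • fderiv ℝ φ.1 x _
    rw [fderiv_const_smul (φ.differentiable x) c]
    rfl

/-- Iterated partial derivatives on test functions. -/
def derivs : List (Fin 2) → TestFn →ₗ[ℂ] TestFn
  | [] => LinearMap.id
  | i :: l => deriv i ∘ₗ derivs l

theorem coe_derivs (l : List (Fin 2)) (φ : TestFn) : (derivs l φ).1 = pds l φ.1 := by
  induction l with
  | nil => rfl
  | cons i l ih =>
    change pd i (derivs l φ).1 = pd i (pds l φ.1)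
    rw [ih]

theorem deriv_comm (i j : Fin 2) (φ : TestFn) : deriv i (deriv j φ) = deriv j (deriv i φ) := by
  have key : ∀ (a b : Fin 2) (x : E), (deriv a (deriv b φ)).1 x =
      fderiv ℝ (fderiv ℝ φ.1) x (EuclideanSpace.single a (1 : ℝ))
        (EuclideanSpace.single b (1 : ℝ)) := by
    intro a b x
    change fderiv ℝ (fun y => fderiv ℝ φ.1 y (EuclideanSpace.single b (1 : ℝ))) x _ = _
    have hd : DifferentiableAt ℝ (fderiv ℝ φ.1) x :=
      ((φ.smooth.fderiv_right (m := ∞) (by simp)).differentiable (by simp)) x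
    rw [fderiv_clm_apply hd (differentiableAt_const _)]
    simp
  ext x
  rw [key, key]
  exact (φ.smooth.contDiffAt.isSymmSndFDerivAt
    (by simpa using WithTop.coe_le_coe.2 (le_top : (2 : ℕ∞) ≤ ⊤))) _ _

theorem derivs_deriv (l : List (Fin 2)) (i : Fin 2) (φ : TestFn) :
    derivs l (deriv i φ) = deriv i (derivs l φ) := by
  induction l with
  | nil => rfl
  | cons j l ih =>
    change deriv j (derivs l (deriv i φ)) = deriv i (deriv j (derivs l φ))
    rw [ih, deriv_comm]

theorem bounded (φ : TestFn) : ∃ M, ∀ x, ‖φ.1 x‖ ≤ M := by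
  obtain ⟨M, hM⟩ := ((isCompact_closedBall (0 : E) (4 * Real.pi)).image
    φ.smooth.continuous).isBounded.exists_norm_le
  refine ⟨M, fun x => ?_⟩
  let n : Fin 2 → ℤ := fun i => - round (x i / (2 * Real.pi))
  rw [← φ.periodic n x]
  apply hM
  refine ⟨_, ?_, rfl⟩
  have hpi := Real.pi_pos
  have hc : ∀ i, |(x + lat n) i| ≤ Real.pi := by
    intro i
    have h1 := abs_sub_round (x i / (2 * Real.pi))
    have h2 : (x + lat n) i = (x i / (2 * Real.pi) - round (x i / (2 * Real.pi))) *
        (2 * Real.pi) := by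
      simp only [PiLp.add_apply, lat, n]
      push_cast
      field_simp
      ring
    rw [h2, abs_mul, abs_of_pos (by positivity : (0 : ℝ) < 2 * Real.pi)]
    nlinarith
  rw [mem_closedBall_zero_iff, EuclideanSpace.norm_eq, Fin.sum_univ_two]
  rw [Real.sqrt_le_left (by positivity)]
  have h0 := hc 0
  have h1 := hc 1
  have e0 : ‖(x + lat n) 0‖ ≤ Real.pi := h0
  have e1 : ‖(x + lat n) 1‖ ≤ Real.pi := h1
  have := norm_nonneg ((x + lat n) 0)
  have := norm_nonneg ((x + lat n) 1)
  nlinarith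

theorem eq_sum_single (h : E) : h = ∑ i, h i • EuclideanSpace.single i (1 : ℝ) := by
  ext j
  fin_cases j <;> simp

theorem norm_coord_le (h : E) (i : Fin 2) : ‖h i‖ ≤ ‖h‖ := PiLp.norm_apply_le h i

theorem fderiv_apply (φ : TestFn) (x h : E) :
    fderiv ℝ φ.1 x h = ∑ i, (h i : ℂ) * (deriv i φ).1 x := by
  conv_lhs => rw [eq_sum_single h, map_sum]
  refine Finset.sum_congr rfl fun i _ => ?_
  rw [map_smul]
  change (h i) • (deriv i φ).1 x = _
  simp

theorem fderiv_bounded (φ : TestFn) : ∃ M, 0 ≤ M ∧ ∀ x, ‖fderiv ℝ φ.1 x‖ ≤ M := by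
  choose M hM using fun i => bounded (deriv i φ)
  have hM0 : ∀ i, 0 ≤ M i := fun i => (norm_nonneg _).trans (hM i 0)
  refine ⟨∑ i, M i, Finset.sum_nonneg fun i _ => hM0 i, fun x => ?_⟩
  refine ContinuousLinearMap.opNorm_le_bound _ (Finset.sum_nonneg fun i _ => hM0 i) fun h => ?_
  rw [fderiv_apply, Finset.sum_mul]
  refine (norm_sum_le _ _).trans (Finset.sum_le_sum fun i _ => ?_)
  rw [norm_mul, mul_comm]
  refine mul_le_mul (hM i x) ?_ (norm_nonneg _) (hM0 i)
  rw [Complex.norm_real]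
  exact norm_coord_le h i

theorem lipschitz (φ : TestFn) : ∃ M, 0 ≤ M ∧ ∀ x y, ‖φ.1 y - φ.1 x‖ ≤ M * ‖y - x‖ := by
  obtain ⟨M, hM0, hM⟩ := fderiv_bounded φ
  exact ⟨M, hM0, fun x y => convex_univ.norm_image_sub_le_of_norm_fderiv_le
    (fun z _ => φ.differentiable z) (fun z _ => hM z) (Set.mem_univ _) (Set.mem_univ _)⟩

/-- First order Taylor expansion with a uniform remainder. -/
theorem taylor (φ : TestFn) : ∃ M, ∀ x h,
    ‖φ.1 (x + h) - φ.1 x - ∑ i, (h i : ℂ) * (deriv i φ).1 x‖ ≤ M * ‖h‖ ^ 2 := by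
  choose M hM0 hM using fun i => lipschitz (deriv i φ)
  refine ⟨∑ i, M i, fun x h => ?_⟩
  have hS : 0 ≤ ∑ i, M i := Finset.sum_nonneg fun i _ => hM0 i
  have hb : ∀ z ∈ Metric.closedBall x ‖h‖,
      ‖fderiv ℝ φ.1 z - fderiv ℝ φ.1 x‖ ≤ (∑ i, M i) * ‖h‖ := by
    intro z hz
    have hz' : ‖z - x‖ ≤ ‖h‖ := by simpa [dist_eq_norm] using hz
    refine ContinuousLinearMap.opNorm_le_bound _ (by positivity) fun v => ?_
    rw [sub_apply, fderiv_apply, fderiv_apply, ← Finset.sum_sub_distrib,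
      Finset.sum_mul, Finset.sum_mul]
    refine (norm_sum_le _ _).trans (Finset.sum_le_sum fun i _ => ?_)
    rw [← mul_sub, norm_mul, mul_comm]
    refine mul_le_mul ((hM i x z).trans (mul_le_mul_of_nonneg_left hz' (hM0 i))) ?_
      (norm_nonneg _) (mul_nonneg (hM0 i) (norm_nonneg _))
    rw [Complex.norm_real]
    exact norm_coord_le v i
  have := (convex_closedBall x ‖h‖).norm_image_sub_le_of_norm_fderiv_le'
    (fun z _ => φ.differentiable z) hb (Metric.mem_closedBall_self (norm_nonneg h))
    (y := x + h) (by simp [dist_eq_norm])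
  rw [add_sub_cancel_left, fderiv_apply] at this
  refine this.trans (le_of_eq (by ring))

/-- `(translate x φ)(y) = φ(x + y)`. -/
def translate (x : E) : TestFn →ₗ[ℂ] TestFn where
  toFun φ := ⟨fun y => φ.1 (x + y), φ.smooth.comp (contDiff_const.add contDiff_id),
    fun n y => by
      change φ.1 (x + (y + lat n)) = φ.1 (x + y)
      rw [← add_assoc, φ.periodic]⟩
  map_add' _ _ := rfl
  map_smul' _ _ := rfl

/-- `(reflect φ)(y) = φ(-y)`. -/
def reflect (φ : TestFn) : TestFn :=
  ⟨fun y => φ.1 (-y), φ.smooth.comp contDiff_neg, fun n y => by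
    have h := φ.periodic (-n) (-y)
    have h2 : lat (-n) = - lat n := by
      ext i
      simp [lat]
    rw [h2] at h
    change φ.1 (-(y + lat n)) = φ.1 (-y)
    rw [neg_add, h]⟩

/-- Pointwise complex conjugate. -/
def conj (φ : TestFn) : TestFn :=
  ⟨fun y => starRingEnd ℂ (φ.1 y), Complex.conjCLE.contDiff.comp φ.smooth,
    fun n y => congrArg (starRingEnd ℂ) (φ.periodic n y)⟩

theorem deriv_translate (i : Fin 2) (x : E) (φ : TestFn) :
    deriv i (translate x φ) = translate x (deriv i φ) := by
  ext y
  change fderiv ℝ (fun z => φ.1 (x + z)) y _ = fderiv ℝ φ.1 (x + y) _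
  rw [fderiv_comp_add_left]

theorem derivs_translate (l : List (Fin 2)) (x : E) (φ : TestFn) :
    derivs l (translate x φ) = translate x (derivs l φ) := by
  induction l with
  | nil => rfl
  | cons j l ih =>
    change deriv j (derivs l (translate x φ)) = translate x (deriv j (derivs l φ))
    rw [ih, deriv_translate]

end TestFn

/-! ### Distributions on the torus -/

/-- All partial derivatives of `f` of order at most `N` are bounded by `B` in the sup norm. -/
def SupBound (N : ℕ) (B : ℝ) (f : E → ℂ) : Prop :=
  ∀ l : List (Fin 2), l.length ≤ N → ∀ x, ‖pds l f x‖ ≤ B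

theorem SupBound.mono {N M : ℕ} {B : ℝ} {f : E → ℂ} (h : SupBound M B f) (hNM : N ≤ M) :
    SupBound N B f := fun l hl x => h l (hl.trans hNM) x

theorem SupBound.nonneg {N : ℕ} {B : ℝ} {f : E → ℂ} (h : SupBound N B f) : 0 ≤ B :=
  (norm_nonneg _).trans (h [] (Nat.zero_le _) 0)

/-- The linear functionals on test functions that are bounded by a multiple of one of the
seminorms `max_{|k| ≤ N} ‖∂ᵏ φ‖_∞`, i.e. the continuous ones. -/
def contFunctionals : Submodule ℂ (Module.Dual ℂ TestFn) where
  carrier := {T | ∃ (N : ℕ) (C : ℝ), ∀ (φ : TestFn) (B : ℝ), SupBound N B φ.1 → ‖T φ‖ ≤ C * B}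
  add_mem' := by
    rintro S T ⟨N, C, h⟩ ⟨M, D, h'⟩
    refine ⟨max N M, C + D, fun φ B hB => ?_⟩
    rw [add_mul]
    exact (norm_add_le _ _).trans (add_le_add (h φ B (hB.mono (le_max_left _ _)))
      (h' φ B (hB.mono (le_max_right _ _))))
  zero_mem' := ⟨0, 0, fun φ B _ => by simp⟩
  smul_mem' := by
    rintro c T ⟨N, C, h⟩
    refine ⟨N, ‖c‖ * C, fun φ B hB => ?_⟩
    rw [LinearMap.smul_apply, norm_smul, mul_assoc]
    exact mul_le_mul_of_nonneg_left (h φ B hB) (norm_nonneg _)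

/-- The space of distributions on the torus. -/
abbrev Dist : Type := contFunctionals

/-- The integral over the torus (with respect to Lebesgue measure, of total mass `4π²`). -/
def tint (f : E → ℂ) : ℂ :=
  ∫ s in (-Real.pi)..Real.pi, ∫ t in (-Real.pi)..Real.pi, f !₂[s, t]

theorem continuous_pair : Continuous fun p : ℝ × ℝ => (!₂[p.1, p.2] : E) := by
  refine (PiLp.continuous_toLp 2 _).comp (continuous_pi fun i => ?_)
  fin_cases i
  · exact continuous_fst
  · exact continuous_snd

theorem continuous_inner {f : E → ℂ} (hf : Continuous f) :
    Continuous fun s : ℝ => ∫ t in (-Real.pi)..Real.pi, f !₂[s, t] :=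
  intervalIntegral.continuous_parametric_intervalIntegral_of_continuous'
    (f := fun s t => f !₂[s, t]) (hf.comp continuous_pair) _ _

theorem tint_add {f g : E → ℂ} (hf : Continuous f) (hg : Continuous g) :
    tint (fun x => f x + g x) = tint f + tint g := by
  unfold tint
  rw [← intervalIntegral.integral_add ((continuous_inner hf).intervalIntegrable _ _)
    ((continuous_inner hg).intervalIntegrable _ _)]
  congr 1
  ext s
  have hs : Continuous fun t : ℝ => (!₂[s, t] : E) :=
    continuous_pair.comp (Continuous.prodMk_right s)
  exact intervalIntegral.integral_add ((hf.comp hs).intervalIntegrable _ _)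
    ((hg.comp hs).intervalIntegrable _ _)

theorem tint_mul_left (c : ℂ) (f : E → ℂ) : tint (fun x => c * f x) = c * tint f := by
  simp [tint, intervalIntegral.integral_const_mul]

theorem norm_tint_le {f : E → ℂ} {B : ℝ} (hB : ∀ x, ‖f x‖ ≤ B) :
    ‖tint f‖ ≤ 4 * Real.pi ^ 2 * B := by
  have hpi := Real.pi_pos
  have h1 : ∀ s : ℝ, ‖∫ t in (-Real.pi)..Real.pi, f !₂[s, t]‖ ≤ B * (2 * Real.pi) := by
    intro s
    refine (intervalIntegral.norm_integral_le_of_norm_le_const fun t _ => hB _).trans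
      (le_of_eq ?_)
    rw [abs_of_pos (by linarith)]
    ring
  refine (intervalIntegral.norm_integral_le_of_norm_le_const fun s _ => h1 s).trans
    (le_of_eq ?_)
  rw [abs_of_pos (by linarith)]
  ring

/-- The distribution `φ ↦ ∫ f φ` attached to a smooth function `f` on the torus. -/
def ofFn (f : TestFn) : Dist :=
  ⟨{ toFun := fun φ => tint fun x => f.1 x * φ.1 x
     map_add' := fun φ ψ => by
      refine Eq.trans (congrArg tint (funext fun x => ?_))
        (tint_add (f := fun x => f.1 x * φ.1 x) (g := fun x => f.1 x * ψ.1 x)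
          (f.smooth.continuous.mul φ.smooth.continuous)
          (f.smooth.continuous.mul ψ.smooth.continuous))
      exact mul_add _ _ _
     map_smul' := fun c φ => by
      rw [RingHom.id_apply, smul_eq_mul, ← tint_mul_left]
      congr 1
      ext x
      exact mul_left_comm _ _ _ }, by
    obtain ⟨M, hM⟩ := f.bounded
    have hM0 : 0 ≤ M := (norm_nonneg _).trans (hM 0)
    refine ⟨0, 4 * Real.pi ^ 2 * M, fun φ B hB => ?_⟩
    rw [mul_assoc]
    refine norm_tint_le fun x => ?_
    rw [norm_mul]
    exact mul_le_mul (hM x) (hB [] le_rfl x) (norm_nonneg _) hM0⟩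

/-- `∂ᵢ` on distributions: `(∂ᵢ T)(φ) = -T(∂ᵢ φ)`. -/
def Dist.deriv (i : Fin 2) (T : Dist) : Dist :=
  ⟨-(T.1 ∘ₗ TestFn.deriv i), by
    obtain ⟨N, C, h⟩ := T.2
    refine ⟨N + 1, C, fun φ B hB => ?_⟩
    rw [LinearMap.neg_apply, norm_neg]
    refine h _ B fun l hl x => ?_
    rw [← TestFn.coe_derivs, TestFn.derivs_deriv]
    change ‖(TestFn.derivs (i :: l) φ).1 x‖ ≤ B
    rw [TestFn.coe_derivs]
    exact hB _ (by simpa using hl) x⟩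

/-! ### Convolutions -/

theorem hasFDerivAt_corr (T : Dist) (φ : TestFn) (x : E) :
    HasFDerivAt (fun x => T.1 (TestFn.translate x φ))
      (∑ i, (EuclideanSpace.proj i : E →L[ℝ] ℝ).smulRight
        (T.1 (TestFn.translate x (TestFn.deriv i φ)))) x := by
  obtain ⟨N, C, hC⟩ := T.2
  choose M hM using fun l => TestFn.taylor (TestFn.derivs l φ)
  obtain ⟨M', hM'⟩ := ((List.finite_length_le (Fin 2) N).image M).bddAbove
  have key : ∀ h : E, ‖T.1 (TestFn.translate (x + h) φ) - T.1 (TestFn.translate x φ) -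
      ∑ i, (h i : ℂ) * T.1 (TestFn.translate x (TestFn.deriv i φ))‖ ≤ C * (M' * ‖h‖ ^ 2) := by
    intro h
    have e : T.1 (TestFn.translate (x + h) φ) - T.1 (TestFn.translate x φ) -
        ∑ i, (h i : ℂ) * T.1 (TestFn.translate x (TestFn.deriv i φ)) =
        T.1 (TestFn.translate (x + h) φ - TestFn.translate x φ -
          ∑ i, (h i : ℂ) • TestFn.translate x (TestFn.deriv i φ)) := by
      simp only [map_sub, map_sum, map_smul, smul_eq_mul]
    rw [e]
    refine hC _ _ fun l hl y => ?_
    rw [← TestFn.coe_derivs]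
    simp only [map_sub, map_sum, map_smul, TestFn.derivs_translate, TestFn.derivs_deriv]
    have := hM l (x + y) h
    have hle : M l ≤ M' := hM' ⟨l, hl, rfl⟩
    refine le_trans (le_of_eq ?_) (this.trans (mul_le_mul_of_nonneg_right hle (by positivity)))
    congr 1
    simp only [Fin.sum_univ_two]
    change (TestFn.derivs l φ).1 (x + h + y) - (TestFn.derivs l φ).1 (x + y) -
      ((h 0 : ℂ) * (TestFn.deriv 0 (TestFn.derivs l φ)).1 (x + y) +
        (h 1 : ℂ) * (TestFn.deriv 1 (TestFn.derivs l φ)).1 (x + y)) = _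
    rw [add_right_comm]
  have hO : (fun z => T.1 (TestFn.translate z φ) - T.1 (TestFn.translate x φ) -
      ∑ i, ((z - x) i : ℂ) * T.1 (TestFn.translate x (TestFn.deriv i φ)))
      =O[𝓝 x] fun z => ‖z - x‖ ^ 2 := by
    refine Asymptotics.IsBigO.of_bound (C * M') (Eventually.of_forall fun z => ?_)
    have := key (z - x)
    rw [add_sub_cancel] at this
    refine this.trans (le_of_eq ?_)
    rw [norm_pow, norm_norm]
    ring
  have h0 := hO.hasFDerivAt (𝕜 := ℝ) one_lt_two
  have hL := ContinuousLinearMap.hasFDerivAt (x := x)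
    (∑ i, (EuclideanSpace.proj i : E →L[ℝ] ℝ).smulRight
      (T.1 (TestFn.translate x (TestFn.deriv i φ))))
  have := (h0.add hL).add_const (T.1 (TestFn.translate x φ) -
    (∑ i, (EuclideanSpace.proj i : E →L[ℝ] ℝ).smulRight
      (T.1 (TestFn.translate x (TestFn.deriv i φ)))) x)
  rw [zero_add] at this
  refine this.congr_of_eventuallyEq (Eventually.of_forall fun z => ?_)
  simp [Fin.sum_univ_two]
  ring

theorem contDiff_corr (T : Dist) (n : ℕ) : ∀ φ : TestFn,
    ContDiff ℝ n (fun x => T.1 (TestFn.translate x φ)) := by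
  induction n with
  | zero =>
    intro φ
    exact contDiff_zero.2 (continuous_iff_continuousAt.2 fun x =>
      (hasFDerivAt_corr T φ x).continuousAt)
  | succ n ih =>
    intro φ
    push_cast
    rw [contDiff_succ_iff_fderiv]
    refine ⟨fun x => (hasFDerivAt_corr T φ x).differentiableAt, by simp, ?_⟩
    have : fderiv ℝ (fun x => T.1 (TestFn.translate x φ)) = fun x =>
        ∑ i, (EuclideanSpace.proj i : E →L[ℝ] ℝ).smulRight
          (T.1 (TestFn.translate x (TestFn.deriv i φ))) :=
      funext fun x => (hasFDerivAt_corr T φ x).fderiv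
    rw [this]
    exact ContDiff.sum fun i _ => contDiff_const.smulRight (ih _)

/-- The test function `x ↦ T(y ↦ φ(x + y))`. -/
def corr (T : Dist) : TestFn →ₗ[ℂ] TestFn where
  toFun φ := ⟨fun x => T.1 (TestFn.translate x φ),
    contDiff_infty.2 fun n => contDiff_corr T n φ, fun n x => congrArg T.1
      (Subtype.ext (funext fun y => by
        change φ.1 (x + lat n + y) = φ.1 (x + y)
        rw [add_right_comm, φ.periodic]))⟩
  map_add' φ ψ := by
    ext x
    exact (congrArg T.1 ((TestFn.translate x).map_add φ ψ)).trans (T.1.map_add _ _)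
  map_smul' c φ := by
    ext x
    exact (congrArg T.1 ((TestFn.translate x).map_smul c φ)).trans (T.1.map_smul _ _)

theorem deriv_corr (T : Dist) (i : Fin 2) (φ : TestFn) :
    TestFn.deriv i (corr T φ) = corr T (TestFn.deriv i φ) := by
  ext x
  change fderiv ℝ (fun x => T.1 (TestFn.translate x φ)) x _ = _
  rw [(hasFDerivAt_corr T φ x).fderiv]
  fin_cases i <;> simp [corr]

theorem derivs_corr (T : Dist) (l : List (Fin 2)) (φ : TestFn) :
    TestFn.derivs l (corr T φ) = corr T (TestFn.derivs l φ) := by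
  induction l with
  | nil => rfl
  | cons j l ih =>
    change TestFn.deriv j (TestFn.derivs l (corr T φ)) = corr T (TestFn.deriv j _)
    rw [ih, deriv_corr]

/-- The convolution of a distribution with a smooth function: `(T ∗ f)(x) = T(y ↦ f(x - y))`. -/
def Dist.convFn (T : Dist) (f : TestFn) : TestFn := (corr T f.reflect).reflect

/-- The convolution of two distributions: `(S ∗ T)(φ) = S(x ↦ T(y ↦ φ(x + y)))`. -/
def Dist.conv (S T : Dist) : Dist :=
  ⟨S.1 ∘ₗ corr T, by
    obtain ⟨N, C, hS⟩ := S.2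
    obtain ⟨M, D, hT⟩ := T.2
    refine ⟨N + M, C * D, fun φ B hB => ?_⟩
    rw [mul_assoc]
    refine hS _ _ fun l hl x => ?_
    rw [← TestFn.coe_derivs, derivs_corr]
    refine hT _ _ fun l' hl' y => ?_
    rw [← TestFn.coe_derivs, TestFn.derivs_translate]
    change ‖(TestFn.derivs l' (TestFn.derivs l φ)).1 (x + y)‖ ≤ B
    have : TestFn.derivs l' (TestFn.derivs l φ) = TestFn.derivs (l' ++ l) φ := by
      induction l' with
      | nil => rfl
      | cons j l' ih =>
        change TestFn.deriv j (TestFn.derivs l' _) = TestFn.deriv j (TestFn.derivs (l' ++ l) φ)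
        rw [ih (by simp at hl'; omega)]
    rw [this, TestFn.coe_derivs]
    refine hB _ ?_ _
    rw [List.length_append]
    omega⟩

theorem convFn_apply (T : Dist) (f : TestFn) (x : E) :
    (T.convFn f).1 x = T.1 (TestFn.translate (-x) f.reflect) := rfl

/-! ### Fourier modes and the Green function of the Laplacian -/

/-- The Fourier mode `e_k(x) = exp(i (k, x))`. -/
def mode (k : Fin 2 → ℤ) : TestFn :=
  ⟨fun x => Complex.exp (Complex.I * (((k 0 : ℝ) * x 0 + (k 1 : ℝ) * x 1 : ℝ) : ℂ)), by
    constructor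
    · refine (contDiff_const.mul (Complex.ofRealCLM.contDiff.comp ?_)).cexp
      exact (contDiff_const.mul (EuclideanSpace.proj (0 : Fin 2) : E →L[ℝ] ℝ).contDiff).add
        (contDiff_const.mul (EuclideanSpace.proj (1 : Fin 2) : E →L[ℝ] ℝ).contDiff)
    · intro n x
      have := Complex.exp_int_mul_two_pi_mul_I (k 0 * n 0 + k 1 * n 1)
      have e : Complex.I * (((k 0 : ℝ) * (x + lat n) 0 + (k 1 : ℝ) * (x + lat n) 1 : ℝ) : ℂ) =
          Complex.I * (((k 0 : ℝ) * x 0 + (k 1 : ℝ) * x 1 : ℝ) : ℂ) +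
          ((k 0 * n 0 + k 1 * n 1 : ℤ) : ℂ) * (2 * Real.pi * Complex.I) := by
        simp only [PiLp.add_apply, lat]
        push_cast
        ring
      change Complex.exp (Complex.I *
        (((k 0 : ℝ) * (x + lat n) 0 + (k 1 : ℝ) * (x + lat n) 1 : ℝ) : ℂ)) = _
      rw [e, Complex.exp_add, this, mul_one]⟩

theorem norm_mode (k : Fin 2 → ℤ) (x : E) : ‖(mode k).1 x‖ = 1 := by
  change ‖Complex.exp (Complex.I * (((k 0 : ℝ) * x 0 + (k 1 : ℝ) * x 1 : ℝ) : ℂ))‖ = 1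
  rw [mul_comm, Complex.norm_exp_ofReal_mul_I]

theorem deriv_mul (i : Fin 2) (f g : TestFn) :
    TestFn.deriv i (f * g) = TestFn.deriv i f * g + f * TestFn.deriv i g := by
  ext x
  change fderiv ℝ (f.1 * g.1) x _ = fderiv ℝ f.1 x _ * g.1 x + f.1 x * fderiv ℝ g.1 x _
  rw [fderiv_mul (f.differentiable x) (g.differentiable x)]
  simp
  ring

theorem deriv_mode (i : Fin 2) (k : Fin 2 → ℤ) :
    TestFn.deriv i (mode k) = (Complex.I * (k i : ℂ)) • mode k := by
  ext x
  have hl : HasFDerivAt (fun x : E => Complex.I *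
      (((k 0 : ℝ) * x 0 + (k 1 : ℝ) * x 1 : ℝ) : ℂ))
      (Complex.I • (Complex.ofRealCLM.comp
        ((k 0 : ℝ) • (EuclideanSpace.proj (0 : Fin 2) : E →L[ℝ] ℝ) +
          (k 1 : ℝ) • (EuclideanSpace.proj (1 : Fin 2) : E →L[ℝ] ℝ)))) x := by
    refine HasFDerivAt.const_mul ?_ Complex.I
    refine Complex.ofRealCLM.hasFDerivAt.comp x ?_
    exact ((EuclideanSpace.proj (0 : Fin 2) : E →L[ℝ] ℝ).hasFDerivAt.const_mul _).add
      ((EuclideanSpace.proj (1 : Fin 2) : E →L[ℝ] ℝ).hasFDerivAt.const_mul _)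
  change fderiv ℝ (fun x : E => Complex.exp (Complex.I *
      (((k 0 : ℝ) * x 0 + (k 1 : ℝ) * x 1 : ℝ) : ℂ))) x (EuclideanSpace.single i (1 : ℝ)) =
      (Complex.I * (k i : ℂ)) * Complex.exp (Complex.I *
      (((k 0 : ℝ) * x 0 + (k 1 : ℝ) * x 1 : ℝ) : ℂ))
  rw [hl.cexp.fderiv]
  fin_cases i <;> simp <;> ring

theorem tint_deriv (i : Fin 2) (φ : TestFn) : tint (TestFn.deriv i φ).1 = 0 := by
  have hcd := (TestFn.deriv i φ).smooth.continuous
  have hline : ∀ (v : E) (j : Fin 2) (t : ℝ), HasDerivAt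
      (fun t : ℝ => φ.1 (v + t • EuclideanSpace.single j (1 : ℝ)))
      ((TestFn.deriv j φ).1 (v + t • EuclideanSpace.single j (1 : ℝ))) t := by
    intro v j t
    have h1 := (φ.differentiable (v + t • EuclideanSpace.single j (1 : ℝ))).hasFDerivAt
    have h2 : HasDerivAt (fun t : ℝ => v + t • EuclideanSpace.single j (1 : ℝ))
        (EuclideanSpace.single j (1 : ℝ)) t := by
      simpa using ((hasDerivAt_id t).smul_const (EuclideanSpace.single j (1 : ℝ))).const_add v
    exact h1.comp_hasDerivAt t h2
  have hzero : ∀ (v : E) (j : Fin 2), ∫ t in (-Real.pi)..Real.pi,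
      (TestFn.deriv j φ).1 (v + t • EuclideanSpace.single j (1 : ℝ)) = 0 := by
    intro v j
    have hc : Continuous fun t : ℝ => v + t • EuclideanSpace.single j (1 : ℝ) := by fun_prop
    rw [intervalIntegral.integral_eq_sub_of_hasDerivAt (fun t _ => hline v j t)
      (((TestFn.deriv j φ).smooth.continuous.comp hc).intervalIntegrable _ _)]
    have hp := φ.periodic (Pi.single j 1) (v + (-Real.pi) • EuclideanSpace.single j (1 : ℝ))
    rw [sub_eq_zero, ← hp]
    refine congrArg φ.1 ?_
    ext l
    fin_cases j <;> fin_cases l <;> simp [lat] <;> ring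
  unfold tint
  fin_cases i
  · rw [intervalIntegral_intervalIntegral_swap]
    · have : ∀ t : ℝ, ∫ s in (-Real.pi)..Real.pi, (TestFn.deriv 0 φ).1 !₂[s, t] = 0 := by
        intro t
        rw [← hzero !₂[0, t] 0]
        refine intervalIntegral.integral_congr fun s _ => congrArg (TestFn.deriv _ φ).1 ?_
        ext l
        fin_cases l <;> simp
      simp [this]
    · refine IntegrableOn.mono_set ?_
        (Set.prod_mono Set.uIoc_subset_uIcc Set.uIoc_subset_uIcc)
      exact ((hcd.comp continuous_pair).continuousOn).integrableOn_compact
        (isCompact_uIcc.prod isCompact_uIcc)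
  · have : ∀ s : ℝ, ∫ t in (-Real.pi)..Real.pi, (TestFn.deriv 1 φ).1 !₂[s, t] = 0 := by
      intro s
      rw [← hzero !₂[s, 0] 1]
      refine intervalIntegral.integral_congr fun t _ => congrArg (TestFn.deriv _ φ).1 ?_
      ext l
      fin_cases l <;> simp
    simp [this]

theorem ofFn_apply (f φ : TestFn) : (ofFn f).1 φ = tint (f * φ : TestFn).1 := rfl

theorem ofFn_mode_deriv (k : Fin 2 → ℤ) (i : Fin 2) (φ : TestFn) :
    (ofFn (mode k)).1 (TestFn.deriv i φ) = -(Complex.I * (k i : ℂ)) * (ofFn (mode k)).1 φ := by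
  have h := tint_deriv i (mode k * φ)
  have h1 : (ofFn (1 : TestFn)).1 (TestFn.deriv i (mode k * φ)) = 0 := by
    rw [ofFn_apply, one_mul, h]
  have h2 : ∀ g : TestFn, (ofFn (1 : TestFn)).1 (mode k * g) = (ofFn (mode k)).1 g := by
    intro g
    rw [ofFn_apply, ofFn_apply, one_mul]
  rw [deriv_mul, deriv_mode, smul_mul_assoc, map_add, map_smul, h2, h2] at h1
  rw [smul_eq_mul] at h1
  linear_combination h1

theorem ofFn_mode_bound (k : Fin 2 → ℤ) (φ : TestFn) (B : ℝ) (hB : SupBound 4 B φ.1) :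
    ‖(ofFn (mode k)).1 φ‖ ≤ 16 * Real.pi ^ 2 * B *
      ((1 + (k 0 : ℝ) ^ 2)⁻¹ * (1 + (k 1 : ℝ) ^ 2)⁻¹) := by
  have e : (ofFn (mode k)).1 (φ - TestFn.derivs [0, 0] φ - TestFn.derivs [1, 1] φ +
      TestFn.derivs [0, 0, 1, 1] φ) =
      (((1 + (k 0 : ℝ) ^ 2) * (1 + (k 1 : ℝ) ^ 2) : ℝ) : ℂ) * (ofFn (mode k)).1 φ := by
    simp only [TestFn.derivs, LinearMap.comp_apply, LinearMap.id_apply, map_add, map_sub,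
      ofFn_mode_deriv]
    push_cast
    have := Complex.I_sq
    ring_nf
    rw [show Complex.I ^ 4 = 1 from Complex.I_pow_four, this]
    ring
  have hb : ‖(ofFn (mode k)).1 (φ - TestFn.derivs [0, 0] φ - TestFn.derivs [1, 1] φ +
      TestFn.derivs [0, 0, 1, 1] φ)‖ ≤ 4 * Real.pi ^ 2 * (4 * B) := by
    refine norm_tint_le fun x => ?_
    rw [norm_mul, norm_mode, one_mul]
    have h0 := hB [] (by simp) x
    have h1 := hB [0, 0] (by simp) x
    have h2 := hB [1, 1] (by simp) x
    have h3 := hB [0, 0, 1, 1] (by simp) x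
    rw [← TestFn.coe_derivs] at h0 h1 h2 h3
    change ‖φ.1 x - (TestFn.derivs [0, 0] φ).1 x - (TestFn.derivs [1, 1] φ).1 x +
      (TestFn.derivs [0, 0, 1, 1] φ).1 x‖ ≤ _
    refine (norm_add_le _ _).trans ?_
    have e1 := norm_sub_le (φ.1 x - (TestFn.derivs [0, 0] φ).1 x) ((TestFn.derivs [1, 1] φ).1 x)
    have e2 := norm_sub_le (φ.1 x) ((TestFn.derivs [0, 0] φ).1 x)
    change ‖φ.1 x‖ ≤ B at h0
    linarith
  rw [e, norm_mul, Complex.norm_real, Real.norm_of_nonneg (by positivity)] at hb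
  rw [← mul_inv, ← div_eq_mul_inv, le_div_iff₀ (by positivity)]
  linarith

theorem summable_weight : Summable fun k : Fin 2 → ℤ =>
    (1 + (k 0 : ℝ) ^ 2)⁻¹ * (1 + (k 1 : ℝ) ^ 2)⁻¹ := by
  have h1 : Summable fun n : ℤ => (1 + (n : ℝ) ^ 2)⁻¹ := by
    have h := (Real.summable_one_div_int_pow (p := 2)).2 one_lt_two
    refine Summable.of_norm_bounded_eventually h ?_
    have : ∀ᶠ n : ℤ in cofinite, n ≠ 0 := by
      simpa using (Set.finite_singleton (0 : ℤ)).compl_mem_cofinite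
    filter_upwards [this] with n hn
    have hn' : (0 : ℝ) < (n : ℝ) ^ 2 := by positivity
    rw [Real.norm_of_nonneg (by positivity), one_div]
    exact inv_anti₀ hn' (by linarith)
  have h2 := h1.mul_of_nonneg h1 (fun n => by positivity) (fun n => by positivity)
  exact (finTwoArrowEquiv ℤ).summable_iff.2 h2

/-- The `k`-th Fourier coefficient of the Green function: `(4π² |k|²)⁻¹`, and `0` for `k = 0`. -/
def greenCoeff (k : Fin 2 → ℤ) : ℝ :=
  if k = 0 then 0 else (4 * Real.pi ^ 2 * ((k 0 : ℝ) ^ 2 + (k 1 : ℝ) ^ 2))⁻¹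

theorem greenCoeff_nonneg (k : Fin 2 → ℤ) : 0 ≤ greenCoeff k := by
  unfold greenCoeff
  split_ifs <;> positivity

theorem greenCoeff_le_one (k : Fin 2 → ℤ) : greenCoeff k ≤ 1 := by
  unfold greenCoeff
  split_ifs with h
  · exact zero_le_one
  · refine inv_le_one_of_one_le₀ ?_
    have hk : (1 : ℝ) ≤ (k 0 : ℝ) ^ 2 + (k 1 : ℝ) ^ 2 := by
      have : 1 ≤ k 0 ^ 2 + k 1 ^ 2 := by
        by_contra hc
        have h0 : k 0 = 0 := by nlinarith [sq_nonneg (k 0), sq_nonneg (k 1)]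
        have h1 : k 1 = 0 := by nlinarith [sq_nonneg (k 0), sq_nonneg (k 1)]
        exact h (by ext i; fin_cases i <;> simp [h0, h1])
      exact_mod_cast this
    nlinarith [Real.pi_gt_three]

theorem green_term_bound (k : Fin 2 → ℤ) (φ : TestFn) (B : ℝ) (hB : SupBound 4 B φ.1) :
    ‖(greenCoeff k : ℂ) * (ofFn (mode k)).1 φ‖ ≤ 16 * Real.pi ^ 2 * B *
      ((1 + (k 0 : ℝ) ^ 2)⁻¹ * (1 + (k 1 : ℝ) ^ 2)⁻¹) := by
  rw [norm_mul, Complex.norm_real, Real.norm_of_nonneg (greenCoeff_nonneg k)]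
  exact (mul_le_of_le_one_left (norm_nonneg _) (greenCoeff_le_one k)).trans
    (ofFn_mode_bound k φ B hB)

theorem exists_supBound (N : ℕ) (φ : TestFn) : ∃ B, SupBound N B φ.1 := by
  choose M hM using fun l => TestFn.bounded (TestFn.derivs l φ)
  obtain ⟨B, hB⟩ := ((List.finite_length_le (Fin 2) N).image M).bddAbove
  refine ⟨B, fun l hl x => ?_⟩
  rw [← TestFn.coe_derivs]
  exact (hM l x).trans (hB ⟨l, hl, rfl⟩)

theorem green_summable (φ : TestFn) :
    Summable fun k => (greenCoeff k : ℂ) * (ofFn (mode k)).1 φ := by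
  obtain ⟨B, hB⟩ := exists_supBound 4 φ
  exact Summable.of_norm_bounded (summable_weight.mul_left _)
    fun k => green_term_bound k φ B hB

/-- The mean-zero Green function of `-Δ` on the torus, as a distribution:
`K = (4π²)⁻¹ ∑_{k ≠ 0} |k|⁻² e_k`, so that `-ΔK = δ₀ - (4π²)⁻¹`. -/
def green : Dist :=
  ⟨{ toFun := fun φ => ∑' k, (greenCoeff k : ℂ) * (ofFn (mode k)).1 φ
     map_add' := fun φ ψ => by
      rw [← (green_summable φ).tsum_add (green_summable ψ)]
      exact tsum_congr fun k => by rw [map_add, mul_add]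
     map_smul' := fun c φ => by
      rw [RingHom.id_apply, smul_eq_mul, ← tsum_mul_left]
      exact tsum_congr fun k => by rw [map_smul, smul_eq_mul, mul_left_comm] }, by
    refine ⟨4, 16 * Real.pi ^ 2 * ∑' k : Fin 2 → ℤ,
      ((1 + (k 0 : ℝ) ^ 2)⁻¹ * (1 + (k 1 : ℝ) ^ 2)⁻¹), fun φ B hB => ?_⟩
    refine (tsum_of_norm_bounded (summable_weight.mul_left (16 * Real.pi ^ 2 * B)).hasSum
      fun k => green_term_bound k φ B hB).trans (le_of_eq ?_)
    rw [tsum_mul_left]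
    ring⟩

/-- `G₁ = ∂₁ K` and `G₂ = ∂₂ K` (for `i = 0, 1`). -/
def greenD (i : Fin 2) : Dist := green.deriv i

/-- `G = 2 ∂_z K = ∂₁ K - i ∂₂ K`. -/
def greenG : Dist := greenD 0 - Complex.I • greenD 1

/-! ### Periodized compactly supported functions and mollification -/

/-- Smooth compactly supported complex functions on the plane. -/
structure CcFn where
  toFun : E → ℂ
  smooth : ContDiff ℝ ∞ toFun
  compact : HasCompactSupport toFun

theorem finite_lat (R : ℝ) : {n : Fin 2 → ℤ | ‖lat n‖ ≤ R}.Finite := by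
  refine (Set.finite_Icc (fun _ : Fin 2 => -⌈R⌉) (fun _ => ⌈R⌉)).subset fun n hn => ?_
  have h : ∀ i, |n i| ≤ ⌈R⌉ := by
    intro i
    have h1 : ‖(lat n) i‖ ≤ R := (TestFn.norm_coord_le _ i).trans hn
    have h2 : (lat n) i = 2 * Real.pi * (n i : ℝ) := rfl
    rw [h2, Real.norm_eq_abs, abs_mul, abs_of_pos (by positivity)] at h1
    have h3 : ((|n i| : ℤ) : ℝ) ≤ ⌈R⌉ := by
      push_cast
      refine le_trans ?_ (h1.trans (Int.le_ceil R))
      nlinarith [abs_nonneg (n i : ℝ), Real.pi_gt_three]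
    exact_mod_cast h3
  exact ⟨fun i => (abs_le.1 (h i)).1, fun i => (abs_le.1 (h i)).2⟩

/-- The periodization `x ↦ ∑_{n ∈ ℤ²} f(x + 2πn)` of a smooth function of bounded support. -/
def periodize (f : E → ℂ) (hf : ContDiff ℝ ∞ f) (hR : ∃ R, ∀ x, f x ≠ 0 → ‖x‖ ≤ R) : TestFn :=
  ⟨fun x => ∑' n, f (x + lat n), by
    constructor
    · obtain ⟨R, hR⟩ := hR
      rw [contDiff_iff_contDiffAt]
      intro x
      have hfin := finite_lat (R + (‖x‖ + 1))
      have heq : (fun y => ∑' n, f (y + lat n)) =ᶠ[𝓝 x]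
          fun y => ∑ n ∈ hfin.toFinset, f (y + lat n) := by
        filter_upwards [Metric.ball_mem_nhds x one_pos] with y hy
        refine tsum_eq_sum fun n hn => ?_
        by_contra hne
        apply hn
        rw [Set.Finite.mem_toFinset]
        have h1 := hR _ hne
        have h2 : ‖y‖ ≤ ‖x‖ + 1 := by
          have : ‖y - x‖ < 1 := by simpa [dist_eq_norm] using hy
          have h3 := norm_add_le x (y - x)
          rw [add_sub_cancel] at h3
          linarith
        have h3 := norm_sub_le (y + lat n) y
        rw [add_sub_cancel_left] at h3
        change ‖lat n‖ ≤ _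
        linarith
      refine ContDiffAt.congr_of_eventuallyEq ?_ heq
      exact (ContDiff.sum fun n _ => hf.comp (contDiff_id.add contDiff_const)).contDiffAt
    · intro m x
      have h : ∀ n, x + lat m + lat n = x + lat (Equiv.addLeft m n) := by
        intro n
        ext i
        simp [lat]
        ring
      simp only [h]
      exact (Equiv.addLeft m).tsum_eq fun n => f (x + lat n)⟩

/-- The rescaled and recentred function `φ^r_x(y) = r⁻² φ((y - x) / r)` on the torus. -/
def CcFn.scale (φ : CcFn) (x : E) (r : ℝ) : TestFn :=
  periodize (fun y => ((r⁻¹ ^ 2 : ℝ) : ℂ) * φ.toFun (r⁻¹ • (y - x)))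
    (contDiff_const.mul (φ.smooth.comp (by fun_prop)))
    (by
      obtain ⟨R, hR⟩ := φ.compact.isCompact.isBounded.exists_norm_le
      refine ⟨|r| * R + ‖x‖, fun y hy => ?_⟩
      have hr : r ≠ 0 := by
        rintro rfl
        simp at hy
      have h1 : φ.toFun (r⁻¹ • (y - x)) ≠ 0 := right_ne_zero_of_mul hy
      have h2 := hR _ (subset_tsupport _ h1)
      rw [norm_smul, norm_inv, Real.norm_eq_abs, inv_mul_le_iff₀ (abs_pos.2 hr)] at h2
      have h3 := norm_add_le (y - x) x
      rw [sub_add_cancel] at h3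
      linarith)

/-- A mollifier `ρ`: smooth, nonnegative, supported in the closed unit ball, of integral one. -/
structure IsMollifier (ρ : CcFn) : Prop where
  nonneg : ∀ x, 0 ≤ (ρ.toFun x).re ∧ (ρ.toFun x).im = 0
  support : tsupport ρ.toFun ⊆ Metric.closedBall 0 1
  integral : ∫ x, ρ.toFun x = 1

/-- The mollification `ρ_ε ∗ T`, where `ρ_ε(x) = ε⁻² ρ(x / ε)`, as a smooth function. -/
def mollify (ρ : CcFn) (ε : ℝ) (T : Dist) : TestFn := T.convFn (ρ.scale 0 ε)

/-! ### Little Hölder-Zygmund spaces and Young products -/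

/-- `sup |T(φ^r_x)| / r^α` over `φ ∈ S`, `r ∈ I` and all points `x`. -/
def testSup (α : ℝ) (S : Set CcFn) (I : Set ℝ) (T : Dist) : ℝ≥0∞ :=
  ⨆ φ ∈ S, ⨆ r ∈ I, ⨆ x : E, ENNReal.ofReal (‖T.1 (φ.scale x r)‖ / r ^ α)

/-- Test functions supported in the open unit ball, with all derivatives up to order `m`
bounded by one. -/
def ballFns (m : ℕ) : Set CcFn :=
  {φ | tsupport φ.toFun ⊆ Metric.ball 0 1 ∧ SupBound m 1 φ.toFun}

/-- The functions that annihilate the monomials of degree at most `α`. -/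
def annihilating (α : ℝ) : Set CcFn :=
  {φ | ∀ a b : ℕ, ((a + b : ℕ) : ℝ) ≤ α →
    ∫ z : E, φ.toFun z * ((z 0 ^ a * z 1 ^ b : ℝ) : ℂ) = 0}

/-- The Hölder-Zygmund norm of exponent `α` on the torus. For `α < 0` the test functions have
`⌊-α + 1⌋` derivatives bounded by one, that is the smallest integer larger than `-α`. -/
def hzNorm (α : ℝ) (T : Dist) : ℝ≥0∞ :=
  if α < 0 then testSup α (ballFns ⌊-α + 1⌋₊) (Set.Ioc 0 1) T
  else testSup 0 (ballFns 0) {1} T +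
    testSup α (ballFns 0 ∩ annihilating α) (Set.Ioc 0 1) T

theorem testSup_add_le {α : ℝ} {S : Set CcFn} {I : Set ℝ} (hI : ∀ r ∈ I, 0 < r) (T U : Dist) :
    testSup α S I (T + U) ≤ testSup α S I T + testSup α S I U := by
  refine iSup₂_le fun φ hφ => iSup₂_le fun r hr => iSup_le fun x => ?_
  have hr0 : 0 ≤ r ^ α := Real.rpow_nonneg (hI r hr).le α
  have h : ∀ V : Dist, ENNReal.ofReal (‖V.1 (φ.scale x r)‖ / r ^ α) ≤ testSup α S I V :=
    fun V => (le_iSup (fun x => ENNReal.ofReal (‖V.1 (φ.scale x r)‖ / r ^ α)) x).trans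
      ((le_iSup₂ (f := fun r (_ : r ∈ I) => ⨆ x : E,
        ENNReal.ofReal (‖V.1 (φ.scale x r)‖ / r ^ α)) r hr).trans
        (le_iSup₂ (f := fun φ (_ : φ ∈ S) => ⨆ r ∈ I, ⨆ x : E,
          ENNReal.ofReal (‖V.1 (CcFn.scale φ x r)‖ / r ^ α)) φ hφ))
  refine le_trans ?_ (add_le_add (h T) (h U))
  rw [← ENNReal.ofReal_add (by positivity) (by positivity), ← add_div]
  exact ENNReal.ofReal_le_ofReal (div_le_div_of_nonneg_right (norm_add_le _ _) hr0)

theorem testSup_smul_le {α : ℝ} {S : Set CcFn} {I : Set ℝ} (c : ℂ) (T : Dist) :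
    testSup α S I (c • T) ≤ ENNReal.ofReal ‖c‖ * testSup α S I T := by
  refine iSup₂_le fun φ hφ => iSup₂_le fun r hr => iSup_le fun x => ?_
  have h : ENNReal.ofReal (‖T.1 (φ.scale x r)‖ / r ^ α) ≤ testSup α S I T :=
    (le_iSup (fun x => ENNReal.ofReal (‖T.1 (φ.scale x r)‖ / r ^ α)) x).trans
      ((le_iSup₂ (f := fun r (_ : r ∈ I) => ⨆ x : E,
        ENNReal.ofReal (‖T.1 (φ.scale x r)‖ / r ^ α)) r hr).trans
        (le_iSup₂ (f := fun φ (_ : φ ∈ S) => ⨆ r ∈ I, ⨆ x : E,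
          ENNReal.ofReal (‖T.1 (CcFn.scale φ x r)‖ / r ^ α)) φ hφ))
  refine le_trans (le_of_eq ?_) (mul_le_mul_right h _)
  rw [← ENNReal.ofReal_mul (norm_nonneg _), ← mul_div_assoc, ← norm_smul]
  rfl

theorem hzNorm_add_le (α : ℝ) (T U : Dist) : hzNorm α (T + U) ≤ hzNorm α T + hzNorm α U := by
  unfold hzNorm
  split_ifs
  · exact testSup_add_le (fun r hr => hr.1) T U
  · refine (add_le_add (testSup_add_le (fun r hr => by rw [hr]; exact one_pos) T U)
      (testSup_add_le (fun r hr => hr.1) T U)).trans (le_of_eq ?_)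
    ring

theorem hzNorm_smul_le (α : ℝ) (c : ℂ) (T : Dist) :
    hzNorm α (c • T) ≤ ENNReal.ofReal ‖c‖ * hzNorm α T := by
  unfold hzNorm
  split_ifs
  · exact testSup_smul_le c T
  · rw [mul_add]
    exact add_le_add (testSup_smul_le c T) (testSup_smul_le c T)

theorem hzNorm_zero (α : ℝ) : hzNorm α 0 = 0 := by
  have := hzNorm_smul_le α 0 0
  simpa using this

theorem ofFn_add (f g : TestFn) : ofFn (f + g) = ofFn f + ofFn g := by
  ext φ
  change (ofFn (f + g)).1 φ = (ofFn f).1 φ + (ofFn g).1 φ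
  rw [ofFn_apply, mul_comm, ← ofFn_apply, map_add, ofFn_apply, ofFn_apply, ofFn_apply,
    ofFn_apply, mul_comm f, mul_comm g]

theorem ofFn_smul (c : ℂ) (f : TestFn) : ofFn (c • f) = c • ofFn f := by
  ext φ
  change (ofFn (c • f)).1 φ = c • (ofFn f).1 φ
  rw [ofFn_apply, mul_comm, ← ofFn_apply, map_smul, ofFn_apply, ofFn_apply, mul_comm f]

/-- The little Hölder-Zygmund space: the closure of the smooth functions in the
Hölder-Zygmund space of exponent `α`. -/
def littleHZ (α : ℝ) : Submodule ℂ Dist where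
  carrier := {T | hzNorm α T < ⊤ ∧ ∀ δ : ℝ≥0∞, 0 < δ → ∃ f : TestFn, hzNorm α (T - ofFn f) < δ}
  add_mem' := by
    rintro T U ⟨hT, hT'⟩ ⟨hU, hU'⟩
    refine ⟨(hzNorm_add_le α T U).trans_lt (ENNReal.add_lt_top.2 ⟨hT, hU⟩), fun δ hδ => ?_⟩
    obtain ⟨f, hf⟩ := hT' (δ / 2) (ENNReal.half_pos hδ.ne')
    obtain ⟨g, hg⟩ := hU' (δ / 2) (ENNReal.half_pos hδ.ne')
    refine ⟨f + g, ?_⟩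
    have : T + U - ofFn (f + g) = (T - ofFn f) + (U - ofFn g) := by
      rw [ofFn_add]
      abel
    rw [this]
    refine (hzNorm_add_le α _ _).trans_lt ((ENNReal.add_lt_add hf hg).trans_le ?_)
    rw [ENNReal.add_halves]
  zero_mem' := by
    refine ⟨by simp [hzNorm_zero], fun δ hδ => ⟨0, ?_⟩⟩
    have h : ofFn 0 = 0 := by simpa using ofFn_smul 0 0
    rwa [h, sub_zero, hzNorm_zero]
  smul_mem' := by
    rintro c T ⟨hT, hT'⟩
    refine ⟨(hzNorm_smul_le α c T).trans_lt (ENNReal.mul_lt_top ENNReal.ofReal_lt_top hT),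
      fun δ hδ => ?_⟩
    have hc : (0 : ℝ) < ‖c‖ + 1 := by positivity
    have hc' : ENNReal.ofReal (‖c‖ + 1) ≠ 0 := by simpa using hc
    obtain ⟨f, hf⟩ := hT' (δ / ENNReal.ofReal (‖c‖ + 1))
      (ENNReal.div_pos hδ.ne' ENNReal.ofReal_ne_top)
    refine ⟨c • f, ?_⟩
    rw [ofFn_smul, ← smul_sub]
    refine (hzNorm_smul_le α c _).trans_lt ?_
    rw [ENNReal.lt_div_iff_mul_lt (Or.inl hc') (Or.inl ENNReal.ofReal_ne_top)] at hf
    refine lt_of_le_of_lt ?_ hf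
    rw [mul_comm]
    exact mul_le_mul_right (ENNReal.ofReal_le_ofReal (by linarith)) _

/-- `Y` is a continuous bilinear map on little Hölder-Zygmund spaces that extends the
pointwise product of smooth functions. -/
structure IsYoungMap (α β : ℝ) (Y : littleHZ α →ₗ[ℂ] littleHZ β →ₗ[ℂ] littleHZ β) : Prop where
  continuous : ∃ C : ℝ≥0, ∀ f g,
    hzNorm β (Y f g : Dist) ≤ C * hzNorm α (f : Dist) * hzNorm β (g : Dist)
  extends_mul : ∀ (f g : TestFn) (hf : ofFn f ∈ littleHZ α) (hg : ofFn g ∈ littleHZ β),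
    (Y ⟨ofFn f, hf⟩ ⟨ofFn g, hg⟩ : Dist) = ofFn (f * g)

/-- `h` is the Young product of `f` and `g`: both lie in the little Hölder-Zygmund spaces of
exponents `α` and `β`, and `h` is the value at `(f, g)` of the continuous bilinear extension of
the pointwise product (which is unique, since smooth functions are dense). -/
def IsYoungProduct (α β : ℝ) (f g h : Dist) : Prop :=
  ∃ (hf : f ∈ littleHZ α) (hg : g ∈ littleHZ β)
    (Y : littleHZ α →ₗ[ℂ] littleHZ β →ₗ[ℂ] littleHZ β),
    IsYoungMap α β Y ∧ (Y ⟨f, hf⟩ ⟨g, hg⟩ : Dist) = h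

/-- The distribution `T` is given by the continuous periodic function `u`. -/
def IsRepresentedBy (T : Dist) (u : E → ℂ) : Prop :=
  Continuous u ∧ (∀ n x, u (x + lat n) = u x) ∧
    ∀ φ : TestFn, T.1 φ = tint fun x => u x * φ.1 x

end

noncomputable section

/-! ### White noise -/

/-- A three-dimensional white noise on the torus: almost surely, in the sense of distributions,
`W_j = η_j + Re ∑_{k ≠ 0} c_{k,j} e_k`. Here the `c_{k,j}` are complex Gaussian variables whose
real and imaginary parts are independent with law `N(0, v)` (the usual normalizations of a
standard complex Gaussian are `v = 1/2` and `v = 1`), the `η_j` are standard real Gaussian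
variables, except that `η_j = 0` for `j ∈ Z` (the components with zero mean over the torus),
and all these variables are independent. -/
def IsWhiteNoise {Ω : Type*} [MeasurableSpace Ω] (P : Measure Ω) (v : ℝ≥0) (Z : Set (Fin 3))
    (W : Fin 3 → Ω → Dist) : Prop :=
  ∃ (η : Fin 3 → Ω → ℝ) (c : {k : Fin 2 → ℤ // k ≠ 0} × Fin 3 → Ω → ℂ),
    (∀ j ∈ Z, ∀ ω, η j ω = 0) ∧
    (∀ j ∉ Z, HasLaw (η j) (gaussianReal 0 1) P) ∧
    iIndepFun η P ∧
    (∀ p, AEMeasurable (c p) P) ∧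
    (∀ p, HasLaw (fun ω => (c p ω).re) (gaussianReal 0 v) P) ∧
    (∀ p, HasLaw (fun ω => (c p ω).im) (gaussianReal 0 v) P) ∧
    (∀ p, IndepFun (fun ω => (c p ω).re) (fun ω => (c p ω).im) P) ∧
    iIndepFun c P ∧
    IndepFun (fun ω j => η j ω) (fun ω p => c p ω) P ∧
    ∀ᵐ ω ∂P, ∀ (j : Fin 3) (φ : TestFn),
      HasSum (fun k : {k : Fin 2 → ℤ // k ≠ 0} =>
          tint fun x => ((c (k, j) ω * (mode k).1 x).re : ℂ) * φ.1 x)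
        ((W j ω).1 φ - (η j ω : ℂ) * tint φ.1)

/-! ### The fields `ξ` and `θ` -/

/-- `2 G_{i+1} ∗ f` for a smooth function `f`; with `f` the mollified `k`-th component of the
noise this is `ξ^ε_{1k}` for `i = 0` and `ξ^ε_{2k}` for `i = 1`. -/
def xiPartFn (i : Fin 2) (f : TestFn) : TestFn := (2 : ℂ) • (greenD i).convFn f

/-- `ξ_{1k} = 2 G₁ ∗ T` and `ξ_{2k} = 2 G₂ ∗ T` (for `i = 0, 1`), `T` the `k`-th component of
the noise. -/
def xiPart (i : Fin 2) (T : Dist) : Dist := (2 : ℂ) • (greenD i).conv T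

/-- The smooth field `ξ_k = 2i G ∗ f_k`. -/
def xiFn (f : Fin 3 → TestFn) : Fin 3 → TestFn := fun k => (2 * Complex.I) • greenG.convFn (f k)

/-- The field `θ = ξ × ξ̄` attached to `ξ_k = 2i G ∗ f_k`. -/
def thetaFn (f : Fin 3 → TestFn) : Fin 3 → TestFn :=
  crossProduct (xiFn f) fun k => (xiFn f k).conj

/-- The constant function `a` on the torus. -/
def constFn (a : ℂ) : TestFn := algebraMap ℂ TestFn a

end

end Torus

namespace Torus

noncomputable section

open scoped ContDiff

/-! ### Integrals over the torus -/

/-! Write f_k for the convolution of K with the k-th (mollified) component. Then ξ_k = 2∂₂f_k +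
2i∂₁f_k, and since the f_k are real, θ_j is 8i times the Jacobian ∂₁f_{j+1}∂₂f_{j+2} −
∂₂f_{j+1}∂₁f_{j+2}. A Jacobian is a divergence, ∂₁(f∂₂g) − ∂₂(f∂₁g), because mixed derivatives
commute; for the same reason a constant subtracted from f drops out (`thetaFn_eq`). This replaces a
product of two distributions of exponent −κ by derivatives of a product of exponents 1−κ and −κ,
whose sum is positive for κ < 1/2.

The Young product is the series of the products of the dyadic blocks of f with g. The key estimate
is `NegBound.norm_mul_scale_le`: multiplying by a smooth function of size a that varies on the scale
s costs a·s^{-κ}, since the test function can be cut into pieces of relative scale s by translates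
of a bump. Block n of f has size 2^{-n(1-κ)} and scale 2^{-n}, so the series is geometric with ratio
2^{-(1-2κ)}. Its tails give continuity, membership in the little space, and agreement with the
pointwise product (`isYoungMap_youngMap`).

The regularity of K∗W comes from its Fourier series, cut into dyadic shells of frequencies. Shell n
multiplied by 2^n, and each partial derivative of shell n, are at every point Gaussian sums of
bounded variance. Exponential moments and a weighted union bound over a grid of mesh 4^{-n} show
that almost surely they grow at most linearly in n (`ae_exists_shellSum_le`). Hence K∗W is a sum of
functions with sup bound C(n+1)2^{-n} and Lipschitz bound C(n+1) (`IsBlockSum`). The sup bounds give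
a continuous representative; interpolation between the two bounds gives the exponent 1−κ; and
dominated convergence over the blocks gives convergence of the mollifications in that norm
(`tendsto_hzNorm_sub_mollify`).

Mollification commutes with convolution by K and with derivatives, so continuity of the Young
product lets θ^ε converge to the divergence expression (`tendsto_thetaFn`). Neither κ nor A occurs
in θ^ε, so the limit depends on neither. -/

theorem setIntegral_square {F : (Fin 2 → ℝ) → ℂ} (hF : Continuous F) {a b : ℝ} (hab : a ≤ b) :
    ∫ x in {x : Fin 2 → ℝ | ∀ i, x i ∈ Set.Ioc a b}, F x =
      ∫ s in a..b, ∫ t in a..b, F ![s, t] := by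
  have e := (volume_preserving_finTwoArrow ℝ).symm
  have hs : (MeasurableEquiv.finTwoArrow (α := ℝ)).symm ⁻¹'
      {x : Fin 2 → ℝ | ∀ i, x i ∈ Set.Ioc a b} = Set.Ioc a b ×ˢ Set.Ioc a b := by
    ext ⟨s, t⟩
    simp [Fin.forall_fin_two, MeasurableEquiv.finTwoArrow]
  rw [← e.setIntegral_preimage_emb (MeasurableEquiv.measurableEmbedding _), hs,
    intervalIntegral.integral_of_le hab]
  have hc : Continuous fun p : ℝ × ℝ => F ![p.1, p.2] := hF.comp (by fun_prop)
  have hi : IntegrableOn (fun p : ℝ × ℝ => F ![p.1, p.2]) (Set.Ioc a b ×ˢ Set.Ioc a b)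
      (volume.prod volume) := by
    refine IntegrableOn.mono_set ?_
      (Set.prod_mono Set.Ioc_subset_Icc_self Set.Ioc_subset_Icc_self)
    exact hc.continuousOn.integrableOn_compact (isCompact_Icc.prod isCompact_Icc)
  refine (setIntegral_prod (fun p : ℝ × ℝ => F ![p.1, p.2]) hi).trans ?_
  refine integral_congr_ae (Eventually.of_forall fun s => ?_)
  exact (intervalIntegral.integral_of_le hab).symm

theorem tint_comp_neg (f : E → ℂ) : tint (fun x => f (-x)) = tint f := by
  unfold tint
  have h : ∀ s : ℝ, ∫ t in (-Real.pi)..Real.pi, f (-!₂[s, t]) =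
      ∫ t in (-Real.pi)..Real.pi, f !₂[-s, t] := by
    intro s
    have := intervalIntegral.integral_comp_neg (a := -Real.pi) (b := Real.pi)
      fun t => f !₂[-s, t]
    rw [neg_neg] at this
    rw [← this]
    congr 1
    ext t
    congr 1
    ext i
    fin_cases i <;> simp
  simp only [h]
  have := intervalIntegral.integral_comp_neg (a := -Real.pi) (b := Real.pi)
    fun s => ∫ t in (-Real.pi)..Real.pi, f !₂[s, t]
  rwa [neg_neg] at this

theorem tint_conj (f : E → ℂ) :
    tint (fun x => starRingEnd ℂ (f x)) = starRingEnd ℂ (tint f) := by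
  unfold tint
  simp only [intervalIntegral.intervalIntegral_eq_integral_uIoc]
  simp [integral_conj, Real.pi_pos.le]

theorem tint_one : tint (fun _ => 1) = 4 * Real.pi ^ 2 := by
  simp [tint]
  ring

/-! ### Fourier modes -/

theorem mode_apply (k : Fin 2 → ℤ) (x : E) : (mode k).1 x =
    Complex.exp (Complex.I * (((k 0 : ℝ) * x 0 + (k 1 : ℝ) * x 1 : ℝ) : ℂ)) := rfl

theorem mode_mul (k l : Fin 2 → ℤ) : mode k * mode l = mode (k + l) := by
  ext x
  change (mode k).1 x * (mode l).1 x = (mode (k + l)).1 x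
  rw [mode_apply, mode_apply, mode_apply, ← Complex.exp_add]
  congr 1
  simp only [Pi.add_apply]
  push_cast
  ring

theorem mode_zero : mode 0 = 1 := by
  ext x
  change (mode 0).1 x = 1
  rw [mode_apply]
  simp

theorem mode_add_apply (k : Fin 2 → ℤ) (x y : E) :
    (mode k).1 (x + y) = (mode k).1 x * (mode k).1 y := by
  rw [mode_apply, mode_apply, mode_apply, ← Complex.exp_add]
  congr 1
  simp only [PiLp.add_apply]
  push_cast
  ring

theorem mode_neg_apply (k : Fin 2 → ℤ) (x : E) : (mode k).1 (-x) = (mode (-k)).1 x := by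
  rw [mode_apply, mode_apply]
  congr 1
  simp only [PiLp.neg_apply, Pi.neg_apply]
  push_cast
  ring

theorem conj_mode_apply (k : Fin 2 → ℤ) (x : E) :
    starRingEnd ℂ ((mode k).1 x) = (mode (-k)).1 x := by
  rw [mode_apply, mode_apply, ← Complex.exp_conj]
  congr 1
  simp only [Pi.neg_apply, map_mul, Complex.conj_I, Complex.conj_ofReal]
  push_cast
  ring

theorem reflect_mode (k : Fin 2 → ℤ) : (mode k).reflect = mode (-k) :=
  Subtype.ext (funext fun x => mode_neg_apply k x)

theorem translate_mode (k : Fin 2 → ℤ) (x : E) :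
    TestFn.translate x (mode k) = (mode k).1 x • mode k :=
  Subtype.ext (funext fun y => mode_add_apply k x y)

theorem tint_mode (k : Fin 2 → ℤ) : tint (mode k).1 = if k = 0 then 4 * (Real.pi : ℂ) ^ 2 else 0 := by
  split_ifs with h
  · rw [h, mode_zero]
    exact tint_one
  · obtain ⟨i, hi⟩ := Function.ne_iff.1 h
    have h1 := tint_deriv i (mode k)
    rw [deriv_mode] at h1
    have h2 := tint_mul_left (Complex.I * (k i : ℂ)) (mode k).1
    change tint (fun x => (Complex.I * (k i : ℂ)) * (mode k).1 x) = 0 at h1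
    rw [h2] at h1
    refine (mul_eq_zero.1 h1).resolve_left (mul_ne_zero Complex.I_ne_zero ?_)
    exact_mod_cast hi

/-- Orthogonality of the modes. The pairing is bilinear, not sesquilinear, whence the sign in `mode
(-l)`. -/
theorem ofFn_mode_mode (k l : Fin 2 → ℤ) :
    (ofFn (mode k)).1 (mode (-l)) = if k = l then 4 * (Real.pi : ℂ) ^ 2 else 0 := by
  rw [ofFn_apply, mode_mul, tint_mode, ← sub_eq_add_neg]
  simp only [sub_eq_zero]

/-! ### Fourier inversion for test functions -/

theorem ofFn_mode_summable (φ : TestFn) : Summable fun k => ‖(ofFn (mode k)).1 φ‖ := by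
  obtain ⟨B, hB⟩ := exists_supBound 4 φ
  exact Summable.of_nonneg_of_le (fun _ => norm_nonneg _) (fun k => ofFn_mode_bound k φ B hB)
    (summable_weight.mul_left _)

/-- The point of the unit torus with given real coordinates. -/
def toUnitTorus : C(Fin 2 → ℝ, UnitAddTorus (Fin 2)) where
  toFun x i := (x i : UnitAddCircle)
  continuous_toFun := continuous_pi fun i =>
    (AddCircle.continuous_mk' 1).comp (continuous_apply i)

/-- Lets a continuous periodic function descend to a continuous function on the quotient. -/
theorem isQuotientMap_toUnitTorus : Topology.IsQuotientMap toUnitTorus := by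
  have : IsOpenQuotientMap (Pi.map fun (_ : Fin 2) (x : ℝ) => (x : UnitAddCircle)) :=
    IsOpenQuotientMap.piMap fun _ => QuotientAddGroup.isOpenQuotientMap_mk
  exact this.isQuotientMap

/-- A test function in the coordinates `x / 2π`. -/
def TestFn.rescaled (φ : TestFn) : C(Fin 2 → ℝ, ℂ) :=
  ⟨fun x => φ.1 (WithLp.toLp 2 fun i => 2 * Real.pi * x i), by
    refine φ.smooth.continuous.comp ((PiLp.continuous_toLp 2 _).comp ?_)
    fun_prop⟩

theorem TestFn.factorsThrough_rescaled (φ : TestFn) :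
    Function.FactorsThrough φ.rescaled toUnitTorus := by
  intro x y hxy
  have h : ∀ i, ∃ n : ℤ, y i = x i + n := by
    intro i
    have h1 : ((x i : ℝ) : UnitAddCircle) = (y i : ℝ) := congrFun hxy i
    obtain ⟨n, hn⟩ := (QuotientAddGroup.eq.1 h1 : -x i + y i ∈ AddSubgroup.zmultiples (1 : ℝ))
    refine ⟨n, ?_⟩
    simp only [zsmul_eq_mul, mul_one] at hn
    linarith
  choose n hn using h
  change φ.1 _ = φ.1 _
  rw [← φ.periodic n]
  refine congrArg φ.1 ?_
  ext i
  simp [lat, hn]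
  ring

/-- A periodic function as a function on the unit torus. -/
def TestFn.onUnitTorus (φ : TestFn) : C(UnitAddTorus (Fin 2), ℂ) :=
  isQuotientMap_toUnitTorus.lift φ.rescaled φ.factorsThrough_rescaled

theorem TestFn.onUnitTorus_apply (φ : TestFn) (x : Fin 2 → ℝ) :
    φ.onUnitTorus (toUnitTorus x) = φ.1 (WithLp.toLp 2 fun i => 2 * Real.pi * x i) :=
  DFunLike.congr_fun
    (isQuotientMap_toUnitTorus.lift_comp φ.rescaled φ.factorsThrough_rescaled) x

theorem mFourier_toUnitTorus (k : Fin 2 → ℤ) (x : Fin 2 → ℝ) :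
    UnitAddTorus.mFourier k (toUnitTorus x) =
      (mode k).1 (WithLp.toLp 2 fun i => 2 * Real.pi * x i) := by
  change ∏ i, fourier (k i) ((x i : ℝ) : UnitAddCircle) = _
  rw [Fin.prod_univ_two, fourier_coe_apply, fourier_coe_apply, ← Complex.exp_add, mode_apply]
  congr 1
  push_cast
  ring

theorem mFourierCoeff_onUnitTorus (φ : TestFn) (k : Fin 2 → ℤ) :
    UnitAddTorus.mFourierCoeff φ.onUnitTorus k =
      (4 * (Real.pi : ℂ) ^ 2)⁻¹ * (ofFn (mode (-k))).1 φ := by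
  have hpi : (2 * Real.pi : ℝ) ≠ 0 := by positivity
  -- The cell (-1/2, 1/2]² is chosen because multiplication by 2π carries it to the cell of `tint`.
  rw [UnitAddTorus.mFourierCoeff_eq_integral _ _ (fun _ => -(1 / 2))]
  have h1 : ∀ x : Fin 2 → ℝ, UnitAddTorus.mFourier (-k) (fun i => (x i : UnitAddCircle)) •
      φ.onUnitTorus (fun i => (x i : UnitAddCircle)) =
      (mode (-k) * φ).1 (WithLp.toLp 2 fun i => 2 * Real.pi * x i) := by
    intro x
    have e1 := mFourier_toUnitTorus (-k) x
    have e2 := φ.onUnitTorus_apply x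
    change UnitAddTorus.mFourier (-k) (toUnitTorus x) • φ.onUnitTorus (toUnitTorus x) = _
    rw [e1, e2]
    rfl
  simp only [h1, show (-(1 / 2) + 1 : ℝ) = 1 / 2 by norm_num]
  rw [setIntegral_square _ (by norm_num)]
  · have h2 : ∀ s t : ℝ, (WithLp.toLp 2 fun i => 2 * Real.pi * ![s, t] i : E) =
        !₂[2 * Real.pi * s, 2 * Real.pi * t] := by
      intro s t
      ext i
      fin_cases i <;> simp
    simp only [h2]
    have h3 : ∀ s : ℝ, ∫ t in (-(1 / 2) : ℝ)..(1 / 2),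
        (mode (-k) * φ).1 !₂[2 * Real.pi * s, 2 * Real.pi * t] =
        (2 * Real.pi)⁻¹ • ∫ t in (-Real.pi)..Real.pi, (mode (-k) * φ).1 !₂[2 * Real.pi * s, t] := by
      intro s
      rw [intervalIntegral.integral_comp_mul_left
        (fun t => (mode (-k) * φ).1 !₂[2 * Real.pi * s, t]) hpi]
      congr 2 <;> ring
    simp only [h3]
    rw [intervalIntegral.integral_smul, intervalIntegral.integral_comp_mul_left
      (fun s => ∫ t in (-Real.pi)..Real.pi, (mode (-k) * φ).1 !₂[s, t]) hpi, smul_smul,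
      ofFn_apply]
    have h4 : (2 * Real.pi * -(1 / 2) : ℝ) = -Real.pi := by ring
    have h5 : (2 * Real.pi * (1 / 2) : ℝ) = Real.pi := by ring
    rw [h4, h5, Complex.real_smul]
    congr 1
    push_cast
    rw [← mul_inv]
    ring
  · exact (mode (-k) * φ).smooth.continuous.comp
      ((PiLp.continuous_toLp 2 _).comp (by fun_prop))

/-- Smoothness makes the Fourier coefficients absolutely summable, so the series represents the
function at every point. -/
theorem hasSum_fourier (φ : TestFn) (x : E) :
    HasSum (fun k => (4 * (Real.pi : ℂ) ^ 2)⁻¹ * (ofFn (mode (-k))).1 φ * (mode k).1 x)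
      (φ.1 x) := by
  have hs : Summable (UnitAddTorus.mFourierCoeff φ.onUnitTorus) := by
    simp only [funext (mFourierCoeff_onUnitTorus φ)]
    refine Summable.mul_left _ (Summable.of_norm ?_)
    exact (Equiv.neg (Fin 2 → ℤ)).summable_iff.2 (ofFn_mode_summable φ)
  have h := UnitAddTorus.hasSum_mFourier_series_apply_of_summable hs
    (toUnitTorus fun i => (2 * Real.pi)⁻¹ * x i)
  have hx : (WithLp.toLp 2 fun i => 2 * Real.pi * ((2 * Real.pi)⁻¹ * x i) : E) = x := by
    ext i
    have : (2 * Real.pi : ℝ) ≠ 0 := by positivity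
    simp only []
    field_simp
  simp only [mFourierCoeff_onUnitTorus, mFourier_toUnitTorus, φ.onUnitTorus_apply, hx,
    smul_eq_mul] at h
  exact h

/-! ### Fourier expansion of distributions -/

/-- The `k`-th Fourier coefficient of a test function. -/
def TestFn.coeff (φ : TestFn) (k : Fin 2 → ℤ) : ℂ :=
  (4 * (Real.pi : ℂ) ^ 2)⁻¹ * (ofFn (mode (-k))).1 φ

/-- Fourier series may be differentiated term by term, so the derivatives of a tail for `φ` are
tails for the derivatives of `φ`. -/
theorem TestFn.derivs_coeff_smul_mode (φ : TestFn) (k : Fin 2 → ℤ) (l : List (Fin 2)) :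
    TestFn.derivs l (φ.coeff k • mode k) = (TestFn.derivs l φ).coeff k • mode k := by
  induction l with
  | nil => rfl
  | cons i l ih =>
    change TestFn.deriv i (TestFn.derivs l _) = (TestFn.deriv i (TestFn.derivs l φ)).coeff k • _
    rw [ih, map_smul, deriv_mode, smul_smul]
    congr 1
    rw [TestFn.coeff, TestFn.coeff, ofFn_mode_deriv]
    simp only [Pi.neg_apply]
    push_cast
    ring

theorem TestFn.norm_sub_sum_coeff_le (φ : TestFn) (A : Finset (Fin 2 → ℤ)) (x : E) :
    ‖(φ - ∑ k ∈ A, φ.coeff k • mode k : TestFn).1 x‖ ≤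
      ∑' k : {k // k ∉ A}, ‖φ.coeff k‖ := by
  have h1 := (hasSum_fourier φ x)
  have h2 : Summable fun k : {k // k ∉ A} => φ.coeff k * (mode (k : Fin 2 → ℤ)).1 x :=
    h1.summable.subtype {k | k ∉ A}
  have h3 := h1.summable.sum_add_tsum_subtype_compl A
  rw [h1.tsum_eq] at h3
  have h4 : (φ - ∑ k ∈ A, φ.coeff k • mode k : TestFn).1 x =
      ∑' k : {k // k ∉ A}, φ.coeff k * (mode (k : Fin 2 → ℤ)).1 x := by
    have h5 : (∑ k ∈ A, φ.coeff k • mode k : TestFn).1 x =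
        ∑ k ∈ A, φ.coeff k * (mode k).1 x := by
      rw [AddSubmonoidClass.coe_finsetSum, Finset.sum_apply]
      rfl
    change φ.1 x - (∑ k ∈ A, φ.coeff k • mode k : TestFn).1 x = _
    rw [h5, ← h3]
    exact add_sub_cancel_left _ _
  rw [h4]
  refine (norm_tsum_le_tsum_norm h2.norm).trans (le_of_eq (tsum_congr fun k => ?_))
  rw [norm_mul, norm_mode, mul_one]

/-- A bound for the derivatives of order at most `N` of the remainders of a Fourier series. -/
def TestFn.fourierTail (φ : TestFn) (N : ℕ) (A : Finset (Fin 2 → ℤ)) : ℝ :=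
  ∑ l ∈ (List.finite_length_le (Fin 2) N).toFinset,
    ∑' k : {k // k ∉ A}, ‖(TestFn.derivs l φ).coeff k‖

theorem TestFn.tendsto_fourierTail (φ : TestFn) (N : ℕ) :
    Tendsto (φ.fourierTail N) atTop (𝓝 0) := by
  have h : ∀ l ∈ (List.finite_length_le (Fin 2) N).toFinset,
      Tendsto (fun A : Finset (Fin 2 → ℤ) => ∑' k : {k // k ∉ A}, ‖(TestFn.derivs l φ).coeff k‖)
        atTop (𝓝 0) := fun l _ =>
    tendsto_tsum_compl_atTop_zero fun k => ‖(TestFn.derivs l φ).coeff k‖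
  have := tendsto_finsetSum _ h
  rwa [Finset.sum_const_zero] at this

theorem TestFn.supBound_fourierTail (φ : TestFn) (N : ℕ) (A : Finset (Fin 2 → ℤ)) :
    SupBound N (φ.fourierTail N A) (φ - ∑ k ∈ A, φ.coeff k • mode k : TestFn).1 := by
  intro l hl x
  rw [← TestFn.coe_derivs]
  simp only [map_sub, map_sum, TestFn.derivs_coeff_smul_mode]
  refine (TestFn.norm_sub_sum_coeff_le _ A x).trans ?_
  exact Finset.single_le_sum (f := fun l => ∑' k : {k // k ∉ A}, ‖(TestFn.derivs l φ).coeff k‖)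
    (fun l _ => tsum_nonneg fun _ => norm_nonneg _)
    ((List.finite_length_le (Fin 2) N).mem_toFinset.2 hl)

/-- The Fourier series of a test function converges in every C^N norm, and `T` is bounded by one of
these norms. -/
theorem Dist.hasSum_coeff (T : Dist) (φ : TestFn) :
    HasSum (fun k => φ.coeff k * T.1 (mode k)) (T.1 φ) := by
  obtain ⟨N, C, hC⟩ := T.2
  have hbound : ∀ A : Finset (Fin 2 → ℤ), ‖(∑ k ∈ A, φ.coeff k * T.1 (mode k)) - T.1 φ‖ ≤
      C * φ.fourierTail N A := by
    intro A
    have e : (∑ k ∈ A, φ.coeff k * T.1 (mode k)) - T.1 φ =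
        -T.1 (φ - ∑ k ∈ A, φ.coeff k • mode k) := by
      simp only [map_sub, map_sum, map_smul, smul_eq_mul, neg_sub]
    rw [e, norm_neg]
    exact hC _ _ (φ.supBound_fourierTail N A)
  rw [HasSum, SummationFilter.unconditional_filter, tendsto_iff_norm_sub_tendsto_zero]
  refine squeeze_zero (fun _ => norm_nonneg _) hbound ?_
  simpa using (φ.tendsto_fourierTail N).const_mul C

/-- Reduces identities between distributions, such as commutativity of convolution, to identities
between numbers. -/
theorem Dist.ext_mode {S T : Dist} (h : ∀ k, S.1 (mode k) = T.1 (mode k)) : S = T := by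
  refine Subtype.ext (LinearMap.ext fun φ => ?_)
  refine (S.hasSum_coeff φ).unique ?_
  simpa only [h] using T.hasSum_coeff φ

theorem Dist.hasSum_mode (T : Dist) (φ : TestFn) :
    HasSum (fun k => (4 * (Real.pi : ℂ) ^ 2)⁻¹ * T.1 (mode (-k)) * (ofFn (mode k)).1 φ)
      (T.1 φ) := by
  have h := (Equiv.neg (Fin 2 → ℤ)).hasSum_iff.2 (T.hasSum_coeff φ)
  convert! h using 2 with k
  simp only [Function.comp_apply, Equiv.neg_apply, TestFn.coeff, neg_neg]
  ring

/-! ### Convolutions in terms of Fourier coefficients -/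

theorem corr_mode (T : Dist) (k : Fin 2 → ℤ) : corr T (mode k) = T.1 (mode k) • mode k := by
  ext x
  change T.1 (TestFn.translate x (mode k)) = T.1 (mode k) * (mode k).1 x
  rw [translate_mode, map_smul, smul_eq_mul, mul_comm]

theorem conv_mode (S T : Dist) (k : Fin 2 → ℤ) :
    (S.conv T).1 (mode k) = S.1 (mode k) * T.1 (mode k) := by
  change S.1 (corr T (mode k)) = _
  rw [corr_mode, map_smul, smul_eq_mul, mul_comm]

/-- Modes are eigenfunctions of every convolution operator, by orthogonality. -/
theorem ofFn_mode_conv (k : Fin 2 → ℤ) (T : Dist) :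
    (ofFn (mode k)).conv T = T.1 (mode (-k)) • ofFn (mode k) := by
  refine Dist.ext_mode fun l => ?_
  rw [conv_mode]
  change _ = T.1 (mode (-k)) * (ofFn (mode k)).1 (mode l)
  have h := ofFn_mode_mode k (-l)
  rw [neg_neg] at h
  rw [h, mul_comm]
  split_ifs with hk
  · rw [hk, neg_neg]
  · simp

theorem ofFn_reflect (f φ : TestFn) : (ofFn f.reflect).1 φ = (ofFn f).1 φ.reflect := by
  have := tint_comp_neg (f * φ.reflect : TestFn).1
  rw [ofFn_apply, ofFn_apply, ← this]
  congr 1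
  ext x
  change f.1 (-x) * φ.1 x = f.1 (-x) * φ.1 (- -x)
  rw [neg_neg]

theorem ofFn_symm (f φ : TestFn) : (ofFn f).1 φ = (ofFn φ).1 f := by
  rw [ofFn_apply, ofFn_apply, mul_comm]

theorem TestFn.reflect_reflect (φ : TestFn) : φ.reflect.reflect = φ :=
  Subtype.ext (funext fun x => congrArg φ.1 (neg_neg x))

/-- Fubini's theorem for a distribution and a smooth function. -/
theorem ofFn_convFn (T : Dist) (f : TestFn) : ofFn (T.convFn f) = (ofFn f).conv T := by
  refine Dist.ext_mode fun k => ?_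
  rw [conv_mode, Dist.convFn, ofFn_reflect, reflect_mode, ofFn_symm]
  -- No exchange of `T` with an integral is needed: once tested on a mode, the claim is the
  -- eigenfunction identity paired with the reflection of `f`.
  have h := congrArg (fun S : Dist => S.1 f.reflect) (ofFn_mode_conv (-k) T)
  change (ofFn (mode (-k))).1 (corr T f.reflect) =
    T.1 (mode (- -k)) * (ofFn (mode (-k))).1 f.reflect at h
  rw [h, neg_neg, mul_comm, ← ofFn_reflect, reflect_mode, neg_neg, ofFn_symm]

theorem convFn_convFn (S T : Dist) (f : TestFn) :
    S.convFn (T.convFn f) = (S.conv T).convFn f := by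
  ext x
  change S.1 (TestFn.translate (-x) (corr T f.reflect).reflect.reflect) =
    S.1 (corr T (TestFn.translate (-x) f.reflect))
  rw [TestFn.reflect_reflect]
  refine congrArg S.1 (Subtype.ext (funext fun y => ?_))
  change T.1 (TestFn.translate (-x + y) f.reflect) =
    T.1 (TestFn.translate y (TestFn.translate (-x) f.reflect))
  refine congrArg T.1 (Subtype.ext (funext fun z => ?_))
  exact congrArg f.reflect.1 (add_assoc (-x) y z)

theorem deriv_reflect (i : Fin 2) (φ : TestFn) :
    TestFn.deriv i φ.reflect = -(TestFn.deriv i φ).reflect := by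
  ext x
  change fderiv ℝ (fun y => φ.1 (-y)) x _ = -(fderiv ℝ φ.1 (-x) _)
  have h := ((φ.differentiable (-x)).hasFDerivAt.comp x (hasFDerivAt_id x).neg).fderiv
  change fderiv ℝ (fun y => φ.1 (-y)) x = _ at h
  rw [h]
  simp

theorem TestFn.reflect_neg (φ : TestFn) : (-φ).reflect = -φ.reflect := rfl

theorem deriv_convFn (i : Fin 2) (T : Dist) (f : TestFn) :
    TestFn.deriv i (T.convFn f) = (T.deriv i).convFn f := by
  rw [Dist.convFn, deriv_reflect, deriv_corr, deriv_reflect, map_neg, TestFn.reflect_neg, neg_neg]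
  ext x
  change T.1 (TestFn.translate (-x) _) = -T.1 (TestFn.deriv i (TestFn.translate (-x) f.reflect))
  rw [TestFn.deriv_translate, deriv_reflect, map_neg, map_neg, neg_neg]

theorem deriv_conv (i : Fin 2) (S T : Dist) : (S.deriv i).conv T = (S.conv T).deriv i := by
  refine Subtype.ext (LinearMap.ext fun φ => ?_)
  change -S.1 (TestFn.deriv i (corr T φ)) = -S.1 (corr T (TestFn.deriv i φ))
  rw [deriv_corr]

theorem ofFn_deriv (i : Fin 2) (f : TestFn) : ofFn (TestFn.deriv i f) = (ofFn f).deriv i := by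
  refine Subtype.ext (LinearMap.ext fun φ => ?_)
  change _ = -(ofFn f).1 (TestFn.deriv i φ)
  rw [ofFn_apply, ofFn_apply, eq_neg_iff_add_eq_zero]
  have h1 := tint_deriv i (f * φ)
  rw [deriv_mul] at h1
  rw [← h1]
  exact (tint_add (TestFn.deriv i f * φ).smooth.continuous
    (f * TestFn.deriv i φ).smooth.continuous).symm

theorem green_mode (k : Fin 2 → ℤ) :
    green.1 (mode k) = if k = 0 then 0 else (((k 0 : ℝ) ^ 2 + (k 1 : ℝ) ^ 2 : ℝ) : ℂ)⁻¹ := by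
  change ∑' l, (greenCoeff l : ℂ) * (ofFn (mode l)).1 (mode k) = _
  have h : ∀ l, (ofFn (mode l)).1 (mode k) = if l = -k then 4 * (Real.pi : ℂ) ^ 2 else 0 := by
    intro l
    have := ofFn_mode_mode l (-k)
    rwa [neg_neg] at this
  rw [tsum_eq_single (-k) fun l hl => by rw [h, if_neg hl, mul_zero], h, if_pos rfl, greenCoeff]
  simp only [neg_eq_zero]
  split_ifs with hk
  · simp
  · have : (Real.pi : ℂ) ≠ 0 := by exact_mod_cast Real.pi_ne_zero
    simp only [Pi.neg_apply]
    push_cast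
    field_simp

/-! ### Periodizations -/

/-- The fundamental square `(-π, π]²`. -/
def square : Set E := {x | ∀ i, x i ∈ Set.Ioc (-Real.pi) Real.pi}

theorem measurableSet_square : MeasurableSet square := by
  have : square = ⋂ i : Fin 2, (fun x : E => x i) ⁻¹' Set.Ioc (-Real.pi) Real.pi := by
    ext x
    simp [square]
  rw [this]
  refine MeasurableSet.iInter fun i => measurableSet_Ioc.preimage ?_
  exact (EuclideanSpace.proj i : E →L[ℝ] ℝ).continuous.measurable

theorem norm_le_of_mem_square {x : E} (hx : x ∈ square) : ‖x‖ ≤ 2 * Real.pi := by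
  have hpi := Real.pi_pos
  have e : ∀ i, ‖x i‖ ≤ Real.pi := fun i => abs_le.2 ⟨(hx i).1.le, (hx i).2⟩
  rw [EuclideanSpace.norm_eq, Fin.sum_univ_two, Real.sqrt_le_left (by positivity)]
  nlinarith [e 0, e 1, norm_nonneg (x 0), norm_nonneg (x 1)]

theorem tint_eq_setIntegral {f : E → ℂ} (hf : Continuous f) : tint f = ∫ x in square, f x := by
  have hpi := Real.pi_pos
  have h := setIntegral_square (F := fun x => f (WithLp.toLp 2 x))
    (hf.comp (PiLp.continuous_toLp 2 _)) (a := -Real.pi) (b := Real.pi) (by linarith)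
  have h2 := (PiLp.volume_preserving_toLp (Fin 2)).setIntegral_preimage_emb
    (MeasurableEquiv.toLp 2 (Fin 2 → ℝ)).measurableEmbedding f square
  exact h.symm.trans h2

theorem lat_neg (n : Fin 2 → ℤ) : lat (-n) = -lat n := by
  ext i
  simp [lat]

theorem existsUnique_sub_lat_mem (x : E) : ∃! n : Fin 2 → ℤ, x - lat n ∈ square := by
  have hpi := Real.two_pi_pos
  choose n hn hu using fun i => existsUnique_sub_zsmul_mem_Ioc hpi (x i) (-Real.pi)
  have key : ∀ (m : Fin 2 → ℤ) (i : Fin 2), (x - lat m) i ∈ Set.Ioc (-Real.pi) Real.pi ↔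
      x i - m i • (2 * Real.pi) ∈ Set.Ioc (-Real.pi) (-Real.pi + 2 * Real.pi) := by
    intro m i
    have e : (x - lat m) i = x i - m i • (2 * Real.pi) := by
      simp [lat]
      ring
    rw [e, show -Real.pi + 2 * Real.pi = Real.pi by ring]
  exact ⟨n, fun i => (key n i).2 (hn i), fun m hm => funext fun i => hu i _ ((key m i).1 (hm i))⟩

/-- The lattice translates of the square tile the plane. -/
theorem hasSum_setIntegral_square {F : E → ℂ} (hF : Integrable F) :
    HasSum (fun n => ∫ x in square, F (x + lat n)) (∫ x, F x) := by
  have hm : ∀ n, MeasurableSet ((fun x => x - lat n) ⁻¹' square) := fun n =>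
    measurableSet_square.preimage (measurable_id.sub_const _)
  have hU : (⋃ n, (fun x => x - lat n) ⁻¹' square) = Set.univ := by
    refine Set.eq_univ_of_forall fun x => Set.mem_iUnion.2 ?_
    obtain ⟨n, hn, -⟩ := existsUnique_sub_lat_mem x
    exact ⟨n, hn⟩
  have hd : Pairwise (Function.onFun Disjoint fun n => (fun x => x - lat n) ⁻¹' square) := by
    intro m n hmn
    refine Set.disjoint_left.2 fun x hx hx' => hmn ?_
    exact (existsUnique_sub_lat_mem x).unique hx hx'
  have h := hasSum_integral_iUnion hm hd (f := F) hF.integrableOn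
  rw [hU, setIntegral_univ] at h
  convert! h using 2 with n
  have := (measurePreserving_sub_right (volume : Measure E) (lat n)).setIntegral_preimage_emb
    (MeasurableEquiv.subRight (lat n)).measurableEmbedding (fun x => F (x + lat n)) square
  rw [← this]
  refine setIntegral_congr_fun (hm n) fun x _ => ?_
  simp

theorem finite_translates {f : E → ℂ} {R : ℝ} (hR : ∀ x, f x ≠ 0 → ‖x‖ ≤ R) (r : ℝ) :
    ∀ n ∉ (finite_lat (R + r)).toFinset, ∀ x : E, ‖x‖ ≤ r → f (x + lat n) = 0 := by
  intro n hn x hx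
  by_contra hne
  rw [Set.Finite.mem_toFinset] at hn
  refine hn ?_
  have h := norm_sub_le (x + lat n) x
  rw [add_sub_cancel_left] at h
  change ‖lat n‖ ≤ _
  linarith [hR _ hne]

theorem periodize_apply_eq_sum {f : E → ℂ} (hf : ContDiff ℝ ∞ f) {R : ℝ}
    (hR : ∀ x, f x ≠ 0 → ‖x‖ ≤ R) (r : ℝ) {x : E} (hx : ‖x‖ ≤ r) :
    (periodize f hf ⟨R, hR⟩).1 x = ∑ n ∈ (finite_lat (R + r)).toFinset, f (x + lat n) :=
  tsum_eq_sum fun n hn => finite_translates hR r n hn x hx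

theorem summable_translates {f : E → ℂ} (hR : ∃ R, ∀ x, f x ≠ 0 → ‖x‖ ≤ R) (x : E) :
    Summable fun n => f (x + lat n) := by
  obtain ⟨R, hR⟩ := hR
  exact summable_of_ne_finset_zero fun n hn => finite_translates hR ‖x‖ n hn x le_rfl

theorem hasCompactSupport_of_bounded {f : E → ℂ} (hR : ∃ R, ∀ x, f x ≠ 0 → ‖x‖ ≤ R) :
    HasCompactSupport f := by
  obtain ⟨R, hR⟩ := hR
  refine HasCompactSupport.of_support_subset_isCompact (isCompact_closedBall (0 : E) R)
    fun x hx => ?_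
  rw [mem_closedBall_zero_iff]
  exact hR x hx

/-- Unfolding: periodicity brings `g` inside the sum over translates, and the translated cells tile
the plane. -/
theorem tint_mul_periodize (g : TestFn) {f : E → ℂ} (hf : ContDiff ℝ ∞ f)
    (hR : ∃ R, ∀ x, f x ≠ 0 → ‖x‖ ≤ R) :
    (ofFn g).1 (periodize f hf hR) = ∫ x, g.1 x * f x := by
  have hF : Continuous fun x => g.1 x * f x := g.smooth.continuous.mul hf.continuous
  have hc := hasCompactSupport_of_bounded hR
  have hi : Integrable fun x => g.1 x * f x := hF.integrable_of_hasCompactSupport hc.mul_left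
  have hsum := hasSum_setIntegral_square hi
  obtain ⟨R, hR⟩ := hR
  rw [ofFn_apply, tint_eq_setIntegral (g * periodize f hf ⟨R, hR⟩).smooth.continuous]
  have h0 : ∀ n ∉ (finite_lat (R + 2 * Real.pi)).toFinset,
      ∫ x in square, g.1 (x + lat n) * f (x + lat n) = 0 := by
    intro n hn
    rw [← integral_zero E ℂ (μ := volume.restrict square)]
    refine setIntegral_congr_fun measurableSet_square fun x hx => ?_
    simp only [finite_translates hR _ n hn x (norm_le_of_mem_square hx), mul_zero]
  rw [← hsum.tsum_eq, tsum_eq_sum h0, ← integral_finsetSum]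
  · refine setIntegral_congr_fun measurableSet_square fun x hx => ?_
    change g.1 x * (periodize f hf ⟨R, hR⟩).1 x = _
    rw [periodize_apply_eq_sum hf hR _ (norm_le_of_mem_square hx), Finset.mul_sum]
    simp only [g.periodic]
  · intro n _
    have := hi.comp_add_right (lat n)
    exact this.integrableOn

/-! ### Rescaled compactly supported functions -/

theorem CcFn.bounded_support (φ : CcFn) : ∃ R, ∀ x, φ.toFun x ≠ 0 → ‖x‖ ≤ R := by
  obtain ⟨R, hR⟩ := φ.compact.isCompact.isBounded.exists_norm_le
  exact ⟨R, fun x hx => hR _ (subset_tsupport _ hx)⟩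

theorem CcFn.scale_bounded (φ : CcFn) (x : E) (r : ℝ) : ∃ R, ∀ y : E,
    ((r⁻¹ ^ 2 : ℝ) : ℂ) * φ.toFun (r⁻¹ • (y - x)) ≠ 0 → ‖y‖ ≤ R := by
  obtain ⟨R, hR⟩ := φ.bounded_support
  refine ⟨|r| * R + ‖x‖, fun y hy => ?_⟩
  have hr : r ≠ 0 := by
    rintro rfl
    simp at hy
  have h2 := hR _ (right_ne_zero_of_mul hy)
  rw [norm_smul, norm_inv, Real.norm_eq_abs, inv_mul_le_iff₀ (abs_pos.2 hr)] at h2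
  have h3 := norm_add_le (y - x) x
  rw [sub_add_cancel] at h3
  linarith

theorem CcFn.scale_apply (φ : CcFn) (x : E) (r : ℝ) (y : E) : (φ.scale x r).1 y =
    ∑' n, ((r⁻¹ ^ 2 : ℝ) : ℂ) * φ.toFun (r⁻¹ • (y + lat n - x)) := rfl

theorem CcFn.scale_summable (φ : CcFn) (x : E) (r : ℝ) (y : E) : Summable fun n =>
    ((r⁻¹ ^ 2 : ℝ) : ℂ) * φ.toFun (r⁻¹ • (y + lat n - x)) :=
  summable_translates (φ.scale_bounded x r) y

theorem CcFn.integrable (φ : CcFn) : Integrable φ.toFun :=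
  φ.smooth.continuous.integrable_of_hasCompactSupport φ.compact

/-- The Jacobian of y ↦ x + ry cancels the normalization r⁻². From here on, pairings on the torus
are integrals over the plane with a profile of fixed size. -/
theorem ofFn_scale (g : TestFn) (φ : CcFn) (x : E) {r : ℝ} (hr : 0 < r) :
    (ofFn g).1 (φ.scale x r) = ∫ y, g.1 (x + r • y) * φ.toFun y := by
  have h1 : (ofFn g).1 (φ.scale x r) =
      ∫ y, g.1 y * (((r⁻¹ ^ 2 : ℝ) : ℂ) * φ.toFun (r⁻¹ • (y - x))) :=
    tint_mul_periodize g _ (φ.scale_bounded x r)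
  have h2 := Measure.integral_comp_smul (volume : Measure E)
    (fun y => g.1 y * (((r⁻¹ ^ 2 : ℝ) : ℂ) * φ.toFun (r⁻¹ • (y - x)))) r
  have h3 := integral_sub_right_eq_self (μ := (volume : Measure E))
    (fun y => g.1 (x + r • y) * φ.toFun y) (r⁻¹ • x)
  rw [h1, ← h3]
  have h4 : ∀ y : E, g.1 (r • y) * (((r⁻¹ ^ 2 : ℝ) : ℂ) * φ.toFun (r⁻¹ • (r • y - x))) =
      ((r⁻¹ ^ 2 : ℝ) : ℂ) * (g.1 (x + r • (y - r⁻¹ • x)) * φ.toFun (y - r⁻¹ • x)) := by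
    intro y
    rw [smul_sub r⁻¹, smul_smul, inv_mul_cancel₀ hr.ne', one_smul, smul_sub r, smul_smul,
      mul_inv_cancel₀ hr.ne', one_smul, add_sub_cancel]
    ring
  simp only [h4] at h2
  rw [integral_const_mul, finrank_euclideanSpace_fin, abs_of_pos (by positivity),
    Complex.real_smul, ← inv_pow] at h2
  have h5 : ((r⁻¹ ^ 2 : ℝ) : ℂ) ≠ 0 := by exact_mod_cast (by positivity : r⁻¹ ^ 2 ≠ 0)
  exact (mul_left_cancel₀ h5 h2).symm

/-- The partial derivative of a compactly supported function. -/
def CcFn.deriv (i : Fin 2) (φ : CcFn) : CcFn where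
  toFun := pd i φ.toFun
  smooth := (φ.smooth.fderiv_right (m := ∞) (by simp)).clm_apply contDiff_const
  compact := (φ.compact.fderiv (𝕜 := ℝ)).comp_left
    (g := fun L : E →L[ℝ] ℂ => L (EuclideanSpace.single i (1 : ℝ))) rfl

/-- The product of a smooth and a compactly supported function. -/
def CcFn.mulLeft (h : E → ℂ) (hh : ContDiff ℝ ∞ h) (φ : CcFn) : CcFn where
  toFun x := h x * φ.toFun x
  smooth := hh.mul φ.smooth
  compact := φ.compact.mul_left

/-- The reflection of a compactly supported function. -/
def CcFn.reflect (φ : CcFn) : CcFn where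
  toFun x := φ.toFun (-x)
  smooth := φ.smooth.comp contDiff_neg
  compact := φ.compact.comp_homeomorph (Homeomorph.neg E)

theorem translate_scale (φ : CcFn) (x y : E) (r : ℝ) :
    TestFn.translate y (φ.scale x r) = φ.scale (x - y) r := by
  ext z
  change (φ.scale x r).1 (y + z) = _
  rw [CcFn.scale_apply, CcFn.scale_apply]
  refine tsum_congr fun n => ?_
  rw [show y + z + lat n - x = z + lat n - (x - y) by abel]

/-- By periodicity `h` passes inside the sum over translates, so multiplication by `h` only changes
the profile. -/
theorem mul_scale (h : TestFn) (φ : CcFn) (x : E) {r : ℝ} (hr : r ≠ 0) :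
    h * φ.scale x r =
      (φ.mulLeft (fun z => h.1 (x + r • z)) (h.smooth.comp (by fun_prop))).scale x r := by
  ext y
  change h.1 y * (φ.scale x r).1 y = _
  rw [CcFn.scale_apply, CcFn.scale_apply, ← tsum_mul_left]
  refine tsum_congr fun n => ?_
  change _ = _ * (h.1 (x + r • r⁻¹ • (y + lat n - x)) * φ.toFun (r⁻¹ • (y + lat n - x)))
  rw [smul_smul, mul_inv_cancel₀ hr, one_smul, add_sub_cancel, h.periodic]
  ring

theorem smul_scale (c : ℂ) (φ : CcFn) (x : E) (r : ℝ) :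
    (φ.mulLeft (fun _ => c) contDiff_const).scale x r = c • φ.scale x r := by
  ext y
  change _ = c * (φ.scale x r).1 y
  rw [CcFn.scale_apply, CcFn.scale_apply, ← tsum_mul_left]
  exact tsum_congr fun n => mul_left_comm _ _ _

theorem deriv_scale (i : Fin 2) (φ : CcFn) (x : E) (r : ℝ) :
    TestFn.deriv i (φ.scale x r) = ((r⁻¹ : ℝ) : ℂ) • (φ.deriv i).scale x r := by
  ext y
  obtain ⟨R, hR⟩ := φ.scale_bounded x r
  have hsm : ContDiff ℝ ∞ fun y : E => ((r⁻¹ ^ 2 : ℝ) : ℂ) * φ.toFun (r⁻¹ • (y - x)) :=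
    contDiff_const.mul (φ.smooth.comp (by fun_prop))
  have heq : (φ.scale x r).1 =ᶠ[𝓝 y] fun z => ∑ n ∈ (finite_lat (R + (‖y‖ + 1))).toFinset,
      ((r⁻¹ ^ 2 : ℝ) : ℂ) * φ.toFun (r⁻¹ • (z + lat n - x)) := by
    filter_upwards [Metric.ball_mem_nhds y one_pos] with z hz
    refine periodize_apply_eq_sum hsm hR _ ?_
    have : ‖z - y‖ < 1 := by simpa [dist_eq_norm] using hz
    have h3 := norm_add_le y (z - y)
    rw [add_sub_cancel] at h3
    linarith
  have hd : ∀ z : E, HasFDerivAt φ.toFun (fderiv ℝ φ.toFun z) z := fun z =>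
    (φ.smooth.differentiable (by simp) z).hasFDerivAt
  have hterm : ∀ n, HasFDerivAt
      (fun z : E => ((r⁻¹ ^ 2 : ℝ) : ℂ) * φ.toFun (r⁻¹ • (z + lat n - x)))
      (((r⁻¹ ^ 2 : ℝ) : ℂ) • (fderiv ℝ φ.toFun (r⁻¹ • (y + lat n - x))).comp
        (r⁻¹ • ContinuousLinearMap.id ℝ E)) y := by
    intro n
    refine HasFDerivAt.const_mul ((hd _).comp y ?_) _
    exact (((hasFDerivAt_id y).add_const _).sub_const _).const_smul r⁻¹
  have hval : ∀ n, (((r⁻¹ ^ 2 : ℝ) : ℂ) • (fderiv ℝ φ.toFun (r⁻¹ • (y + lat n - x))).comp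
        (r⁻¹ • ContinuousLinearMap.id ℝ E)) (EuclideanSpace.single i (1 : ℝ)) =
      ((r⁻¹ : ℝ) : ℂ) *
        (((r⁻¹ ^ 2 : ℝ) : ℂ) * (φ.deriv i).toFun (r⁻¹ • (y + lat n - x))) := by
    intro n
    change ((r⁻¹ ^ 2 : ℝ) : ℂ) * (fderiv ℝ φ.toFun (r⁻¹ • (y + lat n - x)))
      (r⁻¹ • EuclideanSpace.single i (1 : ℝ)) = _
    rw [map_smul, Complex.real_smul, mul_left_comm]
    rfl
  change fderiv ℝ (φ.scale x r).1 y (EuclideanSpace.single i (1 : ℝ)) =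
    ((r⁻¹ : ℝ) : ℂ) * ((φ.deriv i).scale x r).1 y
  rw [heq.fderiv_eq, (HasFDerivAt.fun_sum fun n _ => hterm n).fderiv, sum_apply,
    Finset.sum_congr rfl fun n _ => hval n, ← Finset.mul_sum, CcFn.scale_apply]
  congr 1
  refine (tsum_eq_sum fun n hn => ?_).symm
  have hz : (fun z : E => ((r⁻¹ ^ 2 : ℝ) : ℂ) * φ.toFun (r⁻¹ • (z + lat n - x)))
      =ᶠ[𝓝 y] fun _ => 0 := by
    filter_upwards [Metric.ball_mem_nhds y one_pos] with z hz
    refine finite_translates hR _ n hn z ?_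
    have : ‖z - y‖ < 1 := by simpa [dist_eq_norm] using hz
    have h3 := norm_add_le y (z - y)
    rw [add_sub_cancel] at h3
    linarith
  -- Outside the finite index set the summand vanishes near `y`, hence so does its derivative.
  -- Cancelling the factor `r⁻¹` requires r ≠ 0; for r = 0 the convention `r⁻¹ = 0` makes the term
  -- vanish.
  have h0 := hval n
  rw [← (hterm n).fderiv, hz.fderiv_eq] at h0
  by_cases hr : r = 0
  · simp [hr]
  · have hr' : ((r⁻¹ : ℝ) : ℂ) ≠ 0 := by exact_mod_cast inv_ne_zero hr
    refine (mul_eq_zero.1 ?_).resolve_left hr'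
    rw [← h0]
    simp

/-! ### Hölder-Zygmund bounds as real inequalities -/

theorem testSup_le_iff {α : ℝ} {S : Set CcFn} {I : Set ℝ} (hI : ∀ r ∈ I, 0 < r) {T : Dist}
    {M : ℝ} (hM : 0 ≤ M) : testSup α S I T ≤ ENNReal.ofReal M ↔
      ∀ φ ∈ S, ∀ r ∈ I, ∀ x, ‖T.1 (φ.scale x r)‖ ≤ M * r ^ α := by
  unfold testSup
  simp only [iSup_le_iff]
  refine forall₂_congr fun φ _ => forall₂_congr fun r hr => forall_congr' fun x => ?_
  rw [ENNReal.ofReal_le_ofReal_iff hM, div_le_iff₀ (Real.rpow_pos_of_pos (hI r hr) _)]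

theorem supBound_zero_iff {B : ℝ} {f : E → ℂ} : SupBound 0 B f ↔ ∀ x, ‖f x‖ ≤ B := by
  refine ⟨fun h x => h [] le_rfl x, fun h l hl x => ?_⟩
  rw [List.eq_nil_of_length_eq_zero (Nat.le_zero.1 hl)]
  exact h x

theorem supBound_one_iff {B : ℝ} {f : E → ℂ} :
    SupBound 1 B f ↔ (∀ x, ‖f x‖ ≤ B) ∧ ∀ i x, ‖pd i f x‖ ≤ B := by
  refine ⟨fun h => ⟨fun x => h [] (by simp) x, fun i x => h [i] (by simp) x⟩, fun h l hl x => ?_⟩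
  match l, hl with
  | [], _ => exact h.1 x
  | [i], _ => exact h.2 i x

/-- `φ` is supported in the unit ball and its derivatives up to order `m` are bounded by `b`. -/
def BallFn (m : ℕ) (b : ℝ) (φ : CcFn) : Prop :=
  tsupport φ.toFun ⊆ Metric.ball 0 1 ∧ SupBound m b φ.toFun

/-- `|T(φ^r_x)| ≤ M r^{-κ}` for all admissible test functions. -/
def NegBound (κ M : ℝ) (T : Dist) : Prop :=
  ∀ φ ∈ ballFns 1, ∀ r ∈ Set.Ioc (0 : ℝ) 1, ∀ x, ‖T.1 (φ.scale x r)‖ ≤ M * r ^ (-κ)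

/-- For 0 < κ < 1 the number ⌊κ + 1⌋ of controlled derivatives equals one. -/
theorem hzNorm_neg_le_iff {κ : ℝ} (h0 : 0 < κ) (h1 : κ < 1) {T : Dist} {M : ℝ} (hM : 0 ≤ M) :
    hzNorm (-κ) T ≤ ENNReal.ofReal M ↔ NegBound κ M T := by
  have hf : ⌊- -κ + 1⌋₊ = 1 := by
    rw [neg_neg, Nat.floor_eq_iff (by linarith)]
    constructor <;> push_cast <;> linarith
  rw [hzNorm, if_pos (by linarith), hf, testSup_le_iff (fun r hr => hr.1) hM]
  rfl

theorem pd_const_mul (c : ℂ) {f : E → ℂ} (hf : ContDiff ℝ ∞ f) (i : Fin 2) (x : E) :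
    pd i (fun x => c * f x) x = c * pd i f x := by
  unfold pd
  rw [fderiv_const_mul (hf.differentiable (by simp) x)]
  rfl

theorem pds_const_mul (c : ℂ) (φ : CcFn) (l : List (Fin 2)) :
    ContDiff ℝ ∞ (pds l φ.toFun) ∧ pds l (fun x => c * φ.toFun x) = fun x => c * pds l φ.toFun x := by
  induction l with
  | nil => exact ⟨φ.smooth, rfl⟩
  | cons i l ih =>
    refine ⟨(ih.1.fderiv_right (m := ∞) (by simp)).clm_apply contDiff_const, ?_⟩
    change pd i (pds l _) = fun x => c * pd i (pds l φ.toFun) x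
    rw [ih.2]
    exact funext fun x => pd_const_mul c ih.1 i x

/-- Homogeneity: bounds for normalized profiles extend to all profiles. The degenerate case b = 0 is
covered by `BallFn.scale_eq_zero`. -/
theorem BallFn.eq_smul {m : ℕ} {b : ℝ} {φ : CcFn} (h : BallFn m b φ) (hb : 0 < b) :
    ∃ ψ ∈ ballFns m, (∀ x r, φ.scale x r = (b : ℂ) • ψ.scale x r) ∧
      ∀ x, φ.toFun x = b * ψ.toFun x := by
  have hb' : (b : ℂ) ≠ 0 := by exact_mod_cast hb.ne'
  refine ⟨φ.mulLeft (fun _ => (b : ℂ)⁻¹) contDiff_const, ⟨?_, fun l hl x => ?_⟩,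
    fun x r => ?_, fun x => ?_⟩
  · exact (tsupport_mul_subset_right (f := fun _ => (b : ℂ)⁻¹) (g := φ.toFun)).trans h.1
  · change ‖pds l (fun x => (b : ℂ)⁻¹ * φ.toFun x) x‖ ≤ 1
    rw [(pds_const_mul _ φ l).2, norm_mul, norm_inv, Complex.norm_real, Real.norm_of_nonneg hb.le,
      inv_mul_le_iff₀ hb, mul_one]
    exact h.2 l hl x
  · rw [smul_scale, smul_smul, mul_inv_cancel₀ hb', one_smul]
  · change _ = (b : ℂ) * ((b : ℂ)⁻¹ * φ.toFun x)
    rw [mul_inv_cancel_left₀ hb']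

theorem BallFn.scale_eq_zero {m : ℕ} {φ : CcFn} (h : BallFn m 0 φ) (x : E) (r : ℝ) :
    φ.scale x r = 0 := by
  ext y
  rw [CcFn.scale_apply]
  have h0 : ∀ z, φ.toFun z = 0 := fun z => norm_le_zero_iff.1 (h.2 [] (Nat.zero_le _) z)
  simp [h0]

theorem NegBound.apply {κ M : ℝ} {T : Dist} (hT : NegBound κ M T) {b : ℝ} {φ : CcFn}
    (hφ : BallFn 1 b φ) {r : ℝ} (hr : r ∈ Set.Ioc (0 : ℝ) 1) (x : E) :
    ‖T.1 (φ.scale x r)‖ ≤ b * (M * r ^ (-κ)) := by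
  rcases hφ.2.nonneg.eq_or_lt with rfl | hb
  · rw [hφ.scale_eq_zero, map_zero, norm_zero, zero_mul]
  · obtain ⟨ψ, hψ, h, -⟩ := hφ.eq_smul hb
    rw [h, map_smul, norm_smul, Complex.norm_real, Real.norm_of_nonneg hb.le]
    exact mul_le_mul_of_nonneg_left (hT ψ hψ r hr x) hb.le

theorem pd_mul {f g : E → ℂ} (hf : ContDiff ℝ ∞ f) (hg : ContDiff ℝ ∞ g) (i : Fin 2) (x : E) :
    pd i (fun x => f x * g x) x = pd i f x * g x + f x * pd i g x := by
  unfold pd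
  rw [fderiv_fun_mul (hf.differentiable (by simp) x) (hg.differentiable (by simp) x)]
  simp
  ring

theorem pd_comp_affine {f : E → ℂ} (hf : ContDiff ℝ ∞ f) (x : E) (r : ℝ) (i : Fin 2) (y : E) :
    pd i (fun y => f (x + r • y)) y = (r : ℂ) * pd i f (x + r • y) := by
  have h : HasFDerivAt (fun y => f (x + r • y))
      ((fderiv ℝ f (x + r • y)).comp (r • ContinuousLinearMap.id ℝ E)) y := by
    refine (hf.differentiable (by simp) _).hasFDerivAt.comp y ?_
    exact ((hasFDerivAt_id y).const_smul r).const_add x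
  unfold pd
  rw [h.fderiv]
  change fderiv ℝ f (x + r • y) (r • EuclideanSpace.single i (1 : ℝ)) = _
  rw [map_smul, Complex.real_smul]

theorem CcFn.exists_supBound_one (φ : CcFn) : ∃ b, 0 < b ∧ SupBound 1 b φ.toFun := by
  obtain ⟨a, ha⟩ := φ.compact.exists_bound_of_continuous φ.smooth.continuous
  choose d hd using fun i => (φ.deriv i).compact.exists_bound_of_continuous
    (φ.deriv i).smooth.continuous
  refine ⟨|a| + (|d 0| + |d 1|) + 1, by positivity, supBound_one_iff.2 ⟨fun x => ?_, fun i x => ?_⟩⟩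
  · have := ha x
    linarith [le_abs_self a, abs_nonneg (d 0), abs_nonneg (d 1)]
  · have h := hd i x
    change ‖pd i φ.toFun x‖ ≤ d i at h
    have : |d i| ≤ |d 0| + |d 1| := by
      fin_cases i
      · simp
      · simp
    linarith [le_abs_self (d i), abs_nonneg a]

/-! ### A fixed bump function -/

/-- A bump function of integral one supported in the ball of radius `1 / 4`. -/
def bump : CcFn :=
  let f : ContDiffBump (0 : E) := ⟨1 / 8, 1 / 4, by norm_num, by norm_num⟩
  { toFun := fun x => (f.normed volume x : ℂ)
    smooth := Complex.ofRealCLM.contDiff.comp f.contDiff_normed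
    compact := f.hasCompactSupport_normed.comp_left (g := fun t : ℝ => (t : ℂ)) Complex.ofReal_zero }

/-- The radius 1/4 leaves room for the dilation by two in `annulus`, whose support must stay in the
unit ball. -/
theorem tsupport_bump : tsupport bump.toFun ⊆ Metric.closedBall 0 (1 / 4) := by
  let f : ContDiffBump (0 : E) := ⟨1 / 8, 1 / 4, by norm_num, by norm_num⟩
  have h : tsupport (f.normed volume) = Metric.closedBall 0 (1 / 4) :=
    f.tsupport_normed_eq
  rw [← h]
  refine closure_mono fun x hx hx' => hx ?_
  change ((f.normed volume x : ℝ) : ℂ) = 0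
  rw [hx', Complex.ofReal_zero]

theorem tsupport_bump_subset_ball : tsupport bump.toFun ⊆ Metric.ball 0 1 :=
  tsupport_bump.trans (Metric.closedBall_subset_ball (by norm_num))

theorem integral_bump : ∫ x, bump.toFun x = 1 := by
  let f : ContDiffBump (0 : E) := ⟨1 / 8, 1 / 4, by norm_num, by norm_num⟩
  have h := f.integral_normed (μ := volume)
  change ∫ x, ((f.normed volume x : ℝ) : ℂ) = 1
  rw [integral_complex_ofReal, h, Complex.ofReal_one]

theorem isMollifier_bump : IsMollifier bump where
  nonneg x := by
    let f : ContDiffBump (0 : E) := ⟨1 / 8, 1 / 4, by norm_num, by norm_num⟩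
    change 0 ≤ ((f.normed volume x : ℝ) : ℂ).re ∧ ((f.normed volume x : ℝ) : ℂ).im = 0
    exact ⟨by simpa using f.nonneg_normed x, Complex.ofReal_im _⟩
  support := tsupport_bump_subset_ball.trans Metric.ball_subset_closedBall
  integral := integral_bump

/-! ### Mollification -/

/-- Pairing with a mollification averages over translates of the test function, the form in which
bounds pass to mollifications. -/
theorem ofFn_mollify (ρ : CcFn) {ε : ℝ} (hε : 0 < ε) (T : Dist) (φ : TestFn) :
    (ofFn (mollify ρ ε T)).1 φ = ∫ y, T.1 (TestFn.translate (ε • y) φ) * ρ.toFun y := by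
  rw [mollify, ofFn_convFn]
  change (ofFn (ρ.scale 0 ε)).1 (corr T φ) = _
  rw [ofFn_symm, ofFn_scale _ _ _ hε]
  simp only [zero_add]
  rfl

theorem IsMollifier.norm_eq {ρ : CcFn} (hρ : IsMollifier ρ) (x : E) :
    ((‖ρ.toFun x‖ : ℝ) : ℂ) = ρ.toFun x := by
  obtain ⟨h1, h2⟩ := hρ.nonneg x
  have h : ρ.toFun x = ((ρ.toFun x).re : ℂ) := Complex.ext (by simp) (by simp [h2])
  rw [h, Complex.norm_real, Real.norm_of_nonneg h1]

theorem IsMollifier.integral_norm {ρ : CcFn} (hρ : IsMollifier ρ) : ∫ x, ‖ρ.toFun x‖ = 1 := by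
  have h : ∫ x, ((‖ρ.toFun x‖ : ℝ) : ℂ) = 1 := by
    rw [← hρ.integral]
    exact integral_congr_ae (Eventually.of_forall hρ.norm_eq)
  rw [integral_complex_ofReal] at h
  exact_mod_cast h

theorem IsMollifier.norm_integral_le {ρ : CcFn} (hρ : IsMollifier ρ) {c : E → ℂ} {b : ℝ}
    (hc : ∀ y, ‖c y‖ ≤ b) : ‖∫ y, c y * ρ.toFun y‖ ≤ b := by
  have hi : Integrable fun y => b * ‖ρ.toFun y‖ := ρ.integrable.norm.const_mul b
  refine (norm_integral_le_of_norm_le hi (Eventually.of_forall fun y => ?_)).trans ?_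
  · rw [norm_mul]
    exact mul_le_mul_of_nonneg_right (hc y) (norm_nonneg _)
  · rw [integral_const_mul, hρ.integral_norm, mul_one]

theorem IsMollifier.tendsto_integral {ρ : CcFn} (hρ : IsMollifier ρ) (c : TestFn) (x : E) :
    Tendsto (fun ε : ℝ => ∫ y, c.1 (x + ε • y) * ρ.toFun y) (𝓝[>] 0) (𝓝 (c.1 x)) := by
  obtain ⟨b, hb⟩ := c.bounded
  have h := tendsto_integral_filter_of_dominated_convergence (l := 𝓝[>] (0 : ℝ))
    (F := fun (ε : ℝ) y => c.1 (x + ε • y) * ρ.toFun y) (f := fun y => c.1 x * ρ.toFun y)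
    (μ := volume) (fun y => b * ‖ρ.toFun y‖)
    (Eventually.of_forall fun ε => by
      refine Continuous.aestronglyMeasurable ?_
      exact (c.smooth.continuous.comp (by fun_prop)).mul ρ.smooth.continuous)
    (Eventually.of_forall fun ε => Eventually.of_forall fun y => by
      rw [norm_mul]
      exact mul_le_mul_of_nonneg_right (hb _) (norm_nonneg _))
    (ρ.integrable.norm.const_mul b)
    (Eventually.of_forall fun y => by
      refine Tendsto.mul_const _ ?_
      have hc : Continuous fun ε : ℝ => c.1 (x + ε • y) := c.smooth.continuous.comp (by fun_prop)
      have := (hc.tendsto 0).mono_left (nhdsWithin_le_nhds (s := Set.Ioi 0))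
      simpa using this)
  rwa [integral_const_mul, hρ.integral, mul_one] at h

/-- The function `corr T φ` is smooth, so the mollifier acts on it as an approximate identity at the
origin, where its value is `T φ`. -/
theorem IsMollifier.tendsto_mollify {ρ : CcFn} (hρ : IsMollifier ρ) (T : Dist) (φ : TestFn) :
    Tendsto (fun ε : ℝ => (ofFn (mollify ρ ε T)).1 φ) (𝓝[>] 0) (𝓝 (T.1 φ)) := by
  have h := hρ.tendsto_integral (corr T φ) 0
  have e : (corr T φ).1 0 = T.1 φ := by
    change T.1 (TestFn.translate 0 φ) = _
    congr 1
    ext y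
    change φ.1 (0 + y) = φ.1 y
    rw [zero_add]
  rw [e] at h
  refine h.congr' ?_
  filter_upwards [self_mem_nhdsWithin] with ε hε
  rw [ofFn_mollify ρ hε]
  simp only [zero_add]
  rfl

/-- The bound is invariant under translations, and averaging against a probability density preserves
it, uniformly in ε. -/
theorem NegBound.mollify {κ M : ℝ} {T : Dist} (hT : NegBound κ M T) {ρ : CcFn}
    (hρ : IsMollifier ρ) {ε : ℝ} (hε : 0 < ε) : NegBound κ M (ofFn (mollify ρ ε T)) := by
  intro φ hφ r hr x
  rw [ofFn_mollify ρ hε]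
  refine hρ.norm_integral_le fun y => ?_
  rw [translate_scale]
  exact hT φ hφ r hr _

/-! ### Multiplication of distributions of negative exponent by smooth functions -/

/-- A continuous partition of unity: by Fubini, the translates of `η` at scale `s` resolve the
integral of `F` into localized pieces. -/
theorem integral_localize {F η : E → ℂ} (hF : Continuous F) (hF' : HasCompactSupport F)
    (hη : Continuous η) (hη' : HasCompactSupport η) (s : ℝ) :
    ∫ z, ∫ y, F (z + s • y) * η y = (∫ z, F z) * ∫ y, η y := by
  have hc : Continuous fun p : E × E => F (p.1 + s • p.2) * η p.2 :=
    (hF.comp (by fun_prop)).mul (hη.comp continuous_snd)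
  have hs : HasCompactSupport fun p : E × E => F (p.1 + s • p.2) * η p.2 := by
    refine HasCompactSupport.of_support_subset_isCompact
      ((hF'.isCompact.prod hη'.isCompact).image
        (f := fun q : E × E => (q.1 - s • q.2, q.2)) (by fun_prop)) ?_
    rintro ⟨z, y⟩ hp
    refine ⟨(z + s • y, y), ⟨subset_tsupport _ (left_ne_zero_of_mul hp),
      subset_tsupport _ (right_ne_zero_of_mul hp)⟩, ?_⟩
    simp
  have hi : Integrable (fun p : E × E => F (p.1 + s • p.2) * η p.2) (volume.prod volume) :=
    hc.integrable_of_hasCompactSupport hs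
  rw [integral_integral_swap (f := fun z y => F (z + s • y) * η y) hi]
  simp only [integral_mul_const]
  rw [← integral_const_mul]
  refine integral_congr_ae (Eventually.of_forall fun y => ?_)
  simp only [integral_add_right_eq_self F (s • y)]

theorem norm_of_tsupport_ball {φ : CcFn} (h : tsupport φ.toFun ⊆ Metric.ball 0 1) {y : E}
    (hy : φ.toFun y ≠ 0) : ‖y‖ < 1 := by
  simpa using h (subset_tsupport _ hy)

/-- The constant in the multiplication estimate. -/
def mulConst : ℝ := 3 * bump.exists_supBound_one.choose * volume.real (Metric.ball (0 : E) 2)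

theorem mulConst_nonneg : 0 ≤ mulConst := by
  have := bump.exists_supBound_one.choose_spec.1
  exact mul_nonneg (by positivity) measureReal_nonneg

/-- The product `h φ` oscillates at relative scale `s`, too fast to be a good test function at scale
`r`. Cutting it with bumps at scale `r s` yields pieces that are, up to a factor of order `a b`,
admissible profiles there; each contributes M(rs)^{-κ}, and their centres fill a ball of fixed
volume. Smoothness of `g` makes the superposition an ordinary integral. -/
theorem norm_ofFn_mul_scale_le {κ M : ℝ} {g : TestFn} (hg : NegBound κ M (ofFn g))
    {h : TestFn} {a s : ℝ} (hs : s ∈ Set.Ioc (0 : ℝ) 1) (ha : ∀ x, ‖h.1 x‖ ≤ a)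
    (ha' : ∀ i x, ‖pd i h.1 x‖ ≤ a / s) {b : ℝ} {φ : CcFn} (hφ : BallFn 1 b φ) {r : ℝ}
    (hr : r ∈ Set.Ioc (0 : ℝ) 1) (x : E) :
    ‖(ofFn g).1 (h * φ.scale x r)‖ ≤ mulConst * (a * b * (M * (r * s) ^ (-κ))) := by
  have hs0 := hs.1
  have hr0 := hr.1
  have ha0 : 0 ≤ a := (norm_nonneg _).trans (ha 0)
  obtain ⟨hb1, hb2⟩ := supBound_one_iff.1 hφ.2
  have hb0 : 0 ≤ b := (norm_nonneg _).trans (hb1 0)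
  obtain ⟨hc0, hc⟩ := bump.exists_supBound_one.choose_spec
  set c := bump.exists_supBound_one.choose with hcdef
  obtain ⟨hc1, hc2⟩ := supBound_one_iff.1 hc
  have hh : ContDiff ℝ ∞ fun z => h.1 (x + r • z) := h.smooth.comp (by fun_prop)
  rw [mul_scale h φ x hr0.ne', ofFn_scale _ _ _ hr0]
  set H := φ.mulLeft (fun z => h.1 (x + r • z)) hh with hH
  have hHb : ∀ y, ‖H.toFun y‖ ≤ a * b := by
    intro y
    change ‖h.1 (x + r • y) * φ.toFun y‖ ≤ _
    rw [norm_mul]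
    exact mul_le_mul (ha _) (hb1 _) (norm_nonneg _) ha0
  -- One summand for each Leibniz term; r ≤ 1 is used in the first and s ≤ 1 in the second.
  have hHd : ∀ i y, ‖pd i H.toFun y‖ ≤ 2 * (a * b) / s := by
    intro i y
    change ‖pd i (fun y => h.1 (x + r • y) * φ.toFun y) y‖ ≤ _
    rw [pd_mul hh φ.smooth, pd_comp_affine h.smooth]
    refine (norm_add_le _ _).trans ?_
    rw [norm_mul, norm_mul, norm_mul, Complex.norm_real, Real.norm_of_nonneg hr0.le]
    have h1 : r * ‖pd i h.1 (x + r • y)‖ * ‖φ.toFun y‖ ≤ 1 * (a / s) * b :=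
      mul_le_mul (mul_le_mul hr.2 (ha' _ _) (norm_nonneg _) zero_le_one) (hb1 _) (norm_nonneg _)
        (by positivity)
    have h2 : ‖h.1 (x + r • y)‖ * ‖pd i φ.toFun y‖ ≤ a / s * b :=
      mul_le_mul ((ha _).trans (le_div_self ha0 hs0 hs.2)) (hb2 _ _) (norm_nonneg _)
        (by positivity)
    refine (add_le_add h1 h2).trans (le_of_eq ?_)
    ring
  have hloc := integral_localize (F := fun y => g.1 (x + r • y) * H.toFun y) (η := bump.toFun)
    ((g.smooth.continuous.comp (by fun_prop)).mul H.smooth.continuous) H.compact.mul_left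
    bump.smooth.continuous bump.compact s
  rw [integral_bump, mul_one] at hloc
  rw [← hloc]
  -- The dilation by `s` absorbs the 1/s in the derivative of `H`. The factor 3 is 2 from that term
  -- plus 1 from the derivative of the bump.
  have hball : ∀ z, BallFn 1 (3 * c * (a * b))
      (bump.mulLeft (fun y => H.toFun (z + s • y)) (H.smooth.comp (by fun_prop))) := by
    intro z
    refine ⟨(tsupport_mul_subset_right (f := fun y => H.toFun (z + s • y))).trans
      tsupport_bump_subset_ball, supBound_one_iff.2 ⟨fun y => ?_, fun i y => ?_⟩⟩
    · change ‖H.toFun (z + s • y) * bump.toFun y‖ ≤ _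
      rw [norm_mul]
      refine (mul_le_mul (hHb _) (hc1 _) (norm_nonneg _) (by positivity)).trans ?_
      nlinarith [mul_nonneg (mul_nonneg ha0 hb0) hc0.le]
    · change ‖pd i (fun y => H.toFun (z + s • y) * bump.toFun y) y‖ ≤ _
      have hHz : ContDiff ℝ ∞ fun y => H.toFun (z + s • y) := H.smooth.comp (by fun_prop)
      rw [pd_mul hHz bump.smooth, pd_comp_affine H.smooth]
      refine (norm_add_le _ _).trans ?_
      rw [norm_mul, norm_mul, norm_mul, Complex.norm_real, Real.norm_of_nonneg hs0.le]
      have h1 : s * ‖pd i H.toFun (z + s • y)‖ * ‖bump.toFun y‖ ≤ s * (2 * (a * b) / s) * c :=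
        mul_le_mul (mul_le_mul_of_nonneg_left (hHd _ _) hs0.le) (hc1 _) (norm_nonneg _)
          (by positivity)
      have h2 : ‖H.toFun (z + s • y)‖ * ‖pd i bump.toFun y‖ ≤ a * b * c :=
        mul_le_mul (hHb _) (hc2 _ _) (norm_nonneg _) (by positivity)
      refine (add_le_add h1 h2).trans (le_of_eq ?_)
      field_simp
      ring
  have hrs : r * s ∈ Set.Ioc (0 : ℝ) 1 :=
    ⟨by positivity, mul_le_one₀ hr.2 hs0.le hs.2⟩
  have hin : ∀ z, ‖∫ y, g.1 (x + r • (z + s • y)) * H.toFun (z + s • y) * bump.toFun y‖ ≤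
      3 * c * (a * b) * (M * (r * s) ^ (-κ)) := by
    intro z
    have h1 := hg.apply (hball z) hrs (x + r • z)
    rw [ofFn_scale _ _ _ hrs.1] at h1
    refine le_trans (le_of_eq ?_) h1
    congr 1
    refine integral_congr_ae (Eventually.of_forall fun y => ?_)
    change g.1 (x + r • (z + s • y)) * H.toFun (z + s • y) * bump.toFun y =
      g.1 (x + r • z + (r * s) • y) * (H.toFun (z + s • y) * bump.toFun y)
    rw [smul_add, smul_smul, mul_assoc, add_assoc]
  -- A nonzero integrand requires |y| < 1 and |z + sy| < 1, hence |z| < 2.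
  have hout : ∀ z ∉ Metric.ball (0 : E) 2,
      ∫ y, g.1 (x + r • (z + s • y)) * H.toFun (z + s • y) * bump.toFun y = 0 := by
    intro z hz
    rw [← integral_zero E ℂ (μ := volume)]
    refine integral_congr_ae (Eventually.of_forall fun y => ?_)
    by_contra hne
    have h1 := norm_of_tsupport_ball tsupport_bump_subset_ball (right_ne_zero_of_mul hne)
    have h2 : H.toFun (z + s • y) ≠ 0 := right_ne_zero_of_mul (left_ne_zero_of_mul hne)
    have h3 := norm_of_tsupport_ball hφ.1 (right_ne_zero_of_mul h2)
    refine hz ?_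
    rw [mem_ball_zero_iff]
    have h4 := norm_sub_le (z + s • y) (s • y)
    rw [add_sub_cancel_right, norm_smul, Real.norm_of_nonneg hs0.le] at h4
    nlinarith [hs.2, norm_nonneg y]
  rw [← setIntegral_eq_integral_of_forall_compl_eq_zero hout]
  refine (norm_setIntegral_le_of_norm_le_const measure_ball_lt_top fun z _ => hin z).trans
    (le_of_eq ?_)
  rw [mulConst, ← hcdef]
  ring

/-- The estimate for smooth `g` applies to all mollifications with the same constants, so it
survives the limit ε → 0. -/
theorem NegBound.norm_mul_scale_le {κ M : ℝ} {g : Dist} (hg : NegBound κ M g)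
    {h : TestFn} {a s : ℝ} (hs : s ∈ Set.Ioc (0 : ℝ) 1) (ha : ∀ x, ‖h.1 x‖ ≤ a)
    (ha' : ∀ i x, ‖pd i h.1 x‖ ≤ a / s) {b : ℝ} {φ : CcFn} (hφ : BallFn 1 b φ) {r : ℝ}
    (hr : r ∈ Set.Ioc (0 : ℝ) 1) (x : E) :
    ‖g.1 (h * φ.scale x r)‖ ≤ mulConst * (a * b * (M * (r * s) ^ (-κ))) := by
  refine le_of_tendsto (isMollifier_bump.tendsto_mollify g _).norm ?_
  filter_upwards [self_mem_nhdsWithin] with ε hε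
  exact norm_ofFn_mul_scale_le (hg.mollify isMollifier_bump hε) hs ha ha' hφ hr x

/-! ### Multiplication of distributions by smooth functions -/

theorem SupBound.deriv {N : ℕ} {B : ℝ} {φ : TestFn} (h : SupBound (N + 1) B φ.1) (i : Fin 2) :
    SupBound N B (TestFn.deriv i φ).1 := by
  intro l hl x
  rw [← TestFn.coe_derivs, TestFn.derivs_deriv]
  change ‖(TestFn.derivs (i :: l) φ).1 x‖ ≤ B
  rw [TestFn.coe_derivs]
  exact h _ (by simpa using hl) x

/-- Each derivative doubles the number of Leibniz terms. -/
theorem SupBound.mul (N : ℕ) : ∀ {A B : ℝ} {h φ : TestFn}, SupBound N A h.1 → SupBound N B φ.1 →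
    SupBound N (2 ^ N * A * B) (h * φ).1 := by
  induction N with
  | zero =>
    intro A B h φ hA hB
    rw [supBound_zero_iff] at hA hB ⊢
    intro x
    change ‖h.1 x * φ.1 x‖ ≤ _
    rw [norm_mul, pow_zero, one_mul]
    exact mul_le_mul (hA x) (hB x) (norm_nonneg _) ((norm_nonneg _).trans (hA x))
  | succ N ih =>
    intro A B h φ hA hB l hl x
    have hAB := mul_nonneg hA.nonneg hB.nonneg
    have h2 : (1 : ℝ) ≤ 2 ^ (N + 1) := one_le_pow₀ one_le_two
    -- The word is split at its last letter, the innermost derivative, so that Leibniz' rule applies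
    -- to the product itself and the induction hypothesis to the two resulting products.
    rcases List.eq_nil_or_concat' l with rfl | ⟨l, i, rfl⟩
    · change ‖h.1 x * φ.1 x‖ ≤ _
      rw [norm_mul]
      refine (mul_le_mul (hA [] (by simp) x) (hB [] (by simp) x) (norm_nonneg _)
        hA.nonneg).trans ?_
      rw [mul_assoc]
      exact le_mul_of_one_le_left hAB h2
    · rw [List.length_append, List.length_singleton] at hl
      have e : pds (l ++ [i]) (h * φ : TestFn).1 =
          (TestFn.derivs l (TestFn.deriv i h * φ) + TestFn.derivs l (h * TestFn.deriv i φ)).1 := by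
        rw [← map_add, ← deriv_mul, TestFn.coe_derivs]
        exact List.foldr_append ..
      rw [e]
      change ‖(TestFn.derivs l (TestFn.deriv i h * φ)).1 x +
        (TestFn.derivs l (h * TestFn.deriv i φ)).1 x‖ ≤ _
      rw [TestFn.coe_derivs, TestFn.coe_derivs]
      have h1 := ih (hA.deriv i) (hB.mono (Nat.le_succ N)) l (by omega) x
      have h3 := ih (hA.mono (Nat.le_succ N)) (hB.deriv i) l (by omega) x
      refine (norm_add_le_of_le h1 h3).trans (le_of_eq ?_)
      ring

/-- The product of a smooth function and a distribution. -/
def mulDist (h : TestFn) (T : Dist) : Dist :=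
  ⟨T.1 ∘ₗ LinearMap.mulLeft ℂ h, by
    obtain ⟨N, C, hC⟩ := T.2
    obtain ⟨A, hA⟩ := exists_supBound N h
    refine ⟨N, C * (2 ^ N * A), fun φ B hB => ?_⟩
    rw [mul_assoc]
    exact hC _ _ (SupBound.mul N hA hB)⟩

theorem mulDist_apply (h : TestFn) (T : Dist) (φ : TestFn) : (mulDist h T).1 φ = T.1 (h * φ) := rfl

theorem mulDist_ofFn (h g : TestFn) : mulDist h (ofFn g) = ofFn (h * g) := by
  refine Subtype.ext (LinearMap.ext fun φ => ?_)
  rw [mulDist_apply, ofFn_apply, ofFn_apply, mul_left_comm, mul_assoc]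

theorem mulDist_sub (h : TestFn) (S T : Dist) : mulDist h (S - T) = mulDist h S - mulDist h T := rfl

/-! ### Localization -/

/-- The integral over the torus of x ↦ S(bump at x) is `S 1`, because convolution with the constant
mode is a multiple of it and the bump has integral one. This turns local bounds into global ones. -/
theorem norm_apply_one_le (S : Dist) {b : ℝ} (h : ∀ x, ‖S.1 (bump.scale x 1)‖ ≤ b) :
    ‖S.1 1‖ ≤ 4 * Real.pi ^ 2 * b := by
  have h1 := congrArg (fun U : Dist => U.1 (bump.scale 0 1)) (ofFn_mode_conv 0 S)
  rw [neg_zero, mode_zero] at h1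
  change (ofFn 1).1 (corr S (bump.scale 0 1)) = S.1 1 * (ofFn 1).1 (bump.scale 0 1) at h1
  have h2 : (ofFn 1).1 (bump.scale 0 1) = 1 := by
    rw [ofFn_scale _ _ _ one_pos, ← integral_bump]
    exact integral_congr_ae (Eventually.of_forall fun y => one_mul _)
  rw [h2, mul_one, ofFn_apply, one_mul] at h1
  rw [← h1]
  refine norm_tint_le fun x => ?_
  change ‖S.1 (TestFn.translate x (bump.scale 0 1))‖ ≤ b
  rw [translate_scale]
  exact h _

theorem BallFn.mul_bump {c : ℝ} (hc : SupBound 1 c bump.toFun) {B : ℝ} {φ : TestFn}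
    (hφ : SupBound 1 B φ.1) (x : E) : BallFn 1 (2 * c * B)
      (bump.mulLeft (fun y => φ.1 (x + (1 : ℝ) • y)) (φ.smooth.comp (by fun_prop))) := by
  obtain ⟨hc1, hc2⟩ := supBound_one_iff.1 hc
  obtain ⟨hB1, hB2⟩ := supBound_one_iff.1 hφ
  have hc0 := hc.nonneg
  have hB0 := hφ.nonneg
  refine ⟨(tsupport_mul_subset_right (f := fun y => φ.1 (x + (1 : ℝ) • y))).trans
      tsupport_bump_subset_ball, supBound_one_iff.2 ⟨fun y => ?_, fun i y => ?_⟩⟩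
  · change ‖φ.1 (x + (1 : ℝ) • y) * bump.toFun y‖ ≤ _
    rw [norm_mul]
    refine (mul_le_mul (hB1 _) (hc1 _) (norm_nonneg _) hB0).trans ?_
    nlinarith [mul_nonneg hc0 hB0]
  · change ‖pd i (fun y => φ.1 (x + (1 : ℝ) • y) * bump.toFun y) y‖ ≤ _
    have hs : ContDiff ℝ ∞ fun y => φ.1 (x + (1 : ℝ) • y) := φ.smooth.comp (by fun_prop)
    rw [pd_mul hs bump.smooth, pd_comp_affine φ.smooth, Complex.ofReal_one, one_mul]
    refine (norm_add_le _ _).trans ?_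
    rw [norm_mul, norm_mul]
    refine (add_le_add (mul_le_mul (hB2 i _) (hc1 _) (norm_nonneg _) hB0)
      (mul_le_mul (hB1 _) (hc2 i _) (norm_nonneg _) hB0)).trans (le_of_eq ?_)
    ring

/-- The constant in the global multiplication estimate. -/
def globalConst : ℝ := 4 * Real.pi ^ 2 * (mulConst * (2 * bump.exists_supBound_one.choose))

/-- The global version of `NegBound.norm_mul_scale_le`: unit-scale bumps are averaged over the
torus, and `φ` is absorbed into their profile. -/
theorem NegBound.norm_mul_le {κ M : ℝ} {g : Dist} (hg : NegBound κ M g) {h : TestFn} {a s : ℝ}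
    (hs : s ∈ Set.Ioc (0 : ℝ) 1) (ha : ∀ x, ‖h.1 x‖ ≤ a) (ha' : ∀ i x, ‖pd i h.1 x‖ ≤ a / s)
    {B : ℝ} {φ : TestFn} (hφ : SupBound 1 B φ.1) :
    ‖g.1 (h * φ)‖ ≤ globalConst * (a * B * (M * s ^ (-κ))) := by
  have h1 := norm_apply_one_le (mulDist (h * φ) g) (b := mulConst *
    (a * (2 * bump.exists_supBound_one.choose * B) * (M * (1 * s) ^ (-κ)))) fun x => by
      rw [mulDist_apply, mul_assoc, mul_scale φ bump x one_ne_zero]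
      exact hg.norm_mul_scale_le hs ha ha'
        (BallFn.mul_bump bump.exists_supBound_one.choose_spec.2 hφ x) ⟨one_pos, le_rfl⟩ x
  rw [mulDist_apply, mul_one] at h1
  refine h1.trans (le_of_eq ?_)
  simp only [globalConst, one_mul]
  ring

theorem pd_one (i : Fin 2) (x : E) : pd i (1 : TestFn).1 x = 0 := by
  change fderiv ℝ (fun _ : E => (1 : ℂ)) x _ = 0
  simp

/-- Convergence in the norm of negative exponent implies convergence in the sense of distributions
by this estimate. -/
theorem NegBound.norm_le {κ M : ℝ} {g : Dist} (hg : NegBound κ M g) {B : ℝ} {φ : TestFn}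
    (hφ : SupBound 1 B φ.1) : ‖g.1 φ‖ ≤ globalConst * (B * M) := by
  have h := hg.norm_mul_le (h := 1) (a := 1) (s := 1) ⟨one_pos, le_rfl⟩
    (fun x => by change ‖(1 : ℂ)‖ ≤ 1; simp) (fun i x => by rw [pd_one]; simp) hφ
  simpa using h

theorem TestFn.exists_scale_bound (h : TestFn) :
    ∃ a, (∀ x, ‖h.1 x‖ ≤ a) ∧ ∀ i x, ‖pd i h.1 x‖ ≤ a / 1 := by
  obtain ⟨a, ha⟩ := exists_supBound 1 h
  refine ⟨a, (supBound_one_iff.1 ha).1, ?_⟩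
  rw [div_one]
  exact (supBound_one_iff.1 ha).2

theorem NegBound.mulDist {κ M : ℝ} {g : Dist} (hg : NegBound κ M g) {h : TestFn} {a : ℝ}
    (ha : ∀ x, ‖h.1 x‖ ≤ a) (ha' : ∀ i x, ‖pd i h.1 x‖ ≤ a / 1) :
    NegBound κ (mulConst * a * M) (mulDist h g) := by
  intro φ hφ r hr x
  refine (hg.norm_mul_scale_le ⟨one_pos, le_rfl⟩ ha ha' hφ hr x).trans (le_of_eq ?_)
  simp only [mul_one]
  ring

/-! ### Little Hölder-Zygmund spaces of negative exponent -/

theorem exists_negBound {κ : ℝ} (h0 : 0 < κ) (h1 : κ < 1) {T : Dist} (hT : hzNorm (-κ) T < ⊤) :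
    NegBound κ (hzNorm (-κ) T).toReal T :=
  (hzNorm_neg_le_iff h0 h1 ENNReal.toReal_nonneg).1 (ENNReal.ofReal_toReal hT.ne).ge

/-- A closure is closed; finiteness of the norm follows from one approximant at distance less than
one. -/
theorem mem_littleHZ_of_approx {α : ℝ} {T : Dist}
    (h : ∀ δ : ℝ≥0∞, 0 < δ → ∃ U ∈ littleHZ α, hzNorm α (T - U) < δ) : T ∈ littleHZ α := by
  constructor
  · obtain ⟨U, hU, hTU⟩ := h 1 one_pos
    have := hzNorm_add_le α (T - U) U
    rw [sub_add_cancel] at this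
    exact this.trans_lt (ENNReal.add_lt_top.2 ⟨hTU.trans ENNReal.one_lt_top, hU.1⟩)
  · intro δ hδ
    obtain ⟨U, hU, hTU⟩ := h (δ / 2) (ENNReal.half_pos hδ.ne')
    obtain ⟨f, hf⟩ := hU.2 (δ / 2) (ENNReal.half_pos hδ.ne')
    refine ⟨f, ?_⟩
    have e : T - ofFn f = (T - U) + (U - ofFn f) := by abel
    rw [e]
    refine (hzNorm_add_le α _ _).trans_lt ((ENNReal.add_lt_add hTU hf).trans_eq ?_)
    exact ENNReal.add_halves δ

theorem NegBound.ofFn {κ : ℝ} (h0 : 0 < κ) (f : TestFn) : ∃ M, 0 ≤ M ∧ NegBound κ M (ofFn f) := by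
  obtain ⟨b, hb⟩ := f.bounded
  have hb0 := (norm_nonneg _).trans (hb 0)
  refine ⟨b * volume.real (Metric.ball (0 : E) 1), mul_nonneg hb0 measureReal_nonneg,
    fun φ hφ r hr x => ?_⟩
  rw [ofFn_scale _ _ _ hr.1, ← setIntegral_eq_integral_of_forall_compl_eq_zero
    (s := Metric.ball (0 : E) 1) fun y hy => ?_]
  · have h1 : ‖∫ y in Metric.ball (0 : E) 1, f.1 (x + r • y) * φ.toFun y‖ ≤
        b * volume.real (Metric.ball (0 : E) 1) := by
      refine norm_setIntegral_le_of_norm_le_const measure_ball_lt_top fun y _ => ?_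
      rw [norm_mul]
      exact (mul_le_mul (hb _) ((supBound_one_iff.1 hφ.2).1 y) (norm_nonneg _) hb0).trans_eq
        (mul_one b)
    refine h1.trans (le_mul_of_one_le_right (mul_nonneg hb0 measureReal_nonneg) ?_)
    exact Real.one_le_rpow_of_pos_of_le_one_of_nonpos hr.1 hr.2 (by linarith)
  · rw [image_eq_zero_of_notMem_tsupport fun h => hy (hφ.1 h), mul_zero]

theorem ofFn_mem_littleHZ_neg {κ : ℝ} (h0 : 0 < κ) (h1 : κ < 1) (f : TestFn) :
    ofFn f ∈ littleHZ (-κ) := by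
  obtain ⟨M, hM, h⟩ := NegBound.ofFn h0 f
  refine ⟨((hzNorm_neg_le_iff h0 h1 hM).2 h).trans_lt ENNReal.ofReal_lt_top, fun δ hδ => ⟨f, ?_⟩⟩
  rwa [sub_self, hzNorm_zero]

theorem mulDist_mem_littleHZ {κ : ℝ} (h0 : 0 < κ) (h1 : κ < 1) (h : TestFn) {g : Dist}
    (hg : g ∈ littleHZ (-κ)) : mulDist h g ∈ littleHZ (-κ) := by
  refine mem_littleHZ_of_approx fun δ hδ => ?_
  obtain ⟨a, ha, ha'⟩ := h.exists_scale_bound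
  have hK : 0 ≤ mulConst * a := mul_nonneg mulConst_nonneg ((norm_nonneg _).trans (ha 0))
  -- The added one keeps the divisor positive when `a` vanishes.
  have hKp : 0 < ENNReal.ofReal (mulConst * a + 1) := ENNReal.ofReal_pos.2 (by linarith)
  obtain ⟨f, hf⟩ := hg.2 (δ / ENNReal.ofReal (mulConst * a + 1))
    (ENNReal.div_pos hδ.ne' ENNReal.ofReal_ne_top)
  refine ⟨ofFn (h * f), ofFn_mem_littleHZ_neg h0 h1 _, ?_⟩
  rw [← mulDist_ofFn, ← mulDist_sub]
  have hfin := hf.trans_le le_top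
  have hb := (exists_negBound h0 h1 hfin).mulDist ha ha'
  have hb' := (hzNorm_neg_le_iff h0 h1 (mul_nonneg hK ENNReal.toReal_nonneg)).2 hb
  rw [ENNReal.ofReal_mul hK, ENNReal.ofReal_toReal hfin.ne] at hb'
  refine hb'.trans_lt (lt_of_le_of_lt ?_
    ((ENNReal.lt_div_iff_mul_lt (Or.inl hKp.ne') (Or.inl ENNReal.ofReal_ne_top)).1 hf))
  rw [mul_comm]
  exact mul_le_mul_right (ENNReal.ofReal_le_ofReal (by linarith)) _

/-! ### Hölder-Zygmund bounds of positive exponent -/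

/-- The bounds in the Hölder-Zygmund norm of exponent `1 - κ`. -/
def PosBound (κ N : ℝ) (T : Dist) : Prop :=
  (∀ φ ∈ ballFns 0, ∀ x, ‖T.1 (φ.scale x 1)‖ ≤ N) ∧
    ∀ φ ∈ ballFns 0, ∫ z, φ.toFun z = 0 → ∀ r ∈ Set.Ioc (0 : ℝ) 1, ∀ x,
      ‖T.1 (φ.scale x r)‖ ≤ N * r ^ (1 - κ)

/-- As 0 < 1 − κ < 1, the only monomial to annihilate is the constant. -/
theorem mem_annihilating_iff {κ : ℝ} (h0 : 0 < κ) (h1 : κ < 1) (φ : CcFn) :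
    φ ∈ annihilating (1 - κ) ↔ ∫ z, φ.toFun z = 0 := by
  constructor
  · intro h
    have := h 0 0 (by simpa using h1.le)
    simpa using this
  · intro h a b hab
    have h2 : ((a + b : ℕ) : ℝ) < 1 := by linarith
    have h3 : a + b = 0 := by
      have : a + b < 1 := by exact_mod_cast h2
      omega
    obtain ⟨rfl, rfl⟩ := Nat.add_eq_zero_iff.1 h3
    simpa using h

theorem hzNorm_pos_le {κ : ℝ} (h0 : 0 < κ) (h1 : κ < 1) {T : Dist} {N : ℝ} (hN : 0 ≤ N)
    (hT : PosBound κ N T) : hzNorm (1 - κ) T ≤ ENNReal.ofReal (2 * N) := by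
  rw [hzNorm, if_neg (by linarith), two_mul, ENNReal.ofReal_add hN hN]
  refine add_le_add ((testSup_le_iff (fun r hr => ?_) hN).2 fun φ hφ r hr x => ?_)
    ((testSup_le_iff (fun r hr => hr.1) hN).2 fun φ hφ r hr x => ?_)
  · rw [hr]
    exact one_pos
  · rw [Set.mem_singleton_iff.1 hr, Real.one_rpow, mul_one]
    exact hT.1 φ hφ x
  · exact hT.2 φ hφ.1 ((mem_annihilating_iff h0 h1 φ).1 hφ.2) r hr x

theorem exists_posBound {κ : ℝ} (h0 : 0 < κ) (h1 : κ < 1) {T : Dist}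
    (hT : hzNorm (1 - κ) T < ⊤) : PosBound κ (hzNorm (1 - κ) T).toReal T := by
  have h := (ENNReal.ofReal_toReal hT.ne).ge
  have hN := ENNReal.toReal_nonneg (a := hzNorm (1 - κ) T)
  set N := (hzNorm (1 - κ) T).toReal
  rw [hzNorm, if_neg (by linarith)] at h
  constructor
  · intro φ hφ x
    have h2 := (testSup_le_iff (fun r hr => by rw [Set.mem_singleton_iff.1 hr]; exact one_pos)
      hN).1 (le_self_add.trans h) φ hφ 1 rfl x
    simpa using h2
  · intro φ hφ hz r hr x
    exact (testSup_le_iff (fun r hr => hr.1) hN).1 (le_add_self.trans h) φ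
      ⟨hφ, (mem_annihilating_iff h0 h1 φ).2 hz⟩ r hr x

theorem PosBound.nonneg {κ N : ℝ} {T : Dist} (h : PosBound κ N T) : 0 ≤ N := by
  let φ : CcFn := bump.mulLeft (fun _ => 0) contDiff_const
  have hφ : φ ∈ ballFns 0 := ⟨(tsupport_mul_subset_right (f := fun _ => (0 : ℂ))).trans
    tsupport_bump_subset_ball, supBound_zero_iff.2 fun x => by
      change ‖(0 : ℂ) * bump.toFun x‖ ≤ 1
      simp⟩
  exact (norm_nonneg _).trans (h.1 φ hφ 0)

theorem PosBound.apply_one {κ N : ℝ} {T : Dist} (hT : PosBound κ N T) {b : ℝ} {φ : CcFn}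
    (hφ : BallFn 0 b φ) (x : E) : ‖T.1 (φ.scale x 1)‖ ≤ b * N := by
  rcases hφ.2.nonneg.eq_or_lt with rfl | hb
  · rw [hφ.scale_eq_zero, map_zero, norm_zero, zero_mul]
  · obtain ⟨ψ, hψ, h, -⟩ := hφ.eq_smul hb
    rw [h, map_smul, norm_smul, Complex.norm_real, Real.norm_of_nonneg hb.le]
    exact mul_le_mul_of_nonneg_left (hT.1 ψ hψ x) hb.le

theorem PosBound.apply {κ N : ℝ} {T : Dist} (hT : PosBound κ N T) {b : ℝ} {φ : CcFn}
    (hφ : BallFn 0 b φ) (hz : ∫ z, φ.toFun z = 0) {r : ℝ} (hr : r ∈ Set.Ioc (0 : ℝ) 1) (x : E) :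
    ‖T.1 (φ.scale x r)‖ ≤ b * (N * r ^ (1 - κ)) := by
  rcases hφ.2.nonneg.eq_or_lt with rfl | hb
  · rw [hφ.scale_eq_zero, map_zero, norm_zero, zero_mul]
  · obtain ⟨ψ, hψ, h, h'⟩ := hφ.eq_smul hb
    rw [h, map_smul, norm_smul, Complex.norm_real, Real.norm_of_nonneg hb.le]
    refine mul_le_mul_of_nonneg_left (hT.2 ψ hψ ?_ r hr x) hb.le
    simp only [h'] at hz
    rw [integral_const_mul] at hz
    exact (mul_eq_zero.1 hz).resolve_left (by exact_mod_cast hb.ne')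

/-! ### The dyadic decomposition -/

/-- The difference of the bump function and its dilation by the factor two. -/
def annulus : CcFn where
  toFun x := bump.toFun x - 4⁻¹ * bump.toFun ((2 : ℝ)⁻¹ • x)
  smooth := bump.smooth.sub (contDiff_const.mul (bump.smooth.comp (by fun_prop)))
  compact := by
    refine HasCompactSupport.sub bump.compact (HasCompactSupport.mul_left ?_)
    exact bump.compact.comp_homeomorph
      (Homeomorph.smulOfNeZero (2 : ℝ)⁻¹ (inv_ne_zero two_ne_zero) : E ≃ₜ E)

theorem tsupport_annulus : tsupport annulus.toFun ⊆ Metric.ball 0 1 := by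
  refine (closure_minimal (t := Metric.closedBall (0 : E) (1 / 2)) (fun x hx => ?_)
    Metric.isClosed_closedBall).trans (Metric.closedBall_subset_ball (by norm_num))
  by_contra hx'
  rw [mem_closedBall_zero_iff, not_le] at hx'
  have h : ∀ y : E, 1 / 4 < ‖y‖ → bump.toFun y = 0 := by
    intro y hy
    refine image_eq_zero_of_notMem_tsupport fun hm => ?_
    have := tsupport_bump hm
    rw [mem_closedBall_zero_iff] at this
    linarith
  refine hx ?_
  change bump.toFun x - 4⁻¹ * bump.toFun ((2 : ℝ)⁻¹ • x) = 0
  rw [h x (by linarith), h _ (by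
    rw [norm_smul, norm_inv, Real.norm_of_nonneg zero_le_two]
    linarith), mul_zero, sub_zero]

/-- The factor 1/4 in `annulus` is the change of r⁻² under doubling of r. This is the telescoping
identity of the dyadic decomposition. -/
theorem annulus_scale (x : E) (r : ℝ) :
    annulus.scale x r = bump.scale x r - bump.scale x (2 * r) := by
  ext y
  change (annulus.scale x r).1 y = (bump.scale x r).1 y - (bump.scale x (2 * r)).1 y
  rw [CcFn.scale_apply, CcFn.scale_apply, CcFn.scale_apply,
    ← (bump.scale_summable x r y).tsum_sub (bump.scale_summable x (2 * r) y)]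
  refine tsum_congr fun n => ?_
  change _ * (bump.toFun _ - 4⁻¹ * bump.toFun _) = _
  rw [smul_smul, mul_inv, mul_sub]
  push_cast
  ring

theorem ofFn_one_scale (φ : CcFn) (x : E) {r : ℝ} (hr : 0 < r) :
    (ofFn 1).1 (φ.scale x r) = ∫ y, φ.toFun y := by
  rw [ofFn_scale _ _ _ hr]
  exact integral_congr_ae (Eventually.of_forall fun y => one_mul _)

theorem integral_annulus : ∫ x, annulus.toFun x = 0 := by
  rw [← ofFn_one_scale annulus 0 one_pos, annulus_scale, map_sub, ofFn_one_scale _ _ one_pos,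
    ofFn_one_scale _ _ (by norm_num), sub_self]

/-- Derivatives have mean zero, so they may be tested in the cancelling part of `PosBound` even when
the profile itself may not. -/
theorem integral_ccFn_deriv (i : Fin 2) (φ : CcFn) : ∫ x, (φ.deriv i).toFun x = 0 := by
  have h := deriv_scale i φ 0 1
  rw [inv_one, Complex.ofReal_one, one_smul] at h
  rw [← ofFn_one_scale (φ.deriv i) 0 one_pos, ← h, ofFn_apply, one_mul, tint_deriv]

/-- The kernels of the dyadic decomposition. -/
def kernel : ℕ → CcFn
  | 0 => bump
  | _ + 1 => annulus

/-- The kernels of the dyadic decomposition and their derivatives are bounded by this constant. -/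
def kernelConst : ℝ :=
  bump.exists_supBound_one.choose + annulus.exists_supBound_one.choose

theorem kernelConst_nonneg : 0 ≤ kernelConst :=
  add_nonneg bump.exists_supBound_one.choose_spec.1.le annulus.exists_supBound_one.choose_spec.1.le

theorem ballFn_kernel (n : ℕ) : BallFn 1 kernelConst (kernel n) := by
  have h1 := bump.exists_supBound_one.choose_spec
  have h2 := annulus.exists_supBound_one.choose_spec
  match n with
  | 0 => exact ⟨tsupport_bump_subset_ball, fun l hl x => (h1.2 l hl x).trans
      (le_add_of_nonneg_right h2.1.le)⟩
  | _ + 1 => exact ⟨tsupport_annulus, fun l hl x => (h2.2 l hl x).trans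
      (le_add_of_nonneg_left h1.1.le)⟩

theorem BallFn.mono {m n : ℕ} {b : ℝ} {φ : CcFn} (h : BallFn n b φ) (hmn : m ≤ n) : BallFn m b φ :=
  ⟨h.1, h.2.mono hmn⟩

theorem BallFn.deriv {b : ℝ} {φ : CcFn} (h : BallFn 1 b φ) (i : Fin 2) :
    BallFn 0 b (φ.deriv i) := by
  refine ⟨(tsupport_fderiv_apply_subset ℝ (EuclideanSpace.single i (1 : ℝ))).trans h.1, ?_⟩
  exact supBound_zero_iff.2 ((supBound_one_iff.1 h.2).2 i)

/-- The dyadic blocks of a distribution. -/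
def block (n : ℕ) (T : Dist) : TestFn := (corr T ((kernel n).scale 0 ((2 : ℝ)⁻¹ ^ n))).reflect

theorem reflect_corr_scale_apply (T : Dist) (φ : CcFn) (r : ℝ) (x : E) :
    (corr T (φ.scale 0 r)).reflect.1 x = T.1 (φ.scale x r) := by
  change T.1 (TestFn.translate (-x) _) = _
  rw [translate_scale, sub_neg_eq_add, zero_add]

theorem block_apply (n : ℕ) (T : Dist) (x : E) :
    (block n T).1 x = T.1 ((kernel n).scale x ((2 : ℝ)⁻¹ ^ n)) :=
  reflect_corr_scale_apply T _ _ x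

theorem block_add (n : ℕ) (S T : Dist) : block n (S + T) = block n S + block n T := rfl

theorem block_smul (n : ℕ) (c : ℂ) (T : Dist) : block n (c • T) = c • block n T := rfl

theorem pd_block (n : ℕ) (T : Dist) (i : Fin 2) (x : E) : pd i (block n T).1 x =
    -(((((2 : ℝ)⁻¹ ^ n)⁻¹ : ℝ) : ℂ) * T.1 (((kernel n).deriv i).scale x ((2 : ℝ)⁻¹ ^ n))) := by
  change (TestFn.deriv i (corr T ((kernel n).scale 0 ((2 : ℝ)⁻¹ ^ n))).reflect).1 x = _
  rw [deriv_reflect, deriv_corr, deriv_scale, map_smul]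
  change -(((((2 : ℝ)⁻¹ ^ n)⁻¹ : ℝ) : ℂ) * (corr T _).reflect.1 x) = _
  rw [reflect_corr_scale_apply]

theorem half_pow_mem (n : ℕ) : (2 : ℝ)⁻¹ ^ n ∈ Set.Ioc (0 : ℝ) 1 :=
  ⟨by positivity, pow_le_one₀ (by norm_num) (by norm_num)⟩

/-- Block zero is tested at unit scale, where no cancellation is required; the kernels of all later
blocks have mean zero. -/
theorem PosBound.norm_block_le {κ N : ℝ} {T : Dist} (hT : PosBound κ N T) (n : ℕ) (x : E) :
    ‖(block n T).1 x‖ ≤ kernelConst * (N * ((2 : ℝ)⁻¹ ^ n) ^ (1 - κ)) := by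
  rw [block_apply]
  match n with
  | 0 =>
    rw [pow_zero, Real.one_rpow, mul_one]
    exact hT.apply_one ((ballFn_kernel 0).mono zero_le_one) x
  | n + 1 =>
    exact hT.apply ((ballFn_kernel (n + 1)).mono zero_le_one) integral_annulus (half_pow_mem _) x

/-- A derivative falls on the kernel and costs one power of the scale. It also creates the mean
zero, so block zero needs no separate case. -/
theorem PosBound.norm_pd_block_le {κ N : ℝ} {T : Dist} (hT : PosBound κ N T) (n : ℕ) (i : Fin 2)
    (x : E) : ‖pd i (block n T).1 x‖ ≤
      kernelConst * (N * ((2 : ℝ)⁻¹ ^ n) ^ (1 - κ)) / (2 : ℝ)⁻¹ ^ n := by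
  have h0 := (half_pow_mem n).1
  rw [pd_block, norm_neg, norm_mul, Complex.norm_real, Real.norm_of_nonneg (by positivity),
    div_eq_inv_mul]
  exact mul_le_mul_of_nonneg_left (hT.apply ((ballFn_kernel n).deriv i) (integral_ccFn_deriv i _)
    (half_pow_mem n) x) (by positivity)

theorem sum_block (T : Dist) (m : ℕ) : ∑ n ∈ Finset.range (m + 1), block n T =
    (corr T (bump.scale 0 ((2 : ℝ)⁻¹ ^ m))).reflect := by
  induction m with
  | zero => simp [block, kernel]
  | succ m ih =>
    rw [Finset.sum_range_succ, ih]
    ext x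
    change (corr T (bump.scale 0 ((2 : ℝ)⁻¹ ^ m))).reflect.1 x + (block (m + 1) T).1 x = _
    rw [reflect_corr_scale_apply, reflect_corr_scale_apply, block_apply]
    change _ + T.1 (annulus.scale x _) = _
    rw [annulus_scale, pow_succ' _ m, ← mul_assoc, mul_inv_cancel₀ two_ne_zero, one_mul, map_sub]
    ring

theorem reflect_scale (φ : CcFn) (r : ℝ) : (φ.scale 0 r).reflect = φ.reflect.scale 0 r := by
  ext y
  change (φ.scale 0 r).1 (-y) = _
  rw [CcFn.scale_apply, CcFn.scale_apply, ← (Equiv.neg (Fin 2 → ℤ)).tsum_eq]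
  refine tsum_congr fun n => ?_
  change _ = _ * φ.toFun (-(r⁻¹ • (y + lat n - 0)))
  rw [Equiv.neg_apply, lat_neg, sub_zero, sub_zero, ← smul_neg, neg_add]

theorem IsMollifier.reflect {ρ : CcFn} (hρ : IsMollifier ρ) : IsMollifier ρ.reflect where
  nonneg x := hρ.nonneg (-x)
  support := by
    refine closure_minimal (fun x hx => ?_) Metric.isClosed_closedBall
    have h := hρ.support (subset_tsupport ρ.toFun (show ρ.toFun (-x) ≠ 0 from hx))
    simpa using h
  integral := (integral_neg_eq_self ρ.toFun volume).trans hρ.integral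

/-- The reflection appears because blocks correlate with the kernel while `mollify` convolves.
Partial sums are therefore mollifications, which converge to `T`. -/
theorem sum_block_eq_mollify (T : Dist) (m : ℕ) : ∑ n ∈ Finset.range (m + 1), block n T =
    mollify bump.reflect ((2 : ℝ)⁻¹ ^ m) T := by
  rw [sum_block, mollify, Dist.convFn, ← reflect_scale, TestFn.reflect_reflect]

theorem tendsto_half_pow : Tendsto (fun m : ℕ => (2 : ℝ)⁻¹ ^ m) atTop (𝓝[>] 0) :=
  tendsto_nhdsWithin_iff.2 ⟨tendsto_pow_atTop_nhds_zero_of_lt_one (by norm_num) (by norm_num),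
    Eventually.of_forall fun m => (half_pow_mem m).1⟩

/-! ### Young products -/

/-- The ratio of the geometric series in the estimate of Young products. -/
def youngRatio (κ : ℝ) : ℝ := (2 : ℝ)⁻¹ ^ (1 - 2 * κ)

theorem youngRatio_pos (κ : ℝ) : 0 < youngRatio κ := Real.rpow_pos_of_pos (by norm_num) _

theorem youngRatio_lt_one {κ : ℝ} (h : κ < 1 / 2) : youngRatio κ < 1 :=
  Real.rpow_lt_one (by norm_num) (by norm_num) (by linarith)

theorem half_pow_rpow (κ : ℝ) (n : ℕ) :
    ((2 : ℝ)⁻¹ ^ n) ^ (1 - κ) * ((2 : ℝ)⁻¹ ^ n) ^ (-κ) = youngRatio κ ^ n := by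
  rw [← Real.rpow_add (by positivity), youngRatio, ← Real.rpow_natCast, ← Real.rpow_natCast,
    ← Real.rpow_mul (by norm_num), ← Real.rpow_mul (by norm_num)]
  congr 1
  ring

/-- The constant in the estimate of the terms of a Young product. -/
def youngConst : ℝ := (mulConst + |globalConst|) * kernelConst

theorem youngConst_nonneg : 0 ≤ youngConst :=
  mul_nonneg (add_nonneg mulConst_nonneg (abs_nonneg _)) kernelConst_nonneg

/-- With s = 2^{-n}, the size s^{1-κ} of the block meets the loss s^{-κ} of multiplication; what
remains is s^{1-2κ}. -/
theorem norm_block_mul_scale_le {κ M N : ℝ} {T g : Dist} (hT : PosBound κ N T)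
    (hg : NegBound κ M g) (hM : 0 ≤ M) {φ : CcFn} (hφ : φ ∈ ballFns 1) {r : ℝ}
    (hr : r ∈ Set.Ioc (0 : ℝ) 1) (x : E) (n : ℕ) :
    ‖g.1 (block n T * φ.scale x r)‖ ≤ youngConst * N * M * r ^ (-κ) * youngRatio κ ^ n := by
  have hs := half_pow_mem n
  have hN := hT.nonneg
  have hr0 := Real.rpow_nonneg hr.1.le (-κ)
  have h := hg.norm_mul_scale_le hs (hT.norm_block_le n) (hT.norm_pd_block_le n) hφ hr x
  rw [Real.mul_rpow hr.1.le hs.1.le] at h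
  have hq := pow_nonneg (youngRatio_pos κ).le n
  have hk := kernelConst_nonneg
  calc _ ≤ _ := h
    _ = mulConst * kernelConst * N * M * r ^ (-κ) *
        (((2 : ℝ)⁻¹ ^ n) ^ (1 - κ) * ((2 : ℝ)⁻¹ ^ n) ^ (-κ)) := by ring
    _ = mulConst * (kernelConst * N * M * r ^ (-κ) * youngRatio κ ^ n) := by
      rw [half_pow_rpow]
      ring
    _ ≤ (mulConst + |globalConst|) * (kernelConst * N * M * r ^ (-κ) * youngRatio κ ^ n) :=
      mul_le_mul_of_nonneg_right (le_add_of_nonneg_right (abs_nonneg _)) (by positivity)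
    _ = _ := by
      rw [youngConst]
      ring

theorem norm_block_mul_le {κ M N : ℝ} {T g : Dist} (hT : PosBound κ N T) (hg : NegBound κ M g)
    (hM : 0 ≤ M) {B : ℝ} {φ : TestFn} (hφ : SupBound 1 B φ.1) (n : ℕ) :
    ‖g.1 (block n T * φ)‖ ≤ youngConst * N * M * B * youngRatio κ ^ n := by
  have hs := half_pow_mem n
  have hN := hT.nonneg
  have hB := hφ.nonneg
  have h := hg.norm_mul_le hs (hT.norm_block_le n) (hT.norm_pd_block_le n) hφ
  have hq := pow_nonneg (youngRatio_pos κ).le n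
  have hk := kernelConst_nonneg
  calc _ ≤ _ := h
    _ = globalConst * (kernelConst * N * M * B *
        (((2 : ℝ)⁻¹ ^ n) ^ (1 - κ) * ((2 : ℝ)⁻¹ ^ n) ^ (-κ))) := by ring
    _ ≤ (mulConst + |globalConst|) * (kernelConst * N * M * B *
        (((2 : ℝ)⁻¹ ^ n) ^ (1 - κ) * ((2 : ℝ)⁻¹ ^ n) ^ (-κ))) :=
      mul_le_mul_of_nonneg_right ((le_abs_self _).trans (le_add_of_nonneg_left mulConst_nonneg))
        (by positivity)
    _ = _ := by
      rw [half_pow_rpow, youngConst]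
      ring

theorem summable_block_mul {κ M N : ℝ} (hκ : κ < 1 / 2) {T g : Dist} (hT : PosBound κ N T)
    (hg : NegBound κ M g) (hM : 0 ≤ M) (φ : TestFn) :
    Summable fun n => g.1 (block n T * φ) := by
  obtain ⟨B, hB⟩ := exists_supBound 1 φ
  exact Summable.of_norm_bounded ((summable_geometric_of_lt_one (youngRatio_pos κ).le
    (youngRatio_lt_one hκ)).mul_left _) (norm_block_mul_le hT hg hM hB)

/-- The Young product of two distributions, in terms of the dyadic blocks of the first one. -/
def youngProd {κ M N : ℝ} (hκ : κ < 1 / 2) {T g : Dist} (hT : PosBound κ N T)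
    (hg : NegBound κ M g) (hM : 0 ≤ M) : Dist :=
  ⟨{ toFun := fun φ => ∑' n, g.1 (block n T * φ)
     map_add' := fun φ ψ => by
      rw [← (summable_block_mul hκ hT hg hM φ).tsum_add (summable_block_mul hκ hT hg hM ψ)]
      exact tsum_congr fun n => by rw [mul_add, map_add]
     map_smul' := fun c φ => by
      rw [RingHom.id_apply, smul_eq_mul, ← tsum_mul_left]
      exact tsum_congr fun n => by rw [mul_smul_comm, map_smul, smul_eq_mul] }, by
    refine ⟨1, youngConst * N * M * (1 - youngRatio κ)⁻¹, fun φ B hB => ?_⟩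
    refine (tsum_of_norm_bounded ((hasSum_geometric_of_lt_one (youngRatio_pos κ).le
      (youngRatio_lt_one hκ)).mul_left _) (norm_block_mul_le hT hg hM hB)).trans (le_of_eq ?_)
    ring⟩

theorem youngProd_apply {κ M N : ℝ} (hκ : κ < 1 / 2) {T g : Dist} (hT : PosBound κ N T)
    (hg : NegBound κ M g) (hM : 0 ≤ M) (φ : TestFn) :
    (youngProd hκ hT hg hM).1 φ = ∑' n, g.1 (block n T * φ) := rfl

/-- The tail of a geometric series. The case m = 0 is the continuity of the product; letting m grow
approximates it by products with smooth functions. -/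
theorem negBound_youngProd_sub {κ M N : ℝ} (hκ : κ < 1 / 2) {T g : Dist} (hT : PosBound κ N T)
    (hg : NegBound κ M g) (hM : 0 ≤ M) (m : ℕ) :
    NegBound κ (youngConst * N * M * (1 - youngRatio κ)⁻¹ * youngRatio κ ^ m)
      (youngProd hκ hT hg hM - mulDist (∑ n ∈ Finset.range m, block n T) g) := by
  intro φ hφ r hr x
  have hs := summable_block_mul hκ hT hg hM (φ.scale x r)
  have e : (youngProd hκ hT hg hM - mulDist (∑ n ∈ Finset.range m, block n T) g).1
      (φ.scale x r) = ∑' n, g.1 (block (n + m) T * φ.scale x r) := by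
    change (youngProd hκ hT hg hM).1 _ - (mulDist _ g).1 _ = _
    rw [youngProd_apply, mulDist_apply, Finset.sum_mul, map_sum, ← hs.sum_add_tsum_nat_add m,
      add_sub_cancel_left]
  rw [e]
  refine (tsum_of_norm_bounded (((hasSum_geometric_of_lt_one (youngRatio_pos κ).le
    (youngRatio_lt_one hκ)).mul_left (youngConst * N * M * r ^ (-κ) * youngRatio κ ^ m)))
    fun n => ?_).trans (le_of_eq (by ring))
  refine (norm_block_mul_scale_le hT hg hM hφ hr x (n + m)).trans (le_of_eq ?_)
  ring

/-- The partial sums multiply `g` by smooth functions, which preserves the little space, and they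
converge in norm. -/
theorem youngProd_mem_littleHZ {κ M N : ℝ} (h0 : 0 < κ) (hκ : κ < 1 / 2) {T g : Dist}
    (hT : PosBound κ N T) (hg : NegBound κ M g) (hM : 0 ≤ M) (hgl : g ∈ littleHZ (-κ)) :
    youngProd hκ hT hg hM ∈ littleHZ (-κ) := by
  refine mem_littleHZ_of_approx fun δ hδ => ?_
  have hlim : Tendsto (fun m : ℕ => ENNReal.ofReal
      (youngConst * N * M * (1 - youngRatio κ)⁻¹ * youngRatio κ ^ m)) atTop (𝓝 0) := by
    have := (tendsto_pow_atTop_nhds_zero_of_lt_one (youngRatio_pos κ).le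
      (youngRatio_lt_one hκ)).const_mul (youngConst * N * M * (1 - youngRatio κ)⁻¹)
    rw [mul_zero] at this
    simpa using ENNReal.tendsto_ofReal this
  obtain ⟨m, hm⟩ := (hlim.eventually (gt_mem_nhds hδ)).exists
  refine ⟨_, mulDist_mem_littleHZ h0 (by linarith) (∑ n ∈ Finset.range m, block n T) hgl, ?_⟩
  refine lt_of_le_of_lt ((hzNorm_neg_le_iff h0 (by linarith) ?_).2
    (negBound_youngProd_sub hκ hT hg hM m)) hm
  have := sub_pos.2 (youngRatio_lt_one hκ)
  have := youngRatio_pos κ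
  have := youngConst_nonneg
  have := hT.nonneg
  positivity

/-- The partial sums pair `g φ` with mollifications of `f`, and these converge to `f` as
distributions. -/
theorem youngProd_ofFn {κ M N : ℝ} (hκ : κ < 1 / 2) {f g : TestFn} (hT : PosBound κ N (ofFn f))
    (hg : NegBound κ M (ofFn g)) (hM : 0 ≤ M) : youngProd hκ hT hg hM = ofFn (f * g) := by
  refine Subtype.ext (LinearMap.ext fun φ => ?_)
  rw [youngProd_apply]
  -- The shift by one matches `Finset.range (m + 1)` with the mollification at scale 2^{-m}.
  have h1 := ((summable_block_mul hκ hT hg hM φ).hasSum.tendsto_sum_nat).comp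
    (tendsto_add_atTop_nat 1)
  have h2 := (isMollifier_bump.reflect.tendsto_mollify (ofFn f) (g * φ)).comp tendsto_half_pow
  have e : (ofFn (f * g)).1 φ = (ofFn f).1 (g * φ) := by
    rw [ofFn_apply, ofFn_apply, mul_assoc]
  rw [e]
  refine tendsto_nhds_unique h1 (h2.congr fun m => ?_)
  simp only [Function.comp_apply]
  rw [← sum_block_eq_mollify, ← map_sum, ← Finset.sum_mul, ofFn_apply, ofFn_apply, mul_left_comm]

theorem hzNorm_lt_top {α : ℝ} (T : littleHZ α) : hzNorm α (T : Dist) < ⊤ := T.2.1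

/-- The Young product as a bilinear map on little Hölder-Zygmund spaces. -/
def youngMap {κ : ℝ} (h0 : 0 < κ) (hκ : κ < 1 / 2) :
    littleHZ (1 - κ) →ₗ[ℂ] littleHZ (-κ) →ₗ[ℂ] littleHZ (-κ) :=
  have h1 : κ < 1 := by linarith
  -- The value of the series does not depend on the bounds chosen for the two factors, so
  -- bilinearity can be checked term by term once summability is known.
  have key : ∀ (T : littleHZ (1 - κ)) (g : littleHZ (-κ)) (φ : TestFn),
      Summable fun n => (g : Dist).1 (block n T * φ) := fun T g φ =>
    summable_block_mul hκ (exists_posBound h0 h1 (hzNorm_lt_top T))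
      (exists_negBound h0 h1 (hzNorm_lt_top g)) ENNReal.toReal_nonneg φ
  LinearMap.mk₂ ℂ
    (fun T g => ⟨youngProd hκ (exists_posBound h0 h1 (hzNorm_lt_top T))
      (exists_negBound h0 h1 (hzNorm_lt_top g)) ENNReal.toReal_nonneg,
      youngProd_mem_littleHZ h0 hκ _ _ _ g.2⟩)
    (fun S T g => by
      refine Subtype.ext (Subtype.ext (LinearMap.ext fun φ => ?_))
      change ∑' n, (g : Dist).1 (block n ((S : Dist) + T) * φ) =
        ∑' n, (g : Dist).1 (block n S * φ) + ∑' n, (g : Dist).1 (block n T * φ)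
      rw [← (key S g φ).tsum_add (key T g φ)]
      exact tsum_congr fun n => by rw [block_add, add_mul, map_add])
    (fun c T g => by
      refine Subtype.ext (Subtype.ext (LinearMap.ext fun φ => ?_))
      change ∑' n, (g : Dist).1 (block n (c • (T : Dist)) * φ) =
        c * ∑' n, (g : Dist).1 (block n T * φ)
      rw [← tsum_mul_left]
      exact tsum_congr fun n => by rw [block_smul, smul_mul_assoc, map_smul, smul_eq_mul])
    (fun T f g => by
      refine Subtype.ext (Subtype.ext (LinearMap.ext fun φ => ?_))
      change ∑' n, ((f : Dist).1 (block n T * φ) + (g : Dist).1 (block n T * φ)) =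
        ∑' n, (f : Dist).1 (block n T * φ) + ∑' n, (g : Dist).1 (block n T * φ)
      rw [← (key T f φ).tsum_add (key T g φ)])
    (fun c T g => by
      refine Subtype.ext (Subtype.ext (LinearMap.ext fun φ => ?_))
      change ∑' n, c * (g : Dist).1 (block n T * φ) = c * ∑' n, (g : Dist).1 (block n T * φ)
      rw [← tsum_mul_left])

theorem isYoungMap_youngMap {κ : ℝ} (h0 : 0 < κ) (hκ : κ < 1 / 2) :
    IsYoungMap (1 - κ) (-κ) (youngMap h0 hκ) where
  continuous := by
    have h1 : κ < 1 := by linarith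
    have hq := sub_pos.2 (youngRatio_lt_one hκ)
    have hC : 0 ≤ youngConst * (1 - youngRatio κ)⁻¹ :=
      mul_nonneg youngConst_nonneg (inv_nonneg.2 hq.le)
    refine ⟨⟨_, hC⟩, fun f g => ?_⟩
    have hf := exists_posBound h0 h1 (hzNorm_lt_top f)
    have hg := exists_negBound h0 h1 (hzNorm_lt_top g)
    -- With m = 0 nothing is subtracted, and the tail estimate bounds the whole product.
    have h := negBound_youngProd_sub hκ hf hg ENNReal.toReal_nonneg 0
    have e : youngProd hκ hf hg ENNReal.toReal_nonneg -
        mulDist (∑ n ∈ Finset.range 0, block n (f : Dist)) g =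
        youngProd hκ hf hg ENNReal.toReal_nonneg := by
      refine Subtype.ext (LinearMap.ext fun φ => ?_)
      change _ - (g : Dist).1 (_ * φ) = _
      rw [Finset.sum_range_zero, zero_mul, map_zero, sub_zero]
    rw [e, pow_zero, mul_one] at h
    have hN := ENNReal.toReal_nonneg (a := hzNorm (1 - κ) (f : Dist))
    have hM := ENNReal.toReal_nonneg (a := hzNorm (-κ) (g : Dist))
    have h2 := (hzNorm_neg_le_iff h0 h1 (mul_nonneg (mul_nonneg (mul_nonneg youngConst_nonneg hN)
      hM) (inv_nonneg.2 hq.le))).2 h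
    refine le_trans h2 (le_of_eq ?_)
    rw [show youngConst * (hzNorm (1 - κ) (f : Dist)).toReal * (hzNorm (-κ) (g : Dist)).toReal *
      (1 - youngRatio κ)⁻¹ = youngConst * (1 - youngRatio κ)⁻¹ *
      (hzNorm (1 - κ) (f : Dist)).toReal * (hzNorm (-κ) (g : Dist)).toReal by ring,
      ENNReal.ofReal_mul (mul_nonneg hC hN), ENNReal.ofReal_mul hC,
      ENNReal.ofReal_toReal (hzNorm_lt_top f).ne, ENNReal.ofReal_toReal (hzNorm_lt_top g).ne]
    congr 2
    exact ENNReal.ofReal_eq_coe_nnreal hC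
  extends_mul f g hf hg :=
    youngProd_ofFn hκ (exists_posBound h0 (by linarith) hf.1)
      (exists_negBound h0 (by linarith) hg.1) ENNReal.toReal_nonneg

/-! ### Hölder-Zygmund bounds from sup and Lipschitz bounds -/

/-- `f` is bounded by `A` and Lipschitz with constant `B`. -/
def LipBound (A B : ℝ) (f : E → ℂ) : Prop :=
  (∀ x, ‖f x‖ ≤ A) ∧ ∀ x y, ‖f y - f x‖ ≤ B * ‖y - x‖

/-- The volume of the unit ball. -/
def ballVol : ℝ := volume.real (Metric.ball (0 : E) 1)

theorem ballVol_nonneg : 0 ≤ ballVol := measureReal_nonneg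

theorem norm_integral_ball_le {c : E → ℂ} {φ : CcFn} (hφ : φ ∈ ballFns 0) {b : ℝ}
    (hc : ∀ y, ‖y‖ < 1 → ‖c y‖ ≤ b) (hb : 0 ≤ b) : ‖∫ y, c y * φ.toFun y‖ ≤ b * ballVol := by
  rw [← setIntegral_eq_integral_of_forall_compl_eq_zero (s := Metric.ball (0 : E) 1)
    fun y hy => by rw [image_eq_zero_of_notMem_tsupport fun h => hy (hφ.1 h), mul_zero]]
  refine norm_setIntegral_le_of_norm_le_const measure_ball_lt_top fun y hy => ?_
  rw [norm_mul]
  exact (mul_le_mul (hc y (mem_ball_zero_iff.1 hy)) (supBound_zero_iff.1 hφ.2 y) (norm_nonneg _)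
    hb).trans_eq (mul_one b)

/-- Interpolation: in t = t^κ · t^{1-κ} each factor takes a different bound. It is applied to the
sup and the Lipschitz bound. -/
theorem le_rpow_mul_rpow {t a b κ : ℝ} (ht : 0 ≤ t) (ha : t ≤ a) (hb : t ≤ b) (h0 : 0 ≤ κ)
    (h1 : κ ≤ 1) : t ≤ a ^ κ * b ^ (1 - κ) := by
  rcases ht.eq_or_lt with rfl | ht0
  · exact mul_nonneg (Real.rpow_nonneg ha _) (Real.rpow_nonneg hb _)
  · calc t = t ^ κ * t ^ (1 - κ) := by
          rw [← Real.rpow_add ht0, add_sub_cancel, Real.rpow_one]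
      _ ≤ a ^ κ * b ^ (1 - κ) := mul_le_mul (Real.rpow_le_rpow ht ha h0)
          (Real.rpow_le_rpow ht hb (by linarith)) (Real.rpow_nonneg ht _)
          (Real.rpow_nonneg (ht.trans ha) _)

theorem LipBound.nonneg {A B : ℝ} {f : E → ℂ} (h : LipBound A B f) : 0 ≤ A ∧ 0 ≤ B := by
  refine ⟨(norm_nonneg _).trans (h.1 0), ?_⟩
  have := (norm_nonneg _).trans (h.2 0 (EuclideanSpace.single 0 1))
  simpa using this

theorem LipBound.norm_scale_le {A B : ℝ} {f : TestFn} (h : LipBound A B f.1) {φ : CcFn}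
    (hφ : φ ∈ ballFns 0) {r : ℝ} (hr : 0 < r) (x : E) :
    ‖(ofFn f).1 (φ.scale x r)‖ ≤ A * ballVol := by
  rw [ofFn_scale _ _ _ hr]
  exact norm_integral_ball_le hφ (fun y _ => h.1 _) h.nonneg.1

/-- The mean-zero profile allows f(x) to be subtracted, which gives the bound Br; interpolating it
with the sup bound A produces r^{1-κ}. -/
theorem LipBound.norm_scale_le_of_integral_eq_zero {A B κ : ℝ} {f : TestFn}
    (h : LipBound A B f.1) (h0 : 0 ≤ κ) (h1 : κ ≤ 1) {φ : CcFn} (hφ : φ ∈ ballFns 0)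
    (hz : ∫ z, φ.toFun z = 0) {r : ℝ} (hr : 0 < r) (x : E) :
    ‖(ofFn f).1 (φ.scale x r)‖ ≤ A ^ κ * B ^ (1 - κ) * ballVol * r ^ (1 - κ) := by
  have hV := ballVol_nonneg
  obtain ⟨hA, hB⟩ := h.nonneg
  have e1 := h.norm_scale_le hφ hr x
  have e2 : ‖(ofFn f).1 (φ.scale x r)‖ ≤ B * r * ballVol := by
    have hi : Integrable fun y => f.1 (x + r • y) * φ.toFun y :=
      ((f.smooth.continuous.comp (by fun_prop)).mul
        φ.smooth.continuous).integrable_of_hasCompactSupport φ.compact.mul_left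
    have e : (ofFn f).1 (φ.scale x r) = ∫ y, (f.1 (x + r • y) - f.1 x) * φ.toFun y := by
      simp only [sub_mul]
      rw [integral_sub hi (φ.integrable.const_mul _), integral_const_mul, hz, mul_zero, sub_zero,
        ofFn_scale _ _ _ hr]
    rw [e]
    refine norm_integral_ball_le hφ (fun y hy => ?_) (by positivity)
    refine (h.2 _ _).trans ?_
    rw [add_sub_cancel_left, norm_smul, Real.norm_of_nonneg hr.le]
    nlinarith [mul_nonneg hB hr.le]
  refine (le_rpow_mul_rpow (norm_nonneg _) e1 e2 h0 h1).trans (le_of_eq ?_)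
  have hVV : ballVol ^ κ * ballVol ^ (1 - κ) = ballVol := by
    have hpos : 0 < ballVol :=
      ENNReal.toReal_pos (Metric.measure_ball_pos volume _ one_pos).ne' measure_ball_lt_top.ne
    rw [← Real.rpow_add hpos, add_sub_cancel, Real.rpow_one]
  rw [Real.mul_rpow hA hV, Real.mul_rpow (by positivity) hV, Real.mul_rpow hB hr.le,
    ← hVV, hVV]
  calc A ^ κ * ballVol ^ κ * (B ^ (1 - κ) * r ^ (1 - κ) * ballVol ^ (1 - κ)) =
      A ^ κ * B ^ (1 - κ) * (ballVol ^ κ * ballVol ^ (1 - κ)) * r ^ (1 - κ) := by ring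
    _ = _ := by rw [hVV]

/-- The sup bounds are summed for the unit-scale part and the interpolated bounds for the cancelling
part. -/
theorem posBound_of_hasSum {κ : ℝ} (h0 : 0 ≤ κ) (h1 : κ ≤ 1) {T : Dist} {P : ℕ → TestFn}
    {A B : ℕ → ℝ} (hP : ∀ n, LipBound (A n) (B n) (P n).1)
    (hT : ∀ φ : TestFn, HasSum (fun n => (ofFn (P n)).1 φ) (T.1 φ)) (hA : Summable A)
    (hAB : Summable fun n => A n ^ κ * B n ^ (1 - κ)) :
    PosBound κ ((∑' n, A n + ∑' n, A n ^ κ * B n ^ (1 - κ)) * ballVol) T := by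
  have hV := ballVol_nonneg
  have hA0 : 0 ≤ ∑' n, A n := tsum_nonneg fun n => (hP n).nonneg.1
  have hAB0 : 0 ≤ ∑' n, A n ^ κ * B n ^ (1 - κ) := tsum_nonneg fun n =>
    mul_nonneg (Real.rpow_nonneg (hP n).nonneg.1 _) (Real.rpow_nonneg (hP n).nonneg.2 _)
  constructor
  · intro φ hφ x
    rw [← (hT _).tsum_eq]
    refine (tsum_of_norm_bounded (hA.hasSum.mul_right ballVol) fun n =>
      (hP n).norm_scale_le hφ one_pos x).trans ?_
    exact mul_le_mul_of_nonneg_right (le_add_of_nonneg_right hAB0) hV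
  · intro φ hφ hz r hr x
    rw [← (hT _).tsum_eq]
    refine (tsum_of_norm_bounded ((hAB.hasSum.mul_right ballVol).mul_right (r ^ (1 - κ)))
      fun n => (hP n).norm_scale_le_of_integral_eq_zero h0 h1 hφ hz hr.1 x).trans ?_
    exact mul_le_mul_of_nonneg_right (mul_le_mul_of_nonneg_right (le_add_of_nonneg_left hA0) hV)
      (Real.rpow_nonneg hr.1.le _)

theorem TestFn.exists_lipBound (f : TestFn) : ∃ A B, LipBound A B f.1 := by
  obtain ⟨A, hA⟩ := f.bounded
  obtain ⟨B, -, hB⟩ := f.lipschitz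
  exact ⟨A, B, hA, hB⟩

theorem ofFn_mem_littleHZ_pos {κ : ℝ} (h0 : 0 < κ) (h1 : κ < 1) (f : TestFn) :
    ofFn f ∈ littleHZ (1 - κ) := by
  obtain ⟨A, B, h⟩ := f.exists_lipBound
  have hV := ballVol_nonneg
  obtain ⟨hA, hB⟩ := h.nonneg
  have hw : 0 ≤ A ^ κ * B ^ (1 - κ) := mul_nonneg (Real.rpow_nonneg hA _) (Real.rpow_nonneg hB _)
  have hp : PosBound κ ((A + A ^ κ * B ^ (1 - κ)) * ballVol) (ofFn f) := by
    refine ⟨fun φ hφ x => (h.norm_scale_le hφ one_pos x).trans ?_, fun φ hφ hz r hr x =>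
      (h.norm_scale_le_of_integral_eq_zero h0.le h1.le hφ hz hr.1 x).trans ?_⟩
    · exact mul_le_mul_of_nonneg_right (le_add_of_nonneg_right hw) hV
    · exact mul_le_mul_of_nonneg_right (mul_le_mul_of_nonneg_right (le_add_of_nonneg_left hA) hV)
        (Real.rpow_nonneg hr.1.le _)
  refine ⟨(hzNorm_pos_le h0 h1 hp.nonneg hp).trans_lt ENNReal.ofReal_lt_top, fun δ hδ => ⟨f, ?_⟩⟩
  rwa [sub_self, hzNorm_zero]

/-! ### Derivatives -/

/-- The derivative moves to the profile, giving it mean zero and costing r⁻¹, so r^{1-κ} becomes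
r^{-κ}. -/
theorem PosBound.deriv {κ N : ℝ} {T : Dist} (hT : PosBound κ N T) (i : Fin 2) :
    NegBound κ N (T.deriv i) := by
  intro φ hφ r hr x
  change ‖-T.1 (TestFn.deriv i (φ.scale x r))‖ ≤ _
  rw [norm_neg, deriv_scale, map_smul, norm_smul, Complex.norm_real,
    Real.norm_of_nonneg (inv_nonneg.2 hr.1.le)]
  have h := hT.apply (BallFn.deriv hφ i) (integral_ccFn_deriv i φ) hr x
  rw [one_mul] at h
  refine (mul_le_mul_of_nonneg_left h (inv_nonneg.2 hr.1.le)).trans (le_of_eq ?_)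
  rw [sub_eq_add_neg, Real.rpow_add hr.1, Real.rpow_one]
  have := hr.1.ne'
  field_simp

theorem hzNorm_deriv_le {κ : ℝ} (h0 : 0 < κ) (h1 : κ < 1) (T : Dist) (i : Fin 2) :
    hzNorm (-κ) (T.deriv i) ≤ hzNorm (1 - κ) T := by
  rcases eq_or_ne (hzNorm (1 - κ) T) ⊤ with h | h
  · rw [h]
    exact le_top
  · have := (hzNorm_neg_le_iff h0 h1 ENNReal.toReal_nonneg).2
      ((exists_posBound h0 h1 h.lt_top).deriv i)
    rwa [ENNReal.ofReal_toReal h] at this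

theorem deriv_mem_littleHZ {κ : ℝ} (h0 : 0 < κ) (h1 : κ < 1) {T : Dist}
    (hT : T ∈ littleHZ (1 - κ)) (i : Fin 2) : T.deriv i ∈ littleHZ (-κ) := by
  refine ⟨(hzNorm_deriv_le h0 h1 T i).trans_lt hT.1, fun δ hδ => ?_⟩
  obtain ⟨f, hf⟩ := hT.2 δ hδ
  refine ⟨TestFn.deriv i f, ?_⟩
  have e : T.deriv i - ofFn (TestFn.deriv i f) = (T - ofFn f).deriv i := by
    rw [ofFn_deriv]
    refine Subtype.ext (LinearMap.ext fun φ => ?_)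
    change -T.1 _ - -(ofFn f).1 _ = -(T.1 _ - (ofFn f).1 _)
    ring
  rw [e]
  exact (hzNorm_deriv_le h0 h1 _ i).trans_lt hf

/-! ### Mollification in Hölder-Zygmund spaces -/

theorem mollify_apply (ρ : CcFn) {ε : ℝ} (hε : 0 < ε) (f : TestFn) (x : E) :
    (mollify ρ ε (ofFn f)).1 x = ∫ y, f.1 (x + ε • y) * ρ.reflect.toFun y := by
  rw [mollify, Dist.convFn, reflect_scale, reflect_corr_scale_apply, ofFn_scale _ _ _ hε]

theorem conv_comm (S T : Dist) : S.conv T = T.conv S :=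
  Dist.ext_mode fun k => by rw [conv_mode, conv_mode, mul_comm]

/-- Moves the mollification onto the test function, so that a series of distributions can be
mollified term by term. -/
theorem ofFn_mollify_eq_apply (ρ : CcFn) (ε : ℝ) (T : Dist) (φ : TestFn) :
    (ofFn (mollify ρ ε T)).1 φ = T.1 (corr (ofFn (ρ.scale 0 ε)) φ) := by
  rw [mollify, ofFn_convFn, conv_comm]
  rfl

theorem IsMollifier.norm_integral_le' {ρ : CcFn} (hρ : IsMollifier ρ) {c : E → ℂ} {b : ℝ}
    (hc : ∀ y, ‖y‖ ≤ 1 → ‖c y‖ ≤ b) : ‖∫ y, c y * ρ.toFun y‖ ≤ b := by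
  have hi : Integrable fun y => b * ‖ρ.toFun y‖ := ρ.integrable.norm.const_mul b
  refine (norm_integral_le_of_norm_le hi (Eventually.of_forall fun y => ?_)).trans ?_
  · rw [norm_mul]
    by_cases hy : ‖y‖ ≤ 1
    · exact mul_le_mul_of_nonneg_right (hc y hy) (norm_nonneg _)
    · have hz : ρ.toFun y = 0 :=
        image_eq_zero_of_notMem_tsupport fun h => hy (by simpa using hρ.support h)
      rw [hz]
      simp
  · rw [integral_const_mul, hρ.integral_norm, mul_one]

/-- The sup norm gains a factor ε from the Lipschitz bound, as the mollifier lives in the unit ball.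
The Lipschitz constant gains nothing and merely doubles; interpolation makes the gain in sup norm
suffice. -/
theorem LipBound.sub_mollify {A B : ℝ} {f : TestFn} (h : LipBound A B f.1) {ρ : CcFn}
    (hρ : IsMollifier ρ) {ε : ℝ} (hε : 0 < ε) :
    LipBound (min (2 * A) (B * ε)) (2 * B) (f - mollify ρ ε (ofFn f) : TestFn).1 := by
  obtain ⟨hA, hB⟩ := h.nonneg
  have hρ' := hρ.reflect
  have hi : ∀ x, Integrable fun y => f.1 (x + ε • y) * ρ.reflect.toFun y := fun x =>
    ((f.smooth.continuous.comp (by fun_prop)).mul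
      ρ.reflect.smooth.continuous).integrable_of_hasCompactSupport ρ.reflect.compact.mul_left
  have e : ∀ x, (f - mollify ρ ε (ofFn f) : TestFn).1 x =
      ∫ y, (f.1 x - f.1 (x + ε • y)) * ρ.reflect.toFun y := by
    intro x
    change f.1 x - (mollify ρ ε (ofFn f)).1 x = _
    simp only [sub_mul]
    rw [integral_sub (ρ.reflect.integrable.const_mul _) (hi x), integral_const_mul,
      hρ'.integral, mul_one, mollify_apply ρ hε]
  constructor
  · intro x
    rw [e]
    refine hρ'.norm_integral_le' fun y hy => le_min ?_ ?_
    · refine (norm_sub_le _ _).trans ?_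
      linarith [h.1 x, h.1 (x + ε • y)]
    · refine (h.2 _ _).trans ?_
      rw [sub_add_cancel_left, norm_neg, norm_smul, Real.norm_of_nonneg hε.le]
      nlinarith [mul_nonneg hB hε.le]
  · intro x z
    rw [e, e, ← integral_sub]
    · simp only [← sub_mul]
      refine hρ'.norm_integral_le fun y => ?_
      have h2 := h.2 (x + ε • y) (z + ε • y)
      rw [add_sub_add_right_eq_sub] at h2
      rw [show f.1 z - f.1 (z + ε • y) - (f.1 x - f.1 (x + ε • y)) =
        (f.1 z - f.1 x) - (f.1 (z + ε • y) - f.1 (x + ε • y)) by ring]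
      refine (norm_sub_le _ _).trans ?_
      linarith [h.2 x z]
    · simp only [sub_mul]
      exact (ρ.reflect.integrable.const_mul _).sub (hi z)
    · simp only [sub_mul]
      exact (ρ.reflect.integrable.const_mul _).sub (hi x)

/-- The error of each block tends to zero with ε, while its contribution stays below twice the
summable bound of the block itself. Dominated convergence over the blocks concludes. -/
theorem tendsto_hzNorm_sub_mollify {κ : ℝ} (h0 : 0 < κ) (h1 : κ < 1) {T : Dist}
    {P : ℕ → TestFn} {A B : ℕ → ℝ} (hP : ∀ n, LipBound (A n) (B n) (P n).1)
    (hT : ∀ φ : TestFn, HasSum (fun n => (ofFn (P n)).1 φ) (T.1 φ)) (hA : Summable A)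
    (hAB : Summable fun n => A n ^ κ * B n ^ (1 - κ)) {ρ : CcFn} (hρ : IsMollifier ρ) :
    Tendsto (fun ε : ℝ => hzNorm (1 - κ) (T - ofFn (mollify ρ ε T))) (𝓝[>] 0) (𝓝 0) := by
  have hA0 := fun n => (hP n).nonneg.1
  have hB0 := fun n => (hP n).nonneg.2
  have hw0 : ∀ n, 0 ≤ A n ^ κ * B n ^ (1 - κ) := fun n =>
    mul_nonneg (Real.rpow_nonneg (hA0 n) _) (Real.rpow_nonneg (hB0 n) _)
  have hm0 : ∀ n, ∀ ε : ℝ, 0 < ε → 0 ≤ min (2 * A n) (B n * ε) := fun n ε hε =>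
    le_min (mul_nonneg zero_le_two (hA0 n)) (mul_nonneg (hB0 n) hε.le)
  have hb1 : ∀ n, ∀ ε : ℝ, 0 < ε → ‖min (2 * A n) (B n * ε)‖ ≤ 2 * A n := fun n ε hε => by
    rw [Real.norm_of_nonneg (hm0 n ε hε)]
    exact min_le_left _ _
  have hb2 : ∀ n, ∀ ε : ℝ, 0 < ε → ‖min (2 * A n) (B n * ε) ^ κ * (2 * B n) ^ (1 - κ)‖ ≤
      2 * (A n ^ κ * B n ^ (1 - κ)) := fun n ε hε => by
    rw [Real.norm_of_nonneg (mul_nonneg (Real.rpow_nonneg (hm0 n ε hε) _)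
      (Real.rpow_nonneg (mul_nonneg zero_le_two (hB0 n)) _))]
    refine (mul_le_mul_of_nonneg_right (Real.rpow_le_rpow (hm0 n ε hε) (min_le_left _ _) h0.le)
      (Real.rpow_nonneg (mul_nonneg zero_le_two (hB0 n)) _)).trans (le_of_eq ?_)
    rw [Real.mul_rpow zero_le_two (hA0 n), Real.mul_rpow zero_le_two (hB0 n)]
    have : (2 : ℝ) ^ κ * 2 ^ (1 - κ) = 2 := by
      rw [← Real.rpow_add two_pos, add_sub_cancel, Real.rpow_one]
    linear_combination (A n ^ κ * B n ^ (1 - κ)) * this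
  have hl : ∀ n, Tendsto (fun ε : ℝ => min (2 * A n) (B n * ε)) (𝓝[>] 0) (𝓝 0) := fun n => by
    have hc : Continuous fun ε : ℝ => min (2 * A n) (B n * ε) := by fun_prop
    have := (hc.tendsto 0).mono_left (nhdsWithin_le_nhds (s := Set.Ioi 0))
    simpa [hA0 n] using this
  have hl1 := tendsto_tsum_of_dominated_convergence (hA.mul_left 2) hl
    (by filter_upwards [self_mem_nhdsWithin] with ε hε n using hb1 n ε hε)
  have hl2 := tendsto_tsum_of_dominated_convergence (𝓕 := 𝓝[>] (0 : ℝ)) (hAB.mul_left 2)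
    (f := fun (ε : ℝ) n => min (2 * A n) (B n * ε) ^ κ * (2 * B n) ^ (1 - κ)) (g := fun _ => 0)
    (fun n => by
      have := ((hl n).rpow_const (p := κ) (Or.inr h0.le)).mul_const ((2 * B n) ^ (1 - κ))
      rwa [Real.zero_rpow h0.ne', zero_mul] at this)
    (by filter_upwards [self_mem_nhdsWithin] with ε hε n using hb2 n ε hε)
  rw [tsum_zero] at hl1 hl2
  have hl3 := ENNReal.tendsto_ofReal (((hl1.add hl2).mul_const ballVol).const_mul 2)
  simp only [add_zero, zero_mul, mul_zero, ENNReal.ofReal_zero] at hl3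
  refine tendsto_of_tendsto_of_tendsto_of_le_of_le' tendsto_const_nhds hl3
    (Eventually.of_forall fun _ => bot_le) ?_
  filter_upwards [self_mem_nhdsWithin] with ε hε
  -- Mollification passes to the test function, hence commutes with the sum over the blocks.
  have hsum : ∀ φ : TestFn, HasSum (fun n => (ofFn (P n - mollify ρ ε (ofFn (P n)))).1 φ)
      ((T - ofFn (mollify ρ ε T)).1 φ) := by
    intro φ
    have h2 := (hT φ).sub (hT (corr (ofFn (ρ.scale 0 ε)) φ))
    have e : ∀ n, (ofFn (P n - mollify ρ ε (ofFn (P n)))).1 φ =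
        (ofFn (P n)).1 φ - (ofFn (P n)).1 (corr (ofFn (ρ.scale 0 ε)) φ) := by
      intro n
      rw [← ofFn_mollify_eq_apply, ofFn_symm, map_sub, ofFn_symm φ, ofFn_symm φ]
    simp only [e]
    rw [← ofFn_mollify_eq_apply] at h2
    exact h2
  have hp := posBound_of_hasSum h0.le h1.le (fun n => (hP n).sub_mollify hρ hε) hsum
    (Summable.of_norm_bounded (hA.mul_left 2) fun n => hb1 n ε hε)
    (Summable.of_norm_bounded (hAB.mul_left 2) fun n => hb2 n ε hε)
  exact hzNorm_pos_le h0 h1 hp.nonneg hp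

theorem mem_littleHZ_of_tendsto_mollify {κ : ℝ} (h0 : 0 < κ) (h1 : κ < 1) {T : Dist} {ρ : CcFn}
    (h : Tendsto (fun ε : ℝ => hzNorm (1 - κ) (T - ofFn (mollify ρ ε T))) (𝓝[>] 0) (𝓝 0)) :
    T ∈ littleHZ (1 - κ) := by
  refine mem_littleHZ_of_approx fun δ hδ => ?_
  obtain ⟨ε, hε⟩ := (h.eventually (gt_mem_nhds hδ)).exists
  exact ⟨_, ofFn_mem_littleHZ_pos h0 h1 _, hε⟩

/-! ### Continuous representatives -/

theorem tint_sub {f g : E → ℂ} (hf : Continuous f) (hg : Continuous g) :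
    tint (fun x => f x - g x) = tint f - tint g := by
  have h := tint_add hf (g := fun x => -1 * g x) (by fun_prop)
  rw [tint_mul_left] at h
  rw [sub_eq_add_neg, neg_eq_neg_one_mul, ← h]
  congr 1
  ext x
  ring

/-- The Weierstrass criterion: the series converges uniformly, so the limit is continuous and the
sum may be exchanged with the integral. -/
theorem isRepresentedBy_tsum {T : Dist} {P : ℕ → TestFn} {A : ℕ → ℝ}
    (hP : ∀ n x, ‖(P n).1 x‖ ≤ A n)
    (hT : ∀ φ : TestFn, HasSum (fun n => (ofFn (P n)).1 φ) (T.1 φ)) (hA : Summable A) :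
    IsRepresentedBy T fun x => ∑' n, (P n).1 x := by
  have hc : Continuous fun x => ∑' n, (P n).1 x :=
    continuous_tsum (fun n => (P n).smooth.continuous) hA hP
  refine ⟨hc, fun n x => tsum_congr fun m => (P m).periodic n x, fun φ => ?_⟩
  refine tendsto_nhds_unique (hT φ).tendsto_sum_nat ?_
  obtain ⟨b, hb⟩ := φ.bounded
  rw [tendsto_iff_norm_sub_tendsto_zero]
  have hlim : Tendsto (fun m => 4 * Real.pi ^ 2 * ((∑' n, A (n + m)) * b)) atTop (𝓝 0) := by
    have := ((tendsto_sum_nat_add A).mul_const b).const_mul (4 * Real.pi ^ 2)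
    simpa using this
  refine squeeze_zero (fun _ => norm_nonneg _) (fun m => ?_) hlim
  have e : ∑ n ∈ Finset.range m, (ofFn (P n)).1 φ =
      tint fun x => (∑ n ∈ Finset.range m, P n : TestFn).1 x * φ.1 x := by
    simp only [ofFn_symm _ φ]
    rw [← map_sum, ofFn_symm]
    rfl
  rw [e, norm_sub_rev]
  change ‖tint (fun x => (∑' n, (P n).1 x) * φ.1 x) -
    tint (fun x => (∑ n ∈ Finset.range m, P n : TestFn).1 x * φ.1 x)‖ ≤ _
  rw [← tint_sub (f := fun x => (∑' n, (P n).1 x) * φ.1 x)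
    (g := fun x => (∑ n ∈ Finset.range m, P n : TestFn).1 x * φ.1 x)
    (hc.mul φ.smooth.continuous)
    ((∑ n ∈ Finset.range m, P n : TestFn).smooth.continuous.mul φ.smooth.continuous)]
  refine norm_tint_le fun x => ?_
  rw [← sub_mul, norm_mul]
  have hs : Summable fun n => (P n).1 x := Summable.of_norm_bounded hA fun n => hP n x
  have e2 : (∑ n ∈ Finset.range m, P n : TestFn).1 x = ∑ n ∈ Finset.range m, (P n).1 x := by
    rw [AddSubmonoidClass.coe_finsetSum, Finset.sum_apply]
  rw [e2, ← hs.sum_add_tsum_nat_add m, add_sub_cancel_left]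
  have hs2 : Summable fun n => A (n + m) := (summable_nat_add_iff m).2 hA
  exact mul_le_mul (tsum_of_norm_bounded hs2.hasSum fun n => hP _ x) (hb x) (norm_nonneg _)
    (tsum_nonneg fun n => (norm_nonneg _).trans (hP _ 0))

/-! ### Convergence of Young products -/

theorem ofReal_norm_apply_le {κ : ℝ} (h0 : 0 < κ) (h1 : κ < 1) {S : Dist}
    (hS : hzNorm (-κ) S < ⊤) {B : ℝ} {φ : TestFn} (hφ : SupBound 1 B φ.1) :
    ENNReal.ofReal ‖S.1 φ‖ ≤ ENNReal.ofReal (|globalConst| * B) * hzNorm (-κ) S := by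
  have hB := hφ.nonneg
  have h := (exists_negBound h0 h1 hS).norm_le hφ
  rw [← ENNReal.ofReal_toReal hS.ne, ← ENNReal.ofReal_mul (by positivity), mul_assoc]
  exact ENNReal.ofReal_le_ofReal (h.trans (mul_le_mul_of_nonneg_right (le_abs_self _)
    (mul_nonneg hB ENNReal.toReal_nonneg)))

/-- Joint continuity of a bounded bilinear map, read off after pairing with a test function. The
norms take values in `ℝ≥0∞`, so no normed-space structure is at hand and the estimate is written
out. -/
theorem IsYoungMap.tendsto {κ : ℝ} (h0 : 0 < κ) (h1 : κ < 1)
    {Y : littleHZ (1 - κ) →ₗ[ℂ] littleHZ (-κ) →ₗ[ℂ] littleHZ (-κ)}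
    (hY : IsYoungMap (1 - κ) (-κ) Y) {f : ℝ → littleHZ (1 - κ)} {g : ℝ → littleHZ (-κ)}
    {f₀ : littleHZ (1 - κ)} {g₀ : littleHZ (-κ)} {l : Filter ℝ}
    (hf : Tendsto (fun ε => hzNorm (1 - κ) (f₀ - f ε : Dist)) l (𝓝 0))
    (hg : Tendsto (fun ε => hzNorm (-κ) (g₀ - g ε : Dist)) l (𝓝 0)) (φ : TestFn) :
    Tendsto (fun ε => (Y (f ε) (g ε) : Dist).1 φ) l (𝓝 ((Y f₀ g₀ : Dist).1 φ)) := by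
  obtain ⟨C, hC⟩ := hY.continuous
  obtain ⟨B, hB⟩ := exists_supBound 1 φ
  have hbound : ∀ ε, ENNReal.ofReal ‖(Y f₀ g₀ - Y (f ε) (g ε) : Dist).1 φ‖ ≤
      ENNReal.ofReal (|globalConst| * B) *
        (C * hzNorm (1 - κ) (f₀ - f ε : Dist) * hzNorm (-κ) (g₀ : Dist) +
          C * (hzNorm (1 - κ) (f₀ - f ε : Dist) + hzNorm (1 - κ) (f₀ : Dist)) *
            hzNorm (-κ) (g₀ - g ε : Dist)) := by
    intro ε
    -- The usual splitting of a bilinear difference, varying one argument at a time.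
    have e : (Y f₀ g₀ - Y (f ε) (g ε) : Dist) =
        (Y (f₀ - f ε) g₀ : Dist) + (Y (f ε) (g₀ - g ε) : Dist) := by
      have hf' : f₀ - f ε + f ε = f₀ := by
        refine Subtype.ext (Subtype.ext (LinearMap.ext fun ψ => ?_))
        change ((f₀ : Dist).1 ψ - (f ε : Dist).1 ψ) + (f ε : Dist).1 ψ = (f₀ : Dist).1 ψ
        ring
      have hg' : g₀ - g ε + g ε = g₀ := by
        refine Subtype.ext (Subtype.ext (LinearMap.ext fun ψ => ?_))
        change ((g₀ : Dist).1 ψ - (g ε : Dist).1 ψ) + (g ε : Dist).1 ψ = (g₀ : Dist).1 ψ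
        ring
      have e3 : Y f₀ g₀ = Y (f₀ - f ε) g₀ + Y (f ε) g₀ := by
        conv_lhs => rw [← hf']
        exact LinearMap.map_add₂ Y _ _ _
      have e4 : Y (f ε) g₀ = Y (f ε) (g₀ - g ε) + Y (f ε) (g ε) := by
        conv_lhs => rw [← hg']
        exact LinearMap.map_add (Y (f ε)) _ _
      refine Subtype.ext (LinearMap.ext fun ψ => ?_)
      have e5 := congrArg (fun T : littleHZ (-κ) => (T : Dist).1 ψ) e3
      have e6 := congrArg (fun T : littleHZ (-κ) => (T : Dist).1 ψ) e4
      change (Y f₀ g₀ : Dist).1 ψ =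
        (Y (f₀ - f ε) g₀ : Dist).1 ψ + (Y (f ε) g₀ : Dist).1 ψ at e5
      change (Y (f ε) g₀ : Dist).1 ψ =
        (Y (f ε) (g₀ - g ε) : Dist).1 ψ + (Y (f ε) (g ε) : Dist).1 ψ at e6
      change (Y f₀ g₀ : Dist).1 ψ - (Y (f ε) (g ε) : Dist).1 ψ =
        (Y (f₀ - f ε) g₀ : Dist).1 ψ + (Y (f ε) (g₀ - g ε) : Dist).1 ψ
      rw [e5, e6]
      ring
    -- Bounds the varying first factor by its limit and a quantity that tends to zero.
    have hf2 : hzNorm (1 - κ) (f ε : Dist) ≤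
        hzNorm (1 - κ) (f₀ - f ε : Dist) + hzNorm (1 - κ) (f₀ : Dist) := by
      have h2 := hzNorm_add_le (1 - κ) ((-1 : ℂ) • (f₀ - f ε : Dist)) (f₀ : Dist)
      have e2 : (-1 : ℂ) • (f₀ - f ε : Dist) + (f₀ : Dist) = (f ε : Dist) := by
        refine Subtype.ext (LinearMap.ext fun ψ => ?_)
        change -1 * ((f₀ : Dist).1 ψ - (f ε : Dist).1 ψ) + (f₀ : Dist).1 ψ = (f ε : Dist).1 ψ
        ring
      rw [e2] at h2
      refine h2.trans (add_le_add ?_ le_rfl)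
      refine (hzNorm_smul_le _ _ _).trans (le_of_eq ?_)
      simp
    refine (ofReal_norm_apply_le h0 h1 ?_ hB).trans (mul_le_mul_right ?_ _)
    · exact (Y f₀ g₀ - Y (f ε) (g ε)).2.1
    · rw [e]
      refine (hzNorm_add_le _ _ _).trans (add_le_add (hC _ _) ((hC _ _).trans ?_))
      exact mul_le_mul_left (mul_le_mul_right hf2 _) _
  have hlim : Tendsto (fun ε => ENNReal.ofReal (|globalConst| * B) *
        (C * hzNorm (1 - κ) (f₀ - f ε : Dist) * hzNorm (-κ) (g₀ : Dist) +
          C * (hzNorm (1 - κ) (f₀ - f ε : Dist) + hzNorm (1 - κ) (f₀ : Dist)) *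
            hzNorm (-κ) (g₀ - g ε : Dist))) l (𝓝 0) := by
    have hgf := (hzNorm_lt_top g₀).ne
    have hff := (hzNorm_lt_top f₀).ne
    have t1 := ENNReal.Tendsto.mul_const (b := hzNorm (-κ) (g₀ : Dist))
      (ENNReal.Tendsto.const_mul (a := (C : ℝ≥0∞)) hf (Or.inr ENNReal.coe_ne_top)) (Or.inr hgf)
    have t2 := ENNReal.Tendsto.mul (ENNReal.Tendsto.const_mul (a := (C : ℝ≥0∞))
      (hf.add_const (hzNorm (1 - κ) (f₀ : Dist))) (Or.inr ENNReal.coe_ne_top))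
      (Or.inr ENNReal.zero_ne_top) hg
      (Or.inr (ENNReal.mul_ne_top ENNReal.coe_ne_top (by simpa using hff)))
    have t3 := ENNReal.Tendsto.const_mul (a := ENNReal.ofReal (|globalConst| * B)) (t1.add t2)
      (Or.inr ENNReal.ofReal_ne_top)
    simpa using t3
  have h3 := tendsto_of_tendsto_of_tendsto_of_le_of_le tendsto_const_nhds hlim
    (fun _ => bot_le) hbound
  have h4 := (ENNReal.tendsto_toReal ENNReal.zero_ne_top).comp h3
  rw [tendsto_iff_norm_sub_tendsto_zero]
  refine h4.congr fun ε => ?_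
  simp only [Function.comp_apply]
  rw [ENNReal.toReal_ofReal (norm_nonneg _), norm_sub_rev]
  rfl

/-! ### Gaussian sums -/

section Gaussian

variable {Ω : Type*} [MeasurableSpace Ω] {P : Measure Ω}

/-- A countable family of random variables with bounded exponential moments is almost surely
bounded by `C + t` when `∑ exp (-t)` converges. -/
theorem ae_exists_le_add {ι : Type*} [Countable ι] {X : ι → Ω → ℝ} {t : ι → ℝ} {M : ℝ}
    (hX : ∀ i, Integrable (fun w => Real.exp (X i w)) P)
    (hM : ∀ i, ∫ w, Real.exp (X i w) ∂P ≤ M) (ht : Summable fun i => Real.exp (-t i)) :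
    ∀ᵐ w ∂P, ∃ C, ∀ i, X i w ≤ C + t i := by
  have hm : ∀ i, AEMeasurable (fun w => ENNReal.ofReal (Real.exp (-t i) * Real.exp (X i w))) P :=
    fun i => ((hX i).const_mul _).aestronglyMeasurable.aemeasurable.ennreal_ofReal
  -- The sum of exp(X_i − t_i) has finite expectation, so it is almost surely finite. It dominates
  -- each of its terms, and its logarithm serves as C.
  have hle : ∫⁻ w, ∑' i, ENNReal.ofReal (Real.exp (-t i) * Real.exp (X i w)) ∂P ≤
      ∑' i, ENNReal.ofReal (Real.exp (-t i) * M) := by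
    rw [lintegral_tsum hm]
    refine ENNReal.tsum_le_tsum fun i => ?_
    rw [← ofReal_integral_eq_lintegral_ofReal ((hX i).const_mul _)
      (Eventually.of_forall fun w => by positivity), integral_const_mul]
    exact ENNReal.ofReal_le_ofReal (mul_le_mul_of_nonneg_left (hM i) (Real.exp_nonneg _))
  have hfin := ae_lt_top' (AEMeasurable.tsum hm)
    (hle.trans_lt ((ht.mul_right M).tsum_ofReal_lt_top)).ne
  filter_upwards [hfin] with w hw
  refine ⟨Real.log ((∑' i, ENNReal.ofReal (Real.exp (-t i) * Real.exp (X i w))).toReal),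
    fun i => ?_⟩
  have h1 := ENNReal.toReal_mono hw.ne (ENNReal.le_tsum
    (f := fun i => ENNReal.ofReal (Real.exp (-t i) * Real.exp (X i w))) i)
  rw [ENNReal.toReal_ofReal (by positivity)] at h1
  have h2 := Real.log_le_log (by positivity) h1
  rw [← Real.exp_add, Real.log_exp] at h2
  linarith

/-- The exponential moment of a linear combination of independent complex Gaussian variables. -/
theorem integral_exp_sum_gaussian {ι : Type*} {c : ι → Ω → ℂ} {v : ℝ≥0}
    [IsProbabilityMeasure P]
    (hre : ∀ p, HasLaw (fun w => (c p w).re) (gaussianReal 0 v) P)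
    (him : ∀ p, HasLaw (fun w => (c p w).im) (gaussianReal 0 v) P)
    (hri : ∀ p, IndepFun (fun w => (c p w).re) (fun w => (c p w).im) P)
    (hc : iIndepFun c P) (s : Finset ι) (α β : ι → ℝ) :
    Integrable (fun w => Real.exp (∑ p ∈ s, (α p * (c p w).re + β p * (c p w).im))) P ∧
      ∫ w, Real.exp (∑ p ∈ s, (α p * (c p w).re + β p * (c p w).im)) ∂P =
        Real.exp (v / 2 * ∑ p ∈ s, (α p ^ 2 + β p ^ 2)) := by
  have hterm : ∀ p, mgf (fun w => α p * (c p w).re + β p * (c p w).im) P 1 =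
      Real.exp (v / 2 * (α p ^ 2 + β p ^ 2)) := by
    intro p
    have hi : IndepFun (fun w => α p * (c p w).re) (fun w => β p * (c p w).im) P :=
      (hri p).comp (measurable_const_mul (α p)) (measurable_const_mul (β p))
    have h := hi.mgf_add' (t := 1) ((hre p).aemeasurable.const_mul _).aestronglyMeasurable
      ((him p).aemeasurable.const_mul _).aestronglyMeasurable
    change mgf (fun w => α p * (c p w).re + β p * (c p w).im) P 1 = _ at h
    rw [h, mgf_const_mul, mgf_const_mul, mgf_gaussianReal (hre p).map_eq,
      mgf_gaussianReal (him p).map_eq, ← Real.exp_add]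
    congr 1
    ring
  have hi : iIndepFun (fun p w => α p * (c p w).re + β p * (c p w).im) P :=
    hc.comp (fun p (z : ℂ) => α p * z.re + β p * z.im) fun p => by fun_prop
  have hmeas : ∀ p, AEMeasurable (fun w => α p * (c p w).re + β p * (c p w).im) P := fun p =>
    ((hre p).aemeasurable.const_mul _).add ((him p).aemeasurable.const_mul _)
  have hsum := hi.mgf_sum₀ (t := 1) hmeas s
  simp only [hterm, ← Real.exp_sum, ← Finset.mul_sum] at hsum
  -- Integrability is a consequence: the integral of a non-integrable function is zero by
  -- convention, whereas this one is positive.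
  have hpos : 0 < mgf (∑ p ∈ s, fun w => α p * (c p w).re + β p * (c p w).im) P 1 := by
    rw [hsum]
    exact Real.exp_pos _
  have hint := mgf_pos_iff.1 hpos
  simp only [mgf, one_mul, Finset.sum_apply] at hint hsum
  exact ⟨hint, hsum⟩

/-- Sums `∑ (p c + q c̄)` over a countable family of finite sets, with bounded variance,
are almost surely bounded by `C + t`. -/
theorem ae_exists_norm_sum_le {ι ι' : Type*} [Countable ι'] {c : ι → Ω → ℂ} {v : ℝ≥0}
    [IsProbabilityMeasure P]
    (hre : ∀ p, HasLaw (fun w => (c p w).re) (gaussianReal 0 v) P)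
    (him : ∀ p, HasLaw (fun w => (c p w).im) (gaussianReal 0 v) P)
    (hri : ∀ p, IndepFun (fun w => (c p w).re) (fun w => (c p w).im) P)
    (hc : iIndepFun c P) (s : ι' → Finset ι) (p q : ι' → ι → ℂ) {M : ℝ}
    (hM : ∀ i, ∑ k ∈ s i, (‖p i k‖ + ‖q i k‖) ^ 2 ≤ M) {t : ι' → ℝ}
    (ht : Summable fun i => Real.exp (-t i)) :
    ∀ᵐ w ∂P, ∃ C, ∀ i,
      ‖∑ k ∈ s i, (p i k * c k w + q i k * starRingEnd ℂ (c k w))‖ ≤ C + 2 * t i := by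
  -- After multiplication by `u`, the real part is a real combination of independent real Gaussians.
  -- The directions 1, −1, i, −i bound both coordinates from both sides, and adding the two
  -- coordinates gives the factor 2 before `t i`.
  have key : ∀ u : ℂ, ‖u‖ = 1 → ∀ᵐ w ∂P, ∃ C, ∀ i,
      (u * ∑ k ∈ s i, (p i k * c k w + q i k * starRingEnd ℂ (c k w))).re ≤ C + t i := by
    intro u hu
    have e : ∀ i w, (u * ∑ k ∈ s i, (p i k * c k w + q i k * starRingEnd ℂ (c k w))).re =
        ∑ k ∈ s i, ((u * (p i k + q i k)).re * (c k w).re +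
          (-(u * (p i k - q i k)).im) * (c k w).im) := by
      intro i w
      rw [Finset.mul_sum, Complex.re_sum]
      refine Finset.sum_congr rfl fun k _ => ?_
      simp
      ring
    simp only [e]
    -- The coefficients of the real and of the imaginary part are each at most ‖p‖ + ‖q‖, which
    -- doubles `M`.
    refine ae_exists_le_add (M := Real.exp (v / 2 * (2 * M)))
      (fun i => (integral_exp_sum_gaussian hre him hri hc (s i) _ _).1) (fun i => ?_) ht
    rw [(integral_exp_sum_gaussian hre him hri hc (s i) _ _).2]
    refine Real.exp_le_exp.2 (mul_le_mul_of_nonneg_left ?_ (by positivity))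
    refine le_trans ?_ (mul_le_mul_of_nonneg_left (hM i) zero_le_two)
    rw [Finset.mul_sum]
    refine Finset.sum_le_sum fun k _ => ?_
    have h1 : |(u * (p i k + q i k)).re| ≤ ‖p i k‖ + ‖q i k‖ := by
      refine (Complex.abs_re_le_norm _).trans ?_
      rw [norm_mul, hu, one_mul]
      exact norm_add_le _ _
    have h2 : |(-(u * (p i k - q i k)).im)| ≤ ‖p i k‖ + ‖q i k‖ := by
      rw [abs_neg]
      refine (Complex.abs_im_le_norm _).trans ?_
      rw [norm_mul, hu, one_mul]
      exact norm_sub_le _ _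
    have h3 := sq_le_sq' (abs_le.1 h1).1 (abs_le.1 h1).2
    have h4 := sq_le_sq' (abs_le.1 h2).1 (abs_le.1 h2).2
    linarith
  filter_upwards [key 1 (by simp), key (-1) (by simp), key Complex.I (by simp),
    key (-Complex.I) (by simp)] with w ⟨C₁, h₁⟩ ⟨C₂, h₂⟩ ⟨C₃, h₃⟩ ⟨C₄, h₄⟩
  refine ⟨max C₁ C₂ + max C₃ C₄, fun i => ?_⟩
  have g₁ := h₁ i
  have g₂ := h₂ i
  have g₃ := h₃ i
  have g₄ := h₄ i
  set z := ∑ k ∈ s i, (p i k * c k w + q i k * starRingEnd ℂ (c k w))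
  simp only [one_mul, neg_mul, Complex.neg_re, Complex.mul_re, Complex.I_re, Complex.I_im,
    zero_mul, zero_sub, neg_neg] at g₁ g₂ g₃ g₄
  have a₁ : |z.re| ≤ max C₁ C₂ + t i :=
    abs_le.2 ⟨by linarith [le_max_right C₁ C₂], by linarith [le_max_left C₁ C₂]⟩
  have a₂ : |z.im| ≤ max C₃ C₄ + t i :=
    abs_le.2 ⟨by linarith [le_max_left C₃ C₄], by linarith [le_max_right C₃ C₄]⟩
  linarith [Complex.norm_le_abs_re_add_abs_im z]

end Gaussian

/-! ### Dyadic shells of frequencies -/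

/-- The nonzero frequencies. -/
abbrev Freq : Type := {k : Fin 2 → ℤ // k ≠ 0}

instance : Neg Freq := ⟨fun k => ⟨-k.1, neg_ne_zero.2 k.2⟩⟩

instance : InvolutiveNeg Freq := ⟨fun k => Subtype.ext (neg_neg k.1)⟩

/-- The dyadic order of magnitude of a frequency. -/
def Freq.order (k : Freq) : ℕ := Nat.log 2 (max (k.1 0).natAbs (k.1 1).natAbs)

theorem Freq.order_neg (k : Freq) : (-k).order = k.order := by
  change Nat.log 2 (max (-(k.1 0)).natAbs (-(k.1 1)).natAbs) = _
  rw [Int.natAbs_neg, Int.natAbs_neg]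
  rfl

theorem Freq.max_ne_zero (k : Freq) : max (k.1 0).natAbs (k.1 1).natAbs ≠ 0 := by
  intro h
  refine k.2 (funext fun i => ?_)
  fin_cases i
  · exact Int.natAbs_eq_zero.1 (Nat.eq_zero_of_le_zero ((le_max_left _ _).trans h.le))
  · exact Int.natAbs_eq_zero.1 (Nat.eq_zero_of_le_zero ((le_max_right _ _).trans h.le))

theorem Freq.natAbs_lt (k : Freq) (i : Fin 2) : (k.1 i).natAbs < 2 ^ (k.order + 1) := by
  refine lt_of_le_of_lt ?_ (Nat.lt_pow_succ_log_self one_lt_two _)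
  fin_cases i
  · exact le_max_left _ _
  · exact le_max_right _ _

theorem Freq.abs_le (k : Freq) (i : Fin 2) : |(k.1 i : ℝ)| ≤ 2 * 2 ^ k.order := by
  have h := (k.natAbs_lt i).le
  rw [← Int.cast_abs, Int.abs_eq_natAbs]
  have h' : ((k.1 i).natAbs : ℝ) ≤ (2 ^ (k.order + 1) : ℕ) := Nat.cast_le.2 h
  push_cast at h' ⊢
  rw [pow_succ, Nat.cast_natAbs, Int.cast_abs] at h'
  linarith

theorem Freq.le_sq (k : Freq) :
    (2 ^ k.order : ℝ) ^ 2 ≤ (k.1 0 : ℝ) ^ 2 + (k.1 1 : ℝ) ^ 2 := by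
  have h := Nat.pow_log_le_self 2 k.max_ne_zero
  have h' : (2 ^ k.order : ℝ) ≤ max ((k.1 0).natAbs : ℝ) ((k.1 1).natAbs : ℝ) := by
    exact_mod_cast h
  have e : ∀ i, ((k.1 i).natAbs : ℝ) ^ 2 = (k.1 i : ℝ) ^ 2 := fun i => by
    rw [Nat.cast_natAbs, Int.cast_abs, sq_abs]
  rw [← e, ← e]
  rcases le_max_iff.1 h' with h1 | h1
  · have := pow_le_pow_left₀ (by positivity) h1 2
    linarith [sq_nonneg ((k.1 1).natAbs : ℝ)]
  · have := pow_le_pow_left₀ (by positivity) h1 2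
    linarith [sq_nonneg ((k.1 0).natAbs : ℝ)]

/-- The square of integer points with coordinates at most `R` in absolute value. -/
def box (R : ℕ) : Finset (Fin 2 → ℤ) := Fintype.piFinset fun _ => Finset.Icc (-(R : ℤ)) R

theorem card_box (R : ℕ) : (box R).card = (2 * R + 1) ^ 2 := by
  simp only [box, Fintype.card_piFinset_const, Int.card_Icc]
  congr 1
  omega

theorem Freq.mem_box (k : Freq) : k.1 ∈ box (2 ^ (k.order + 1)) := by
  refine Fintype.mem_piFinset.2 fun i => Finset.mem_Icc.2 ?_
  have h := (k.natAbs_lt i).le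
  omega

theorem finite_shell (n : ℕ) : {k : Freq | k.order = n}.Finite := by
  refine Set.Finite.of_finite_image (f := Subtype.val)
    ((box (2 ^ (n + 1))).finite_toSet.subset ?_) Subtype.val_injective.injOn
  rintro _ ⟨k, rfl, rfl⟩
  exact k.mem_box

/-- The frequencies of order `n`. -/
def shell (n : ℕ) : Finset Freq := (finite_shell n).toFinset

theorem mem_shell {n : ℕ} {k : Freq} : k ∈ shell n ↔ k.order = n := by
  simp [shell]

/-- The shell lies in a box of side 4·2^n + 1 ≤ 5·2^n. -/
theorem card_shell_le (n : ℕ) : ((shell n).card : ℝ) ≤ 25 * 4 ^ n := by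
  have h : (shell n).card ≤ (box (2 ^ (n + 1))).card := by
    rw [← Finset.card_map (Function.Embedding.subtype _)]
    refine Finset.card_le_card fun k hk => ?_
    obtain ⟨k', hk', rfl⟩ := Finset.mem_map.1 hk
    rw [mem_shell] at hk'
    subst hk'
    exact Freq.mem_box k'
  rw [card_box] at h
  have h' : ((shell n).card : ℝ) ≤ ((2 * 2 ^ (n + 1) + 1) ^ 2 : ℕ) := Nat.cast_le.2 h
  refine h'.trans ?_
  have h1 : (1 : ℝ) ≤ 2 ^ n := one_le_pow₀ one_le_two
  have h4 : (4 : ℝ) ^ n = (2 ^ n) ^ 2 := by rw [← pow_mul, mul_comm n 2, pow_mul]; norm_num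
  rw [h4]
  push_cast
  rw [pow_succ 2 n]
  nlinarith

theorem sum_shell_neg (n : ℕ) (f : Freq → ℂ) : ∑ k ∈ shell n, f (-k) = ∑ k ∈ shell n, f k :=
  Finset.sum_equiv (Equiv.neg Freq) (fun k => by simp [mem_shell, Freq.order_neg])
    fun k _ => rfl

/-- Absolutely convergent series over the frequencies can be summed shell by shell. -/
theorem hasSum_shell {f : Freq → ℂ} {a : ℂ} (h : HasSum f a) :
    HasSum (fun n => ∑ k ∈ shell n, f k) a := by
  have h1 := (Equiv.sigmaFiberEquiv Freq.order).hasSum_iff.2 h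
  refine h1.sigma fun n => ?_
  have h2 := (shell n).hasSum f
  let e : {k // k ∈ shell n} ≃ {k : Freq // k.order = n} :=
    Equiv.subtypeEquivRight fun k => mem_shell
  exact (e.hasSum_iff (f := fun x : {k : Freq // k.order = n} => f x.1)).1 h2

/-! ### The Fourier coefficients of a real random series -/

/-- The distribution `W` equals `η + Re ∑ c_k e_k`. -/
def IsSeries (c : Freq → ℂ) (η : ℝ) (W : Dist) : Prop :=
  ∀ φ : TestFn, HasSum (fun k : Freq => tint fun x => ((c k * (mode k).1 x).re : ℂ) * φ.1 x)
    (W.1 φ - (η : ℂ) * tint φ.1)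

/-- The Fourier coefficients of `Re ∑ c_k e_k`. -/
def symCoeff (c : Freq → ℂ) (k : Freq) : ℂ := (c k + starRingEnd ℂ (c (-k))) / 2

/-- The terms of the series and the mean are real. Reality of the noise is what turns ξ × ξ̄ into a
Jacobian. -/
theorem IsSeries.apply_conj {c : Freq → ℂ} {η : ℝ} {W : Dist} (h : IsSeries c η W)
    (φ : TestFn) : W.1 φ.conj = starRingEnd ℂ (W.1 φ) := by
  have h1 := Complex.hasSum_conj'.2 (h φ)
  have e : ∀ k : Freq, starRingEnd ℂ (tint fun x => ((c k * (mode k).1 x).re : ℂ) * φ.1 x) =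
      tint fun x => ((c k * (mode k).1 x).re : ℂ) * φ.conj.1 x := fun k => by
    rw [← tint_conj]
    refine congrArg tint (funext fun x => ?_)
    rw [map_mul, Complex.conj_ofReal]
    rfl
  simp only [e] at h1
  have h2 := h1.unique (h φ.conj)
  have h3 : tint φ.conj.1 = starRingEnd ℂ (tint φ.1) := tint_conj φ.1
  rw [h3, map_sub, map_mul, Complex.conj_ofReal] at h2
  linear_combination -h2

/-- Re(a e_k) = (a e_k + ā e_{-k})/2, followed by orthogonality. -/
theorem tint_re_mode_mul (a : ℂ) (k l : Fin 2 → ℤ) :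
    (tint fun x => ((a * (mode k).1 x).re : ℂ) * (mode (-l)).1 x) =
      (if k = l then 4 * (Real.pi : ℂ) ^ 2 * (a / 2) else 0) +
        if k = -l then 4 * (Real.pi : ℂ) ^ 2 * (starRingEnd ℂ a / 2) else 0 := by
  have e : (fun x => ((a * (mode k).1 x).re : ℂ) * (mode (-l)).1 x) =
      (((a / 2) • mode k + (starRingEnd ℂ a / 2) • mode (-k)) * mode (-l) : TestFn).1 := by
    funext x
    change ((a * (mode k).1 x).re : ℂ) * (mode (-l)).1 x =
      (a / 2 * (mode k).1 x + starRingEnd ℂ a / 2 * (mode (-k)).1 x) * (mode (-l)).1 x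
    rw [Complex.re_eq_add_conj, map_mul, conj_mode_apply]
    ring
  rw [e, ← ofFn_apply, ofFn_add, ofFn_smul, ofFn_smul]
  change a / 2 * (ofFn (mode k)).1 (mode (-l)) +
    starRingEnd ℂ a / 2 * (ofFn (mode (-k))).1 (mode (-l)) = _
  rw [ofFn_mode_mode, ofFn_mode_mode]
  simp only [neg_eq_iff_eq_neg]
  split_ifs <;> ring

theorem IsSeries.apply_mode {c : Freq → ℂ} {η : ℝ} {W : Dist} (h : IsSeries c η W) (l : Freq) :
    W.1 (mode (-l.1)) = 4 * (Real.pi : ℂ) ^ 2 * symCoeff c l := by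
  have h1 := h (mode (-l.1))
  have h0 : tint (mode (-l.1)).1 = 0 := by
    rw [tint_mode, if_neg (neg_ne_zero.2 l.2)]
  rw [h0, mul_zero, sub_zero] at h1
  have e : (fun k : Freq => tint fun x =>
        ((c k * (mode k.1).1 x).re : ℂ) * (mode (-l.1)).1 x) =
      fun k => (if k = l then 4 * (Real.pi : ℂ) ^ 2 * (c l / 2) else 0) +
        if k = -l then 4 * (Real.pi : ℂ) ^ 2 * (starRingEnd ℂ (c (-l)) / 2) else 0 := by
    funext k
    rw [tint_re_mode_mul]
    have e1 : k.1 = -l.1 ↔ k = -l := ⟨fun h => Subtype.ext h, fun h => congrArg Subtype.val h⟩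
    simp only [e1, ← Subtype.ext_iff]
    congr 1
    · split_ifs with h
      · rw [h]
      · rfl
    · split_ifs with h
      · rw [h]
      · rfl
  rw [e] at h1
  rw [h1.unique ((hasSum_ite_eq l _).add (hasSum_ite_eq (-l) _)), symCoeff]
  ring

/-- `|k|²`. -/
def Freq.sq (k : Freq) : ℝ := (k.1 0 : ℝ) ^ 2 + (k.1 1 : ℝ) ^ 2

/-- The Fourier expansion of K∗W. The Green function annihilates the zero mode, so the mean η
disappears and components of zero mean are treated alike. -/
theorem IsSeries.hasSum_green {c : Freq → ℂ} {η : ℝ} {W : Dist} (h : IsSeries c η W)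
    (φ : TestFn) : HasSum (fun k : Freq => (k.sq : ℂ)⁻¹ * symCoeff c k * (ofFn (mode k.1)).1 φ)
      ((green.conv W).1 φ) := by
  have h1 := (green.conv W).hasSum_mode φ
  have h2 := (hasSum_subtype_iff_of_support_subset (s := {k : Fin 2 → ℤ | k ≠ 0}) fun k hk => by
    rintro rfl
    refine hk ?_
    change (4 * (Real.pi : ℂ) ^ 2)⁻¹ * (green.conv W).1 (mode (-0)) * (ofFn (mode 0)).1 φ = 0
    rw [conv_mode, green_mode, if_pos neg_zero]
    ring).2 h1
  refine h2.congr_fun fun k => ?_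
  change _ = (4 * (Real.pi : ℂ) ^ 2)⁻¹ * (green.conv W).1 (mode (-k.1)) * (ofFn (mode k.1)).1 φ
  have hk : -k.1 ≠ 0 := neg_ne_zero.2 k.2
  rw [conv_mode, green_mode, if_neg hk, h.apply_mode]
  have hs : ((-k.1) 0 : ℝ) ^ 2 + ((-k.1) 1 : ℝ) ^ 2 = Freq.sq k := by
    simp [Freq.sq]
  rw [hs]
  have hp : (Real.pi : ℂ) ≠ 0 := Complex.ofReal_ne_zero.2 Real.pi_ne_zero
  field_simp

/-! ### Shell sums and their control on a grid -/

/-- A weighted block of the series, over the frequencies of order `n`. -/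
def shellSum (b c : Freq → ℂ) (n : ℕ) (x : E) : ℂ :=
  ∑ k ∈ shell n, b k * symCoeff c k * (mode k.1).1 x

/-- The shell is symmetric under k ↦ −k; reindexing the conjugate half expresses the sum in the
independent variables themselves, as needed for the Gaussian bound. -/
theorem shellSum_eq (b c : Freq → ℂ) (n : ℕ) (x : E) :
    shellSum b c n x = ∑ k ∈ shell n, (b k * (mode k.1).1 x / 2 * c k +
      b (-k) * (mode (-k.1)).1 x / 2 * starRingEnd ℂ (c k)) := by
  have h := sum_shell_neg n fun k => b k * (mode k.1).1 x / 2 * starRingEnd ℂ (c (-k))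
  simp only [neg_neg] at h
  rw [Finset.sum_add_distrib]
  change _ = _ + ∑ k ∈ shell n, b (-k) * (mode (-k).1).1 x / 2 * starRingEnd ℂ (c k)
  rw [h, ← Finset.sum_add_distrib]
  refine Finset.sum_congr rfl fun k _ => ?_
  rw [symCoeff]
  ring

/-- The logarithmic weight of a lattice point. -/
def logWeight (m : Fin 2 → ℤ) : ℝ := Real.log (1 + (m 0 : ℝ) ^ 2) + Real.log (1 + (m 1 : ℝ) ^ 2)

theorem exp_neg_logWeight (m : Fin 2 → ℤ) :
    Real.exp (-logWeight m) = (1 + (m 0 : ℝ) ^ 2)⁻¹ * (1 + (m 1 : ℝ) ^ 2)⁻¹ := by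
  rw [logWeight, neg_add, Real.exp_add, Real.exp_neg, Real.exp_neg, Real.exp_log (by positivity),
    Real.exp_log (by positivity)]

theorem summable_exp_neg_logWeight : Summable fun m => Real.exp (-logWeight m) := by
  simp only [exp_neg_logWeight]
  exact summable_weight

theorem logWeight_le {m : Fin 2 → ℤ} {j : ℕ} (h : ∀ i, 1 + (m i : ℝ) ^ 2 ≤ 2 ^ j) :
    logWeight m ≤ 2 * j := by
  have key : ∀ i, Real.log (1 + (m i : ℝ) ^ 2) ≤ j := by
    intro i
    refine (Real.log_le_log (by positivity) (h i)).trans ?_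
    rw [Real.log_pow]
    exact mul_le_of_le_one_right (Nat.cast_nonneg _) (Real.log_two_lt_d9.le.trans (by norm_num))
  have h0 := key 0
  have h1 := key 1
  rw [logWeight]
  linarith

theorem logWeight_freq_le (k : Freq) : logWeight k.1 ≤ 2 * (2 * k.order + 3) := by
  have := logWeight_le (m := k.1) (j := 2 * k.order + 3) fun i => by
    have h := k.abs_le i
    have h1 : (1 : ℝ) ≤ 2 ^ k.order := one_le_pow₀ one_le_two
    have h2 : (k.1 i : ℝ) ^ 2 ≤ (2 * 2 ^ k.order) ^ 2 := by
      rw [← sq_abs]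
      exact pow_le_pow_left₀ (abs_nonneg _) h 2
    have e : (2 : ℝ) ^ (2 * k.order + 3) = 8 * (2 ^ k.order) ^ 2 := by
      rw [pow_add, mul_comm 2, pow_mul]
      ring
    rw [e]
    nlinarith
  push_cast at this
  exact this

/-- The grid points `4⁻ⁿ m`. -/
def gridPt (n : ℕ) (m : Fin 2 → ℤ) : E := WithLp.toLp 2 fun i => (m i : ℝ) / 4 ^ n

/-- Bounds on the grid and for the coefficients give a uniform bound. -/
theorem shellSum_le {b c : Freq → ℂ} {C₁ C₂ : ℝ} (hb : ∀ k, ‖b k‖ ≤ (2 ^ k.order)⁻¹)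
    (h₁ : ∀ n m, ‖shellSum b c n (gridPt n m)‖ ≤ C₁ + 2 * (n + logWeight m))
    (h₂ : ∀ k : Freq, ‖c k‖ ≤ C₂ + 2 * logWeight k.1) (n : ℕ) (x : E) :
    ‖shellSum b c n x‖ ≤ (|C₁| + 50 * |C₂| + 700) * (n + 1) := by
  have hpi := Real.pi_pos
  -- By periodicity the coordinates may be taken at most π < 4 in absolute value, so grid points
  -- with coordinates of order 4^n suffice.
  let l : Fin 2 → ℤ := fun i => -round (x i / (2 * Real.pi))
  have hper : shellSum b c n x = shellSum b c n (x + lat l) :=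
    Finset.sum_congr rfl fun k _ => by rw [(mode k.1).periodic]
  rw [hper]
  have hx : ∀ i, |(x + lat l) i| ≤ 4 := by
    intro i
    have h1 := abs_sub_round (x i / (2 * Real.pi))
    have h2 : (x + lat l) i = (x i / (2 * Real.pi) - round (x i / (2 * Real.pi))) *
        (2 * Real.pi) := by
      simp only [PiLp.add_apply, lat, l]
      push_cast
      field_simp
      ring
    rw [h2, abs_mul, abs_of_pos (by positivity : (0 : ℝ) < 2 * Real.pi)]
    nlinarith [Real.pi_lt_four]
  set y := x + lat l
  have h4 : (0 : ℝ) < 4 ^ n := by positivity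
  have h41 : (1 : ℝ) ≤ 4 ^ n := one_le_pow₀ (by norm_num)
  -- The nearest grid point, at distance at most half a mesh in each coordinate.
  let m : Fin 2 → ℤ := fun i => round (4 ^ n * y i)
  have hr : ∀ i, |4 ^ n * y i - m i| ≤ 1 / 2 := fun i => abs_sub_round _
  have hy : ∀ i, |y i - gridPt n m i| ≤ (2 * 4 ^ n)⁻¹ := by
    intro i
    have e : y i - gridPt n m i = (4 ^ n * y i - m i) * (4 ^ n)⁻¹ := by
      change y i - (m i : ℝ) / 4 ^ n = _
      field_simp
    rw [e, abs_mul, abs_of_pos (inv_pos.2 h4), mul_inv]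
    exact mul_le_mul_of_nonneg_right ((hr i).trans (by norm_num)) (inv_pos.2 h4).le
  -- Here |m_i| ≤ 4·4^n + 1/2 ≤ 5·4^n, so 1 + m_i² ≤ 32·16^n = 2^{4n+5}.
  have hlog : logWeight m ≤ 2 * (4 * n + 5) := by
    have := logWeight_le (m := m) (j := 4 * n + 5) fun i => by
      have e : (2 : ℝ) ^ (4 * n + 5) = 32 * (4 ^ n) ^ 2 := by
        rw [show (4 : ℝ) = 2 ^ 2 by norm_num, ← pow_mul, ← pow_mul]
        ring
      have hm : |(m i : ℝ)| ≤ 5 * 4 ^ n := by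
        have h5 : |4 ^ n * y i| ≤ 4 ^ n * 4 := by
          rw [abs_mul, abs_of_pos h4]
          exact mul_le_mul_of_nonneg_left (hx i) h4.le
        have h6 := abs_sub_abs_le_abs_sub (m i : ℝ) (4 ^ n * y i)
        rw [abs_sub_comm] at h6
        have h7 := hr i
        linarith
      have hm2 : (m i : ℝ) ^ 2 ≤ (5 * 4 ^ n) ^ 2 := by
        rw [← sq_abs]
        exact pow_le_pow_left₀ (abs_nonneg _) hm 2
      rw [e]
      nlinarith
    push_cast at this
    exact this
  -- The mode varies by at most 2·2^n·4^{-n} over half a mesh; the weight `b` removes 2^n, and the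
  -- coefficient grows only linearly in n.
  have hdiff : ∀ k ∈ shell n, ‖b k * symCoeff c k * (mode k.1).1 y -
      b k * symCoeff c k * (mode k.1).1 (gridPt n m)‖ ≤
        2 * (|C₂| + 4 * (2 * n + 3)) * (4 ^ n)⁻¹ := by
    intro k hk
    rw [mem_shell] at hk
    have hs : ‖symCoeff c k‖ ≤ |C₂| + 4 * (2 * n + 3) := by
      have a1 := h₂ k
      have a2 := h₂ (-k)
      have e : logWeight (-k).1 = logWeight k.1 := by
        change logWeight (-k.1) = _
        simp [logWeight]
      rw [e] at a2
      have a3 := logWeight_freq_le k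
      rw [hk] at a3
      have a4 := norm_add_le (c k) (starRingEnd ℂ (c (-k)))
      rw [RCLike.norm_conj] at a4
      rw [symCoeff, norm_div, Complex.norm_two]
      have := le_abs_self C₂
      linarith
    have hmode : ‖(mode k.1).1 y - (mode k.1).1 (gridPt n m)‖ ≤ 2 * 2 ^ n * (4 ^ n)⁻¹ := by
      have e : (mode k.1).1 y = (mode k.1).1 (gridPt n m) * (mode k.1).1 (y - gridPt n m) := by
        rw [← mode_add_apply, add_sub_cancel]
      have e2 : (mode k.1).1 y - (mode k.1).1 (gridPt n m) =
          (mode k.1).1 (gridPt n m) * ((mode k.1).1 (y - gridPt n m) - 1) := by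
        rw [e]
        ring
      rw [e2, norm_mul, norm_mode, one_mul, mode_apply]
      refine Real.norm_exp_I_mul_ofReal_sub_one_le.trans ?_
      have f : ∀ i, |(k.1 i : ℝ) * (y - gridPt n m) i| ≤ 2 ^ n * (4 ^ n)⁻¹ := by
        intro i
        rw [abs_mul]
        have g := mul_le_mul (k.abs_le i) (hy i) (abs_nonneg _) (by positivity)
        rw [hk] at g
        refine g.trans (le_of_eq ?_)
        field_simp
      rw [Real.norm_eq_abs]
      refine (abs_add_le _ _).trans ((add_le_add (f 0) (f 1)).trans (le_of_eq ?_))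
      ring
    rw [← mul_sub, norm_mul, norm_mul]
    have hbk := hb k
    rw [hk] at hbk
    have h2 : (0 : ℝ) < 2 ^ n := by positivity
    calc ‖b k‖ * ‖symCoeff c k‖ * ‖(mode k.1).1 y - (mode k.1).1 (gridPt n m)‖
        ≤ (2 ^ n)⁻¹ * (|C₂| + 4 * (2 * n + 3)) * (2 * 2 ^ n * (4 ^ n)⁻¹) := by gcongr
      _ = 2 * (|C₂| + 4 * (2 * n + 3)) * (4 ^ n)⁻¹ := by field_simp
  -- The roughly 4^n terms of the shell are compensated by the factor 4^{-n}: this is why the mesh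
  -- is much finer than the wavelength 2^{-n}.
  have hsum : ‖shellSum b c n y - shellSum b c n (gridPt n m)‖ ≤
      25 * (2 * (|C₂| + 4 * (2 * n + 3))) := by
    rw [shellSum, shellSum, ← Finset.sum_sub_distrib]
    refine (norm_sum_le _ _).trans ((Finset.sum_le_card_nsmul _ _ _ hdiff).trans ?_)
    rw [nsmul_eq_mul]
    calc ((shell n).card : ℝ) * (2 * (|C₂| + 4 * (2 * n + 3)) * (4 ^ n)⁻¹)
        ≤ 25 * 4 ^ n * (2 * (|C₂| + 4 * (2 * n + 3)) * (4 ^ n)⁻¹) := by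
          gcongr
          exact card_shell_le n
      _ = 25 * (2 * (|C₂| + 4 * (2 * n + 3))) := by field_simp
  -- The total is at most |C₁| + 50|C₂| + (18 + 400)n + (20 + 600), and 700(n + 1) covers the last
  -- two terms.
  have hg := h₁ n m
  have h9 := norm_add_le (shellSum b c n y - shellSum b c n (gridPt n m))
    (shellSum b c n (gridPt n m))
  rw [sub_add_cancel] at h9
  have hn : (0 : ℝ) ≤ n := Nat.cast_nonneg n
  have b1 := le_abs_self C₁
  have b2 := mul_nonneg (abs_nonneg C₁) hn
  have b3 := mul_nonneg (abs_nonneg C₂) hn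
  nlinarith

/-! ### Almost sure growth of the shells -/

section Random

variable {Ω : Type*} [MeasurableSpace Ω] {P : Measure Ω} [IsProbabilityMeasure P]

/-- Blocks of a random Fourier series with independent Gaussian coefficients grow at most
linearly in the order. -/
theorem ae_exists_shellSum_le {c : Freq → Ω → ℂ} {v : ℝ≥0}
    (hre : ∀ p, HasLaw (fun w => (c p w).re) (gaussianReal 0 v) P)
    (him : ∀ p, HasLaw (fun w => (c p w).im) (gaussianReal 0 v) P)
    (hri : ∀ p, IndepFun (fun w => (c p w).re) (fun w => (c p w).im) P)
    (hc : iIndepFun c P) {b : Freq → ℂ} (hb : ∀ k, ‖b k‖ ≤ (2 ^ k.order)⁻¹) :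
    ∀ᵐ w ∂P, ∃ C, ∀ (n : ℕ) x, ‖shellSum b (fun k => c k w) n x‖ ≤ C * (n + 1) := by
  -- The price n + log weight is linear in n at the grid points of interest, yet makes the union
  -- bound over all shells and all grid points converge.
  have hexp : Summable fun i : ℕ × (Fin 2 → ℤ) => Real.exp (-(i.1 + logWeight i.2)) := by
    simp only [neg_add, Real.exp_add]
    exact Real.summable_exp_neg_nat.mul_of_nonneg summable_exp_neg_logWeight
      (fun n => Real.exp_nonneg _) fun m => Real.exp_nonneg _
  -- At most 25·4^n frequencies, each with squared coefficient at most 4^{-n}: the variance is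
  -- bounded uniformly in the shell and the point.
  have hvar : ∀ i : ℕ × (Fin 2 → ℤ), ∑ k ∈ shell i.1,
      (‖b k * (mode k.1).1 (gridPt i.1 i.2) / 2‖ +
        ‖b (-k) * (mode (-k.1)).1 (gridPt i.1 i.2) / 2‖) ^ 2 ≤ 25 := fun i => by
    have hle : ∀ k ∈ shell i.1, (‖b k * (mode k.1).1 (gridPt i.1 i.2) / 2‖ +
        ‖b (-k) * (mode (-k.1)).1 (gridPt i.1 i.2) / 2‖) ^ 2 ≤ (4 ^ i.1)⁻¹ := by
      intro k hk
      rw [mem_shell] at hk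
      have h1 := hb k
      have h2 := hb (-k)
      rw [Freq.order_neg] at h2
      rw [hk] at h1 h2
      rw [norm_div, norm_mul, norm_mode, norm_div, norm_mul, norm_mode, Complex.norm_two]
      have e : ((4 : ℝ) ^ i.1)⁻¹ = ((2 ^ i.1)⁻¹) ^ 2 := by
        rw [inv_pow, ← pow_mul, mul_comm i.1, pow_mul]
        norm_num
      rw [e]
      exact pow_le_pow_left₀ (by positivity) (by linarith) 2
    refine (Finset.sum_le_card_nsmul _ _ _ hle).trans ?_
    rw [nsmul_eq_mul, ← div_eq_mul_inv, div_le_iff₀ (by positivity)]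
    exact card_shell_le i.1
  have hgrid := ae_exists_norm_sum_le hre him hri hc (ι' := ℕ × (Fin 2 → ℤ))
    (fun i => shell i.1) (fun i k => b k * (mode k.1).1 (gridPt i.1 i.2) / 2)
    (fun i k => b (-k) * (mode (-k.1)).1 (gridPt i.1 i.2) / 2) (M := 25) hvar
    (t := fun i => i.1 + logWeight i.2) hexp
  -- The same bound for sums of one term controls the individual coefficients, as needed between
  -- grid points.
  have hcoef := ae_exists_norm_sum_le hre him hri hc (ι' := Freq) (fun k => {k})
    (fun _ _ => 1) (fun _ _ => 0) (M := 1) (fun k => by simp) (t := fun k => logWeight k.1)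
    (summable_exp_neg_logWeight.comp_injective Subtype.val_injective)
  filter_upwards [hgrid, hcoef] with w ⟨C₁, h₁⟩ ⟨C₂, h₂⟩
  refine ⟨_, shellSum_le (C₁ := C₁) (C₂ := C₂) hb (fun n m => ?_) fun k => ?_⟩
  · rw [shellSum_eq]
    exact h₁ (n, m)
  · simpa using h₂ k

end Random

/-! ### Regularity of the convolution with the Green function -/

/-- `T` is a series of smooth functions with bounds as for a Besov function of exponent one, up to
a factor growing linearly. -/
def IsBlockSum (T : Dist) : Prop :=
  ∃ (P : ℕ → TestFn) (C : ℝ), (∀ n : ℕ, LipBound (C * (n + 1) * (2 ^ n)⁻¹) (C * (n + 1)) (P n).1) ∧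
    ∀ φ : TestFn, HasSum (fun n => (ofFn (P n)).1 φ) (T.1 φ)

theorem summable_add_one_mul_pow {r : ℝ} (h0 : 0 ≤ r) (h1 : r < 1) :
    Summable fun n : ℕ => ((n : ℝ) + 1) * r ^ n := by
  have hr : ‖r‖ < 1 := by rwa [Real.norm_of_nonneg h0]
  have h := (summable_pow_mul_geometric_of_norm_lt_one 1 hr).add
    (summable_geometric_of_norm_lt_one hr)
  refine h.congr fun n => ?_
  ring

theorem summable_block (C : ℝ) : Summable fun n : ℕ => C * ((n : ℝ) + 1) * (2 ^ n)⁻¹ := by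
  refine ((summable_add_one_mul_pow (r := 2⁻¹) (by norm_num) (by norm_num)).mul_left C).congr
    fun n => ?_
  rw [inv_pow, mul_assoc]

/-- The product simplifies to C(n+1)2^{-κn}: any κ > 0 absorbs the linear growth. -/
theorem summable_block_rpow {C κ : ℝ} (hC : 0 ≤ C) (h0 : 0 < κ) (h1 : κ < 1) :
    Summable fun n : ℕ => (C * ((n : ℝ) + 1) * (2 ^ n)⁻¹) ^ κ * (C * ((n : ℝ) + 1)) ^ (1 - κ) := by
  have hr : ((2 : ℝ)⁻¹) ^ κ < 1 := Real.rpow_lt_one (by norm_num) (by norm_num) h0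
  refine ((summable_add_one_mul_pow (r := (2 : ℝ)⁻¹ ^ κ) (by positivity) hr).mul_left C).congr
    fun n => ?_
  have hB : 0 ≤ C * ((n : ℝ) + 1) := by positivity
  rw [Real.mul_rpow hB (by positivity), mul_right_comm, ← Real.rpow_add_of_nonneg hB h0.le
    (by linarith), add_sub_cancel, Real.rpow_one, ← inv_pow, ← Real.rpow_natCast,
    ← Real.rpow_natCast, ← Real.rpow_mul (by norm_num), ← Real.rpow_mul (by norm_num),
    mul_comm κ, mul_assoc]

theorem IsBlockSum.tendsto_hzNorm {T : Dist} (hT : IsBlockSum T) {κ : ℝ} (h0 : 0 < κ)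
    (h1 : κ < 1) {ρ : CcFn} (hρ : IsMollifier ρ) :
    Tendsto (fun ε : ℝ => hzNorm (1 - κ) (T - ofFn (mollify ρ ε T))) (𝓝[>] 0) (𝓝 0) := by
  obtain ⟨P, C, hP, hs⟩ := hT
  have hC : 0 ≤ C := by simpa using (hP 0).nonneg.2
  exact tendsto_hzNorm_sub_mollify h0 h1 hP hs (summable_block C)
    (summable_block_rpow hC h0 h1) hρ

theorem IsBlockSum.exists_isRepresentedBy {T : Dist} (hT : IsBlockSum T) :
    ∃ u, IsRepresentedBy T u := by
  obtain ⟨P, C, hP, hs⟩ := hT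
  exact ⟨_, isRepresentedBy_tsum (fun n => (hP n).1) hs (summable_block C)⟩

/-- The weight of the blocks of the convolution with the Green function. -/
def weight (k : Freq) : ℂ := ((2 ^ k.order / Freq.sq k : ℝ) : ℂ)

/-- The weight of the blocks of the derivatives of the convolution with the Green function. -/
def weightD (i : Fin 2) (k : Freq) : ℂ := Complex.I * ((k.1 i / Freq.sq k : ℝ) : ℂ)

theorem Freq.sq_pos (k : Freq) : 0 < Freq.sq k :=
  lt_of_lt_of_le (by positivity) k.le_sq

/-- Both weights are at most of order 1/|k|, so their squares over a shell have a bounded sum in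
dimension two. -/
theorem norm_weight_le (k : Freq) : ‖weight k‖ ≤ (2 ^ k.order)⁻¹ := by
  have h := k.le_sq
  have hp := Freq.sq_pos k
  rw [weight, Complex.norm_real, Real.norm_of_nonneg (by positivity), div_le_iff₀ hp,
    inv_mul_eq_div, le_div_iff₀ (by positivity), ← pow_two]
  exact h

theorem norm_weightD_le (i : Fin 2) (k : Freq) : ‖weightD i k‖ ≤ (2 ^ k.order)⁻¹ := by
  have h := k.le_sq
  have hp := Freq.sq_pos k
  rw [weightD, norm_mul, Complex.norm_I, one_mul, Complex.norm_real, Real.norm_eq_abs, abs_div,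
    abs_of_pos hp, div_le_iff₀ hp, inv_mul_eq_div, le_div_iff₀ (by positivity)]
  have hi : (k.1 i : ℝ) ^ 2 ≤ Freq.sq k := by
    rw [Freq.sq]
    fin_cases i
    · exact le_add_of_nonneg_right (sq_nonneg _)
    · exact le_add_of_nonneg_left (sq_nonneg _)
  refine abs_le_of_sq_le_sq' ?_ hp.le |>.2
  rw [mul_pow, sq_abs, pow_two (Freq.sq k)]
  exact mul_le_mul hi h (by positivity) hp.le

/-- The blocks of the convolution with the Green function. -/
def greenBlock (c : Freq → ℂ) (n : ℕ) : TestFn :=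
  ∑ k ∈ shell n, ((Freq.sq k : ℂ)⁻¹ * symCoeff c k) • mode k.1

theorem sum_smul_mode_apply (s : Finset Freq) (a : Freq → ℂ) (x : E) :
    (∑ k ∈ s, a k • mode k.1 : TestFn).1 x = ∑ k ∈ s, a k * (mode k.1).1 x := by
  rw [AddSubmonoidClass.coe_finsetSum, Finset.sum_apply]
  rfl

theorem greenBlock_apply (c : Freq → ℂ) (n : ℕ) (x : E) :
    (greenBlock c n).1 x = (2 ^ n)⁻¹ * shellSum weight c n x := by
  rw [greenBlock, sum_smul_mode_apply, shellSum, Finset.mul_sum]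
  refine Finset.sum_congr rfl fun k hk => ?_
  rw [mem_shell] at hk
  rw [weight, hk]
  push_cast
  field_simp

theorem deriv_greenBlock_apply (c : Freq → ℂ) (n : ℕ) (i : Fin 2) (x : E) :
    (TestFn.deriv i (greenBlock c n)).1 x = shellSum (weightD i) c n x := by
  rw [greenBlock, map_sum]
  simp only [map_smul, deriv_mode, smul_smul]
  rw [sum_smul_mode_apply, shellSum]
  refine Finset.sum_congr rfl fun k _ => ?_
  rw [weightD]
  push_cast
  ring

theorem lipBound_of_deriv {f : TestFn} {A B : ℝ} (hA : ∀ x, ‖f.1 x‖ ≤ A)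
    (hB : ∀ i x, ‖(TestFn.deriv i f).1 x‖ ≤ B) : LipBound A (2 * B) f.1 := by
  refine ⟨hA, fun x y => convex_univ.norm_image_sub_le_of_norm_fderiv_le
    (fun z _ => f.differentiable z) (fun z _ => ?_) (Set.mem_univ _) (Set.mem_univ _)⟩
  have hB0 : 0 ≤ B := (norm_nonneg _).trans (hB 0 z)
  refine ContinuousLinearMap.opNorm_le_bound _ (by positivity) fun h => ?_
  rw [TestFn.fderiv_apply, Fin.sum_univ_two]
  have key : ∀ i, ‖(h i : ℂ) * (TestFn.deriv i f).1 z‖ ≤ ‖h‖ * B := by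
    intro i
    rw [norm_mul, Complex.norm_real]
    exact mul_le_mul (TestFn.norm_coord_le h i) (hB i z) (norm_nonneg _) (norm_nonneg _)
  refine (norm_add_le _ _).trans ((add_le_add (key 0) (key 1)).trans (le_of_eq ?_))
  ring

/-- The blocks are the shells of the Fourier series of K∗W. Their sup bound comes from `weight`,
after a factor 2^{-n}, and their Lipschitz bound from `weightD`. -/
theorem IsSeries.isBlockSum {c : Freq → ℂ} {η : ℝ} {W : Dist} (h : IsSeries c η W) {C C' : ℝ}
    (hC : ∀ (n : ℕ) x, ‖shellSum weight c n x‖ ≤ C * (n + 1))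
    (hC' : ∀ i (n : ℕ) x, ‖shellSum (weightD i) c n x‖ ≤ C' * (n + 1)) :
    IsBlockSum (green.conv W) := by
  refine ⟨greenBlock c, max C (2 * C'), fun n => ?_, fun φ => ?_⟩
  · have h1 : LipBound (C * ((n : ℕ) + 1) * (2 ^ n)⁻¹) (2 * (C' * (n + 1))) (greenBlock c n).1 := by
      refine lipBound_of_deriv (fun x => ?_) fun i x => ?_
      · rw [greenBlock_apply, norm_mul, norm_inv, norm_pow, Complex.norm_two, mul_comm]
        exact mul_le_mul_of_nonneg_right (hC n x) (by positivity)
      · rw [deriv_greenBlock_apply]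
        exact hC' i n x
    refine ⟨fun x => (h1.1 x).trans ?_, fun x y => (h1.2 x y).trans ?_⟩
    · gcongr
      exact le_max_left _ _
    · rw [← mul_assoc]
      gcongr
      exact le_max_right _ _
  · have h1 := hasSum_shell (h.hasSum_green φ)
    refine h1.congr_fun fun n => ?_
    have e : ofFn (greenBlock c n) =
        ∑ k ∈ shell n, ((Freq.sq k : ℂ)⁻¹ * symCoeff c k) • ofFn (mode k.1) := by
      have hadd : ∀ s : Finset Freq,
          ofFn (∑ k ∈ s, ((Freq.sq k : ℂ)⁻¹ * symCoeff c k) • mode k.1) =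
            ∑ k ∈ s, ((Freq.sq k : ℂ)⁻¹ * symCoeff c k) • ofFn (mode k.1) := by
        intro s
        classical
        induction s using Finset.induction_on with
        | empty => simpa using ofFn_smul 0 0
        | insert a s ha ih => rw [Finset.sum_insert ha, Finset.sum_insert ha, ofFn_add, ofFn_smul, ih]
      exact hadd _
    rw [e, AddSubmonoidClass.coe_finsetSum, LinearMap.sum_apply]
    rfl

/-- Almost surely, the components of a white noise are real, and their convolutions with the
Green function are block sums. -/
theorem IsWhiteNoise.ae_isBlockSum {Ω : Type*} [MeasurableSpace Ω] {P : Measure Ω}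
    [IsProbabilityMeasure P] {v : ℝ≥0} {Z : Set (Fin 3)} {W : Fin 3 → Ω → Dist}
    (hW : IsWhiteNoise P v Z W) : ∀ᵐ w ∂P, ∀ j,
      (∀ φ : TestFn, (W j w).1 φ.conj = starRingEnd ℂ ((W j w).1 φ)) ∧
        IsBlockSum (green.conv (W j w)) := by
  obtain ⟨η, c, -, -, -, -, hre, him, hri, hc, -, hsum⟩ := hW
  have hind : ∀ j, iIndepFun (fun k : Freq => c (k, j)) P := fun j =>
    hc.precomp (g := fun k : Freq => (k, j)) fun k l h => congrArg Prod.fst h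
  have h1 : ∀ᵐ w ∂P, ∀ j, ∃ C, ∀ (n : ℕ) x,
      ‖shellSum weight (fun k => c (k, j) w) n x‖ ≤ C * (n + 1) := ae_all_iff.2 fun j =>
    ae_exists_shellSum_le (fun k => hre (k, j)) (fun k => him (k, j)) (fun k => hri (k, j))
      (hind j) norm_weight_le
  have h2 : ∀ᵐ w ∂P, ∀ j i, ∃ C, ∀ (n : ℕ) x,
      ‖shellSum (weightD i) (fun k => c (k, j) w) n x‖ ≤ C * (n + 1) :=
    ae_all_iff.2 fun j => ae_all_iff.2 fun i =>
      ae_exists_shellSum_le (fun k => hre (k, j)) (fun k => him (k, j)) (fun k => hri (k, j))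
        (hind j) (norm_weightD_le i)
  filter_upwards [h1, h2, hsum] with w g1 g2 g3 j
  have hs : IsSeries (fun k => c (k, j) w) (η j w) (W j w) := g3 j
  obtain ⟨C, hC⟩ := g1 j
  choose C' hC' using g2 j
  refine ⟨hs.apply_conj, hs.isBlockSum hC (C' := max (C' 0) (C' 1)) fun i n x => ?_⟩
  refine (hC' i n x).trans ?_
  gcongr
  fin_cases i
  · exact le_max_left _ _
  · exact le_max_right _ _

/-! ### Real distributions and functions -/

/-- `T` is a real distribution. -/
def Dist.IsReal (T : Dist) : Prop := ∀ φ : TestFn, T.1 φ.conj = starRingEnd ℂ (T.1 φ)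

theorem Dist.IsReal.conj_convFn {T : Dist} (hT : T.IsReal) {f : TestFn} (hf : f.conj = f) :
    (T.convFn f).conj = T.convFn f := by
  ext x
  change starRingEnd ℂ ((T.convFn f).1 x) = (T.convFn f).1 x
  rw [convFn_apply, ← hT]
  change T.1 (TestFn.translate (-x) f.conj.reflect) = _
  rw [hf]

/-- The Fourier coefficients are real and even. -/
theorem isReal_green : green.IsReal := by
  intro φ
  change ∑' k, (greenCoeff k : ℂ) * (ofFn (mode k)).1 φ.conj =
    starRingEnd ℂ (∑' k, (greenCoeff k : ℂ) * (ofFn (mode k)).1 φ)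
  rw [Complex.conj_tsum, ← (Equiv.neg (Fin 2 → ℤ)).tsum_eq]
  refine tsum_congr fun k => ?_
  have h1 : greenCoeff (-k) = greenCoeff k := by simp [greenCoeff]
  rw [Equiv.neg_apply, h1, map_mul, Complex.conj_ofReal, ofFn_apply, ofFn_apply, ← tint_conj]
  refine congrArg (fun z => (greenCoeff k : ℂ) * tint z) (funext fun x => ?_)
  change (mode (-k)).1 x * starRingEnd ℂ (φ.1 x) = starRingEnd ℂ ((mode k).1 x * φ.1 x)
  rw [map_mul, conj_mode_apply]

theorem IsMollifier.conj_scale {ρ : CcFn} (hρ : IsMollifier ρ) (x : E) (r : ℝ) :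
    (ρ.scale x r).conj = ρ.scale x r := by
  ext y
  change starRingEnd ℂ (∑' n, ((r⁻¹ ^ 2 : ℝ) : ℂ) * ρ.toFun (r⁻¹ • (y + lat n - x))) =
    ∑' n, ((r⁻¹ ^ 2 : ℝ) : ℂ) * ρ.toFun (r⁻¹ • (y + lat n - x))
  rw [Complex.conj_tsum]
  refine tsum_congr fun n => ?_
  rw [map_mul, Complex.conj_ofReal, Complex.conj_eq_iff_im.2 (hρ.nonneg _).2]

theorem Dist.IsReal.conj_mollify {T : Dist} (hT : T.IsReal) {ρ : CcFn} (hρ : IsMollifier ρ)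
    (ε : ℝ) : (mollify ρ ε T).conj = mollify ρ ε T :=
  hT.conj_convFn (hρ.conj_scale 0 ε)

/-! ### The field `θ` for smooth functions -/

theorem deriv_constFn (i : Fin 2) (a : ℂ) : TestFn.deriv i (constFn a) = 0 := by
  ext x
  change fderiv ℝ (fun _ : E => a) x _ = 0
  simp

theorem xiPartFn_eq (i : Fin 2) (f : TestFn) :
    xiPartFn i f = (2 : ℂ) • TestFn.deriv i (green.convFn f) := by
  rw [xiPartFn, deriv_convFn]
  rfl

theorem xiPart_eq (i : Fin 2) (T : Dist) : xiPart i T = (2 : ℂ) • (green.conv T).deriv i := by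
  rw [xiPart, ← deriv_conv]
  rfl

theorem xiFn_apply (f : Fin 3 → TestFn) (j : Fin 3) (x : E) :
    (xiFn f j).1 x = 2 * (TestFn.deriv 1 (green.convFn (f j))).1 x +
      2 * Complex.I * (TestFn.deriv 0 (green.convFn (f j))).1 x := by
  rw [deriv_convFn, deriv_convFn]
  change 2 * Complex.I * (((greenD 0).convFn (f j)).1 x -
    Complex.I * ((greenD 1).convFn (f j)).1 x) = _
  change _ = 2 * ((greenD 1).convFn (f j)).1 x + 2 * Complex.I * ((greenD 0).convFn (f j)).1 x
  linear_combination (-2 * ((greenD 1).convFn (f j)).1 x) * Complex.I_sq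

theorem conj_deriv (i : Fin 2) (f : TestFn) :
    (TestFn.deriv i f).conj = TestFn.deriv i f.conj := by
  ext x
  change starRingEnd ℂ (fderiv ℝ f.1 x _) = fderiv ℝ (Complex.conjCLE ∘ f.1) x _
  rw [ContinuousLinearEquiv.comp_fderiv]
  rfl

/-- Since f₁, f₂, f₃ and K are real, the cross product is 8i times a Jacobian of two of the
functions K∗f_k. In the divergence form, the terms containing mixed second derivatives cancel, and
with them the constant `a`. -/
theorem thetaFn_eq {f : Fin 3 → TestFn} (hf : ∀ j, (f j).conj = f j) (j : Fin 3) (a : ℂ) :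
    thetaFn f j = (4 * Complex.I) •
      (TestFn.deriv 0 ((green.convFn (f (j + 1)) - constFn a) * xiPartFn 1 (f (j + 2))) -
        TestFn.deriv 1 ((green.convFn (f (j + 1)) - constFn a) * xiPartFn 0 (f (j + 2)))) := by
  have hreal : ∀ j i x, starRingEnd ℂ ((TestFn.deriv i (green.convFn (f j))).1 x) =
      (TestFn.deriv i (green.convFn (f j))).1 x := by
    intro j i x
    have h := conj_deriv i (green.convFn (f j))
    rw [isReal_green.conj_convFn (hf j)] at h
    exact congrFun (congrArg Subtype.val h) x
  -- The cyclic form of the components of the cross product, with indices modulo 3.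
  have hcross : thetaFn f j = xiFn f (j + 1) * (xiFn f (j + 2)).conj -
      xiFn f (j + 2) * (xiFn f (j + 1)).conj := by
    rw [thetaFn, cross_apply]
    fin_cases j
    · rfl
    · rfl
    · rfl
  rw [hcross, deriv_mul, deriv_mul, map_sub, map_sub, deriv_constFn, deriv_constFn, xiPartFn_eq,
    xiPartFn_eq, map_smul, map_smul, TestFn.deriv_comm 0 1]
  ext x
  change (xiFn f (j + 1)).1 x * starRingEnd ℂ ((xiFn f (j + 2)).1 x) -
      (xiFn f (j + 2)).1 x * starRingEnd ℂ ((xiFn f (j + 1)).1 x) =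
    4 * Complex.I *
      ((((TestFn.deriv 0 (green.convFn (f (j + 1)))).1 x - 0) *
            (2 * (TestFn.deriv 1 (green.convFn (f (j + 2)))).1 x) +
          ((green.convFn (f (j + 1))).1 x - a) *
            (2 * (TestFn.deriv 1 (TestFn.deriv 0 (green.convFn (f (j + 2))))).1 x)) -
        (((TestFn.deriv 1 (green.convFn (f (j + 1)))).1 x - 0) *
            (2 * (TestFn.deriv 0 (green.convFn (f (j + 2)))).1 x) +
          ((green.convFn (f (j + 1))).1 x - a) *
            (2 * (TestFn.deriv 1 (TestFn.deriv 0 (green.convFn (f (j + 2))))).1 x)))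
  simp only [xiFn_apply, map_add, map_mul, hreal, Complex.conj_I, Complex.conj_ofNat]
  ring

theorem constFn_zero : constFn 0 = 0 := map_zero _

theorem green_convFn_mollify (ρ : CcFn) (ε : ℝ) (T : Dist) :
    green.convFn (mollify ρ ε T) = mollify ρ ε (green.conv T) := convFn_convFn _ _ _

theorem ofFn_sub (f g : TestFn) : ofFn (f - g) = ofFn f - ofFn g := by
  rw [eq_sub_iff_add_eq, ← ofFn_add, sub_add_cancel]

theorem ofFn_zero : ofFn 0 = 0 := by simpa using ofFn_smul 0 0

/-! ### Convergence of the products -/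

theorem hzNorm_two_smul_deriv_le {κ : ℝ} (h0 : 0 < κ) (h1 : κ < 1) (T : Dist) (i : Fin 2) :
    hzNorm (-κ) ((2 : ℂ) • T.deriv i) ≤ 2 * hzNorm (1 - κ) T := by
  refine (hzNorm_smul_le _ _ _).trans ?_
  rw [Complex.norm_two, ENNReal.ofReal_ofNat]
  exact mul_le_mul_right (hzNorm_deriv_le h0 h1 T i) _

theorem IsBlockSum.mem_littleHZ {T : Dist} (hT : IsBlockSum T) {κ : ℝ} (h0 : 0 < κ)
    (h1 : κ < 1) : T ∈ littleHZ (1 - κ) :=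
  mem_littleHZ_of_tendsto_mollify h0 h1 (hT.tendsto_hzNorm h0 h1 isMollifier_bump)

/-- For ε > 0 both factors are smooth, so the Young map gives their pointwise product. The constant
cancels in the error of the first factor, and the error of the second is a derivative of the error
for `T`. -/
theorem IsYoungMap.tendsto_mollify {κ : ℝ} (h0 : 0 < κ) (h1 : κ < 1)
    {Y : littleHZ (1 - κ) →ₗ[ℂ] littleHZ (-κ) →ₗ[ℂ] littleHZ (-κ)}
    (hY : IsYoungMap (1 - κ) (-κ) Y) {S T : Dist} (hS : IsBlockSum S) (hT : IsBlockSum T)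
    {ρ : CcFn} (hρ : IsMollifier ρ) (a : ℂ) (i : Fin 2)
    (hf : S - ofFn (constFn a) ∈ littleHZ (1 - κ)) (hg : (2 : ℂ) • T.deriv i ∈ littleHZ (-κ))
    (φ : TestFn) :
    Tendsto (fun ε : ℝ => (ofFn ((mollify ρ ε S - constFn a) *
        (2 : ℂ) • TestFn.deriv i (mollify ρ ε T))).1 φ) (𝓝[>] 0)
      (𝓝 ((Y ⟨_, hf⟩ ⟨_, hg⟩ : Dist).1 φ)) := by
  have hf' : ∀ ε, ofFn (mollify ρ ε S - constFn a) ∈ littleHZ (1 - κ) :=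
    fun ε => ofFn_mem_littleHZ_pos h0 h1 _
  have hg' : ∀ ε, ofFn ((2 : ℂ) • TestFn.deriv i (mollify ρ ε T)) ∈ littleHZ (-κ) :=
    fun ε => ofFn_mem_littleHZ_neg h0 h1 _
  have h := hY.tendsto h0 h1 (f := fun ε => ⟨_, hf' ε⟩) (g := fun ε => ⟨_, hg' ε⟩)
    (f₀ := ⟨_, hf⟩) (g₀ := ⟨_, hg⟩) (l := 𝓝[>] (0 : ℝ)) ?_ ?_ φ
  · refine h.congr fun ε => ?_
    rw [hY.extends_mul]
  · refine (hS.tendsto_hzNorm h0 h1 hρ).congr fun ε => congrArg _ ?_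
    change S - ofFn (mollify ρ ε S) =
      S - ofFn (constFn a) - ofFn (mollify ρ ε S - constFn a)
    rw [ofFn_sub, sub_sub_sub_cancel_right]
  · have h2 := ENNReal.Tendsto.const_mul (a := 2) (hT.tendsto_hzNorm h0 h1 hρ)
      (Or.inr (by simp))
    rw [mul_zero] at h2
    refine tendsto_of_tendsto_of_tendsto_of_le_of_le tendsto_const_nhds h2 (fun _ => bot_le)
      fun ε => ?_
    refine le_trans (le_of_eq (congrArg _ ?_)) (hzNorm_two_smul_deriv_le h0 h1 _ i)
    change (2 : ℂ) • T.deriv i - ofFn ((2 : ℂ) • TestFn.deriv i (mollify ρ ε T)) =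
      (2 : ℂ) • (T - ofFn (mollify ρ ε T)).deriv i
    rw [ofFn_smul, ofFn_deriv]
    refine Subtype.ext (LinearMap.ext fun ψ => ?_)
    change 2 * -T.1 (TestFn.deriv i ψ) - 2 * -(ofFn (mollify ρ ε T)).1 (TestFn.deriv i ψ) =
      2 * -(T.1 (TestFn.deriv i ψ) - (ofFn (mollify ρ ε T)).1 (TestFn.deriv i ψ))
    ring

/-- The fields `θ^ε` converge to the derivatives of the Young products. -/
theorem tendsto_thetaFn {κ : ℝ} (h0 : 0 < κ) (hκ : κ < 1 / 2) {W : Fin 3 → Dist}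
    (hreal : ∀ j, (W j).IsReal) (hW : ∀ j, IsBlockSum (green.conv (W j))) {ρ : CcFn}
    (hρ : IsMollifier ρ) (j : Fin 3) (a : ℂ) :
    ∃ h₁ h₂ : Dist,
      IsYoungProduct (1 - κ) (-κ) (green.conv (W (j + 1)) - ofFn (constFn a))
        (xiPart 1 (W (j + 2))) h₁ ∧
      IsYoungProduct (1 - κ) (-κ) (green.conv (W (j + 1)) - ofFn (constFn a))
        (xiPart 0 (W (j + 2))) h₂ ∧
      ∀ φ, Tendsto (fun ε : ℝ => (ofFn (thetaFn (fun k => mollify ρ ε (W k)) j)).1 φ) (𝓝[>] 0)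
        (𝓝 (((4 * Complex.I) • (h₁.deriv 0 - h₂.deriv 1) : Dist).1 φ)) := by
  have h1 : κ < 1 := by linarith
  have hY := isYoungMap_youngMap h0 hκ
  have hf : green.conv (W (j + 1)) - ofFn (constFn a) ∈ littleHZ (1 - κ) :=
    (littleHZ (1 - κ)).sub_mem ((hW (j + 1)).mem_littleHZ h0 h1) (ofFn_mem_littleHZ_pos h0 h1 _)
  have hg : ∀ i, (2 : ℂ) • (green.conv (W (j + 2))).deriv i ∈ littleHZ (-κ) := fun i =>
    (littleHZ (-κ)).smul_mem _ (deriv_mem_littleHZ h0 h1 ((hW (j + 2)).mem_littleHZ h0 h1) i)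
  refine ⟨youngMap h0 hκ ⟨_, hf⟩ ⟨_, hg 1⟩, youngMap h0 hκ ⟨_, hf⟩ ⟨_, hg 0⟩, ?_, ?_, fun φ => ?_⟩
  · rw [xiPart_eq]
    exact ⟨hf, hg 1, _, hY, rfl⟩
  · rw [xiPart_eq]
    exact ⟨hf, hg 0, _, hY, rfl⟩
  have t := fun (i : Fin 2) ψ => hY.tendsto_mollify h0 h1 (hW (j + 1)) (hW (j + 2)) hρ a i hf
    (hg i) ψ
  -- The outer derivatives act on the test function, each with a sign.
  have t2 := ((t 1 (TestFn.deriv 0 φ)).neg.sub (t 0 (TestFn.deriv 1 φ)).neg).const_mul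
    (4 * Complex.I)
  refine t2.congr fun ε => ?_
  rw [thetaFn_eq (f := fun k => mollify ρ ε (W k)) (fun k => (hreal k).conj_mollify hρ ε) j a, ofFn_smul,
    xiPartFn_eq, xiPartFn_eq, green_convFn_mollify, green_convFn_mollify, ofFn_sub,
    ofFn_deriv, ofFn_deriv]
  rfl

end

end Torus

/-! ### The main theorem -/

theorem mainTheorem6 {Ω : Type*} [MeasurableSpace Ω] (P : MeasureTheory.Measure Ω)
    [MeasureTheory.IsProbabilityMeasure P] (v : ℝ≥0) (Z : Set (Fin 3))
    (W : Fin 3 → Ω → Torus.Dist) (hW : Torus.IsWhiteNoise P v Z W)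
    (ρ : Torus.CcFn) (hρ : Torus.IsMollifier ρ) :
    ∀ᵐ ω ∂P,
      -- the identities for the mollified noise, in the space of smooth functions
      (∀ ε : ℝ, 0 < ε → ∀ w : Fin 3 → Torus.TestFn,
        (∀ j, w j = Torus.mollify ρ ε (W j ω)) →
        ∀ j : Fin 3,
          Torus.thetaFn w j = (4 * Complex.I) •
            (Torus.TestFn.deriv 0
                (Torus.green.convFn (w (j + 1)) * Torus.xiPartFn 1 (w (j + 2))) -
              Torus.TestFn.deriv 1
                (Torus.green.convFn (w (j + 1)) * Torus.xiPartFn 0 (w (j + 2)))) ∧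
          ∀ x : Torus.E, Torus.thetaFn w j = (4 * Complex.I) •
            (Torus.TestFn.deriv 0
                ((Torus.green.convFn (w (j + 1)) -
                    Torus.constFn ((Torus.green.convFn (w (j + 1))).1 x)) *
                  Torus.xiPartFn 1 (w (j + 2))) -
              Torus.TestFn.deriv 1
                ((Torus.green.convFn (w (j + 1)) -
                    Torus.constFn ((Torus.green.convFn (w (j + 1))).1 x)) *
                  Torus.xiPartFn 0 (w (j + 2))))) ∧
      -- the limit
      ∃ θ : Fin 3 → Torus.Dist,
        (∀ (j : Fin 3) (φ : Torus.TestFn),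
          Tendsto (fun ε : ℝ =>
              (Torus.ofFn (Torus.thetaFn (fun k => Torus.mollify ρ ε (W k ω)) j)).1 φ)
            (𝓝[>] 0) (𝓝 ((θ j).1 φ))) ∧
        ∃ u : Fin 3 → Torus.E → ℂ,
          (∀ j, Torus.IsRepresentedBy (Torus.green.conv (W j ω)) (u j)) ∧
          ∀ κ : ℝ, 0 < κ → κ < 1 / 2 → ∀ j : Fin 3,
            (∃ h₁ h₂ : Torus.Dist,
              Torus.IsYoungProduct (1 - κ) (-κ) (Torus.green.conv (W (j + 1) ω))
                (Torus.xiPart 1 (W (j + 2) ω)) h₁ ∧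
              Torus.IsYoungProduct (1 - κ) (-κ) (Torus.green.conv (W (j + 1) ω))
                (Torus.xiPart 0 (W (j + 2) ω)) h₂ ∧
              θ j = (4 * Complex.I) • (h₁.deriv 0 - h₂.deriv 1)) ∧
            ∀ x : Torus.E, ∃ h₁ h₂ : Torus.Dist,
              Torus.IsYoungProduct (1 - κ) (-κ)
                (Torus.green.conv (W (j + 1) ω) - Torus.ofFn (Torus.constFn (u (j + 1) x)))
                (Torus.xiPart 1 (W (j + 2) ω)) h₁ ∧
              Torus.IsYoungProduct (1 - κ) (-κ)
                (Torus.green.conv (W (j + 1) ω) - Torus.ofFn (Torus.constFn (u (j + 1) x)))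
                (Torus.xiPart 0 (W (j + 2) ω)) h₂ ∧
              θ j = (4 * Complex.I) • (h₁.deriv 0 - h₂.deriv 1) := by
  filter_upwards [hW.ae_isBlockSum] with ω hω
  have hreal : ∀ j, (W j ω).IsReal := fun j => (hω j).1
  have hblock : ∀ j, Torus.IsBlockSum (Torus.green.conv (W j ω)) := fun j => (hω j).2
  -- The limit is constructed once, with κ = 1/4 and A = 0; any admissible pair would serve.
  have h4 : (0 : ℝ) < 1 / 4 := by norm_num
  have h42 : (1 / 4 : ℝ) < 1 / 2 := by norm_num
  refine ⟨fun ε _ w hw j => ?_, ?_⟩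
  · have hconj : ∀ k, (w k).conj = w k := fun k => by
      rw [hw k]
      exact (hreal k).conj_mollify hρ ε
    refine ⟨?_, fun x => Torus.thetaFn_eq hconj j _⟩
    have h := Torus.thetaFn_eq hconj j 0
    rwa [Torus.constFn_zero, sub_zero] at h
  · choose g₁ g₂ _ _ hlim using fun j =>
      Torus.tendsto_thetaFn h4 h42 (W := fun k => W k ω) hreal hblock hρ j 0
    choose u hu using fun j => (hblock j).exists_isRepresentedBy
    refine ⟨_, hlim, u, hu, fun κ h0 hκ j => ?_⟩
    -- For every other κ and every constant, the corresponding Young products describe the limit of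
    -- the same fields θ^ε, so uniqueness of limits identifies them with θ.
    have key : ∀ a : ℂ, ∃ h₁ h₂ : Torus.Dist,
        Torus.IsYoungProduct (1 - κ) (-κ)
          (Torus.green.conv (W (j + 1) ω) - Torus.ofFn (Torus.constFn a))
          (Torus.xiPart 1 (W (j + 2) ω)) h₁ ∧
        Torus.IsYoungProduct (1 - κ) (-κ)
          (Torus.green.conv (W (j + 1) ω) - Torus.ofFn (Torus.constFn a))
          (Torus.xiPart 0 (W (j + 2) ω)) h₂ ∧
        (4 * Complex.I) • ((g₁ j).deriv 0 - (g₂ j).deriv 1) =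
          (4 * Complex.I) • (h₁.deriv 0 - h₂.deriv 1) := by
      intro a
      obtain ⟨h₁, h₂, hy₁, hy₂, hl⟩ :=
        Torus.tendsto_thetaFn h0 hκ (W := fun k => W k ω) hreal hblock hρ j a
      exact ⟨h₁, h₂, hy₁, hy₂, Subtype.ext (LinearMap.ext fun φ =>
        tendsto_nhds_unique (hlim j φ) (hl φ))⟩
    refine ⟨?_, fun x => key _⟩
    have h := key 0
    rwa [Torus.constFn_zero, Torus.ofFn_zero, sub_zero] at h
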